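/- Let $N,p\ge 1$ be integers, let $\beta_1,\dots,\beta_N>0$ and $\gamma>\sum_{j=1}^N 1/\beta_j$, and put $$H_j=\frac{\beta_j}{2}\Big(\gamma-\sum_{i=1}^N\frac1{\beta_i}\Big),\qquad \overline H_j=\min\{1,H_j\}\qquad(1\le j\le N),$$ where the coordinates are ordered so that $H_1\le H_2\le\dots\le H_N$. Let $f\ge 0$ be a measurable function on $\mathbb R^N$ such that the measure $f(\lambda)\,d\lambda$ is symmetric, $\int_{\mathbb R^N}\frac{|\lambda|^2}{1+|\lambda|^2}f(\lambda)\,d\lambda<\infty$, and for some constants $c_1,c_2,c_3>0$ $$\frac{c_1}{\big(\sum_{j=1}^N|\lambda_j|^{\beta_j}\big)^{\gamma}}\le f(\lambda)\le\frac{c_2}{\big(\sum_{j=1}^N|\lambda_j|^{\beta_j}\big)^{\gamma}}\qquad\text{for all }\lambda\in\mathbb R^N\text{ with }|\lambda|\ge c_3.$$ Let $X=\{X(t),t\in\mathbb R^N\}$ be a real-valued centered Gaussian random field with $X(0)=0$ a.s., with stationary increments and with spectral density $f$, i.e. $$\mathbb E[X(s)X(t)]=\int_{\mathbb R^N}\big(e^{i\langle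 s,\lambda\rangle}-1\big)\big(e^{-i\langle t,\lambda\rangle}-1\big)f(\lambda)\,d\lambda\qquad(s,t\in\mathbb R^N).$$ Let $\mathbf X(t)=(X_1(t),\dots,X_p(t))$, $t\in\mathbb R^N$, where $X_1,\dots,X_p$ are independent copies of $X$ with almost surely continuous sample functions. Write $\dim$ for Hausdorff dimension. (i) With probability $1$, $$\dim \mathbf X([0,1]^N)=\min\Big\{p,\ \sum_{j=1}^N\frac1{\overline H_j}\Big\}$$ and $$\dim\{(t,\mathbf X(t)):t\in[0,1]^N\}=\min\Big\{\min_{1\le k\le N}\Big(\sum_{j=1}^k\frac{\overline H_k}{\overline H_j}+N-k+(1-\overline H_k)p\Big),\ \sum_{j=1}^N\frac1{\overline H_j}\Big\}.$$ (ii) If in addition $H_j\le 1$ for all $j$ and $\sum_{j=1}^N 1/H_j>p$, then for every $x\in\mathbb R^p$, with positive probability, $$\dim\{t\in\mathbb R^N:\mathbf X(t)=x\}=\min_{1\le k\le N}\Big(\sum_{j=1}^k\frac{H_k}{H_j}+N-k-H_k\,p\Big).$$ -/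

import Mathlib

open MeasureTheory ProbabilityTheory
open scoped ENNReal

noncomputable section

namespace AnisoField

/-- The measure `F(dξ) = f(ξ) dξ` on `ℝ^N` with density `f`. -/
def spectralMeasure {N : ℕ} (f : EuclideanSpace ℝ (Fin N) → ℝ) :
    Measure (EuclideanSpace ℝ (Fin N)) :=
  volume.withDensity fun ξ => ENNReal.ofReal (f ξ)

/-- `f` is a legitimate spectral density: a non-negative measurable function such that
`F(dξ) = f(ξ) dξ` is symmetric and `∫ |ξ|² / (1 + |ξ|²) F(dξ) < ∞`. -/
structure IsLegitimateSpectralDensity {N : ℕ} (f : EuclideanSpace ℝ (Fin N) → ℝ) : Prop where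
  measurable : Measurable f
  nonneg : ∀ ξ, 0 ≤ f ξ
  symmetric : (spectralMeasure f).map (fun ξ => -ξ) = spectralMeasure f
  integrable : Integrable (fun ξ => ‖ξ‖ ^ 2 / (1 + ‖ξ‖ ^ 2)) (spectralMeasure f)

/-- The process `t ↦ X(t + h) - X(h)` has the same finite dimensional distributions (equivalently,
the same law on the product σ-algebra) as `t ↦ X(t) - X(0)`, for every `h`. -/
def HasStationaryIncrements {N : ℕ} {Ω : Type*} [MeasurableSpace Ω]
    (X : EuclideanSpace ℝ (Fin N) → Ω → ℝ) (P : Measure Ω) : Prop :=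
  ∀ h : EuclideanSpace ℝ (Fin N),
    IdentDistrib (fun ω t => X (t + h) ω - X h ω) (fun ω t => X t ω - X 0 ω) P P

/-- `X` is a real-valued centered Gaussian field on `ℝ^N` with `X(0) = 0`, stationary increments
and spectral density `f`, i.e.
`E[X(s) X(t)] = ∫ (exp(i⟨s,ξ⟩) - 1) (exp(-i⟨t,ξ⟩) - 1) f(ξ) dξ`. -/
structure IsSIGaussianField {N : ℕ} {Ω : Type*} [MeasurableSpace Ω]
    (X : EuclideanSpace ℝ (Fin N) → Ω → ℝ) (P : Measure Ω)
    (f : EuclideanSpace ℝ (Fin N) → ℝ) : Prop where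
  gaussian : IsGaussianProcess X P
  centered : ∀ t, ∫ ω, X t ω ∂P = 0
  zero : ∀ᵐ ω ∂P, X 0 ω = 0
  stationaryIncrements : HasStationaryIncrements X P
  density : IsLegitimateSpectralDensity f
  covariance : ∀ s t, ((∫ ω, X s ω * X t ω ∂P : ℝ) : ℂ) =
    ∫ ξ, (Complex.exp (Complex.I * (inner ℝ s ξ : ℝ)) - 1) *
      (Complex.exp (-(Complex.I * (inner ℝ t ξ : ℝ))) - 1) ∂(spectralMeasure f)

/-- The condition on the spectral density: `γ > ∑ 1/β_j` and, for `|ξ|` large, `f(ξ)` is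
comparable to `(∑ |ξ_j|^{β_j})^{-γ}`. -/
structure SpectralCondition {N : ℕ} (β : Fin N → ℝ) (γ : ℝ)
    (f : EuclideanSpace ℝ (Fin N) → ℝ) : Prop where
  beta_pos : ∀ j, 0 < β j
  gamma_pos : 0 < γ
  gamma_gt : ∑ j, 1 / β j < γ
  bounds : ∃ c₁ c₂ c₃ : ℝ, 0 < c₁ ∧ 0 < c₂ ∧ 0 < c₃ ∧
    ∀ ξ : EuclideanSpace ℝ (Fin N), c₃ ≤ ‖ξ‖ →
      c₁ / (∑ j, |ξ j| ^ β j) ^ γ ≤ f ξ ∧ f ξ ≤ c₂ / (∑ j, |ξ j| ^ β j) ^ γ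

/-- `H_j = (β_j / 2) (γ - ∑ 1/β_i)`. -/
def hurst {N : ℕ} (β : Fin N → ℝ) (γ : ℝ) (j : Fin N) : ℝ :=
  β j / 2 * (γ - ∑ i, 1 / β i)

/-- `H̄_j = 1 ∧ H_j`. -/
def hurstBar {N : ℕ} (β : Fin N → ℝ) (γ : ℝ) (j : Fin N) : ℝ :=
  min 1 (hurst β γ j)

/-- `X_1, …, X_p` are independent (as processes), and each has the same finite dimensional
distributions as `Y`. -/
structure IsIndependentCopies {N p : ℕ} {Ω Ω' : Type*} [MeasurableSpace Ω] [MeasurableSpace Ω']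
    (X : Fin p → EuclideanSpace ℝ (Fin N) → Ω → ℝ) (P : Measure Ω)
    (Y : EuclideanSpace ℝ (Fin N) → Ω' → ℝ) (P' : Measure Ω') : Prop where
  indep : iIndepFun (fun i ω t => X i t ω) P
  identDistrib : ∀ i, IdentDistrib (fun ω t => X i t ω) (fun ω t => Y t ω) P P'

/-- The sample function `t ↦ (X_1(t), …, X_p(t))` at `ω`. -/
def path {N p : ℕ} {Ω : Type*} (X : Fin p → EuclideanSpace ℝ (Fin N) → Ω → ℝ) (ω : Ω)
    (t : EuclideanSpace ℝ (Fin N)) : EuclideanSpace ℝ (Fin p) :=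
  WithLp.toLp 2 fun i => X i t ω

/-- The cube `[0,1]^N`. -/
def unitCube (N : ℕ) : Set (EuclideanSpace ℝ (Fin N)) :=
  {t | ∀ j, 0 ≤ t j ∧ t j ≤ 1}

/-- The graph of `g` over `A`, in `ℝ^N × ℝ^p = ℝ^{N+p}` with its Euclidean metric. -/
def graphOver {N p : ℕ} (g : EuclideanSpace ℝ (Fin N) → EuclideanSpace ℝ (Fin p))
    (A : Set (EuclideanSpace ℝ (Fin N))) :
    Set (WithLp 2 (EuclideanSpace ℝ (Fin N) × EuclideanSpace ℝ (Fin p))) :=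
  (fun t => WithLp.toLp 2 (t, g t)) '' A

/-- `min {p; ∑ 1/h_j}`. -/
def rangeDim {N : ℕ} (p : ℕ) (h : Fin N → ℝ) : ℝ :=
  min (p : ℝ) (∑ j, 1 / h j)

/-- `min_{1 ≤ k ≤ N} {∑_{j ≤ k} h_k/h_j + N - k + (1 - h_k) p; ∑_j 1/h_j}`. The index `k : Fin N`
is zero-based, so it stands for `k + 1` in the formula. -/
def graphDim {N : ℕ} (p : ℕ) (h : Fin N → ℝ) : ℝ :=
  min (⨅ k : Fin N, (∑ j ∈ Finset.Iic k, h k / h j + ((N : ℝ) - ((k : ℕ) + 1 : ℝ))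
    + (1 - h k) * p)) (∑ j, 1 / h j)

/-- `min_{1 ≤ k ≤ N} {∑_{j ≤ k} h_k/h_j + N - k - h_k p}`, with the same indexing. -/
def levelDim {N : ℕ} (p : ℕ) (h : Fin N → ℝ) : ℝ :=
  ⨅ k : Fin N, (∑ j ∈ Finset.Iic k, h k / h j + ((N : ℝ) - ((k : ℕ) + 1 : ℝ)) - h k * p)

end AnisoField

end

/-! ### Hausdorff dimension: coverings from above, energies from below -/

namespace AnisoField

open Filter Topology Metric Set
open scoped NNReal

/-! Everything is governed by the variogram v(h) = E(X(t+h) - X(t))² = ∫ 2(1 - cos⟨h,λ⟩) f(λ) dλ.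
Near 0 it dominates every |h_j|^(2H̄_j) up to a constant (`exists_le_variogram`, by integrating over
anisotropic frequency boxes), and it is at most a constant times ∑ |h_j|^(2a_j) as soon as a_j <
H̄_j for all j (`exists_variogram_le`, by fractional moments of f). The cap at 1 in H̄_j appears
because 1 - cos is at most quadratic.

Upper bounds. Gaussian tails and chaining on grids of anisotropic mesh give |X(s) - X(t)| ≤ K ∑ |s_j
- t_j|^(a_j) almost surely (`ae_holder_of_variogramUpper`). Cells of sides 2^(-n/a_j) have images of
size 2^(-n), which yields ∑ 1/H̄_j. The k-th term of the minima comes from cells of sides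
2^(-nH_k/H_j) for j ≤ k and 2^(-n) for j > k. There are about 2^(n(∑_{j≤k} H_k/H_j + N - k)) of
them, and X oscillates on each by about 2^(-nH_k). The graph over one cell therefore needs
2^(n(1-H_k)p) cubes of side 2^(-n), while the level set meets a given cell with probability about
2^(-nH_k p).

Lower bounds. These use Frostman energies summed over dyadic scales, ∑ 2^(mγ) (μ×μ){dist ≤ 2^(-m)}
(`le_dimH_of_dyadicEnergy`). The probability of |X(s) - X(t)| ≤ ρ is at most (ρ/√v(s-t))^q for q ≤
p. Splitting q = ∑ w_j and using the j-th lower bound of v in the j-th factor bounds it by ρ^q ∏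
|s_j - t_j|^(-H_j w_j). This is integrable if H_j w_j < 1, and over a cube of side r its integral
scales as r^(N - ∑ H_j w_j). Filling the coordinates greedily turns this exponent into one of the
terms of the minimum (`exists_weights`).

Level sets. Lebesgue measure on {|X - x| ≤ 2^(-n)}, rescaled by 2^(np), is an approximate local
time. Its second moment requires the conditional variance of X(t) given X(s) to be comparable to
v(t-s). When all H_j ≤ 1, v(h)/|h|² tends to infinity, so most of the variance of a small increment
sits at high frequencies, whereas that of X(s) sits at bounded ones; a Cauchy–Schwarz inequality
localized in frequency makes the two nearly uncorrelated (`exists_cross_le`). Paley–Zygmund and a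
limsup of events then give one event of positive probability serving all exponents below the target
(`exists_measure_frequently_pos`). The energy criterion accepts a sequence of measures concentrating
on a compact set, so no limiting local time has to be extracted. -/

/-- Upper bound of the Hausdorff dimension through finite covers with controlled cardinality. -/
theorem dimH_le_of_cover {E ι : Type*} [EMetricSpace E] {s : Set E} {d : ℝ≥0} {C : ℝ≥0∞}
    (hC : C ≠ ⊤) {r : ℕ → ℝ≥0∞} (hr : Tendsto r atTop (𝓝 0)) (T : ℕ → Finset ι)
    (t : ℕ → ι → Set E) (hdiam : ∀ᶠ n in atTop, ∀ i ∈ T n, ediam (t n i) ≤ r n)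
    (hcover : ∀ᶠ n in atTop, s ⊆ ⋃ i ∈ T n, t n i)
    (hcard : ∃ᶠ n in atTop, (T n).card * r n ^ (d : ℝ) ≤ C) : dimH s ≤ d := by
  borelize E
  refine dimH_le_of_hausdorffMeasure_ne_top (ne_top_of_le_ne_top hC ?_)
  have h := Measure.hausdorffMeasure_le_liminf_sum (d : ℝ) s (l := atTop) (ι := fun n => T n) r hr
    (fun n i => t n i) (by filter_upwards [hdiam] with n hn i using hn i i.2)
    (by filter_upwards [hcover] with n hn
        intro x hx
        obtain ⟨i, hi, hxi⟩ := by simpa using hn hx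
        exact mem_iUnion.2 ⟨⟨i, hi⟩, hxi⟩)
  -- Only a liminf has to be bounded, so the cardinality estimate is needed along a subsequence
  -- only.
  refine h.trans (liminf_le_of_frequently_le' ?_)
  refine (hcard.and_eventually hdiam).mono fun n hn => le_trans ?_ hn.1
  calc ∑ i : T n, ediam (t n i) ^ (d : ℝ) ≤ ∑ i : T n, r n ^ (d : ℝ) :=
        Finset.sum_le_sum fun i _ => ENNReal.rpow_le_rpow (hn.2 i i.2) d.2
    _ = _ := by simp

/-- The dyadic energy of a measure. -/
noncomputable def dyadicEnergy {E : Type*} [PseudoMetricSpace E] [MeasurableSpace E] (γ : ℝ)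
    (μ : Measure E) : ℝ≥0∞ :=
  ∑' m : ℕ, ENNReal.ofReal (2 ^ (m * γ)) * ∫⁻ x, μ (closedBall x ((1 / 2) ^ m)) ∂μ

theorem measurable_measure_closedBall {E : Type*} [PseudoMetricSpace E] [MeasurableSpace E]
    [BorelSpace E] [SecondCountableTopology E] (μ : Measure E) [IsFiniteMeasure μ] (r : ℝ) :
    Measurable fun x => μ (closedBall x r) := by
  have : MeasurableSet {q : E × E | dist q.2 q.1 ≤ r} :=
    (isClosed_le (continuous_snd.dist continuous_fst) continuous_const).measurableSet
  exact measurable_measure_prodMk_left this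

/-- Small enlargements of the members of a cover by dyadic balls. -/
theorem exists_open_superset_dyadic {E : Type*} [MetricSpace E] {γ : ℝ} (hγ : 0 < γ)
    {t : Set E} (ht : ediam t ≤ ENNReal.ofReal (1 / 8)) {η : ℝ≥0} (hη : 0 < η) :
    ∃ (V : Set E) (m : ℕ), IsOpen V ∧ t ⊆ V ∧
      (∀ x ∈ V, V ⊆ closedBall x ((1 / 2) ^ m)) ∧
      (V.Nonempty → ENNReal.ofReal ((1 / 2) ^ (m * γ)) ≤
        ENNReal.ofReal (8 ^ γ) * ((⨆ _ : t.Nonempty, ediam t ^ γ) + η)) := by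
  rcases t.eq_empty_or_nonempty with rfl | hne
  · exact ⟨∅, 0, isOpen_empty, Subset.rfl, by simp, by simp⟩
  obtain ⟨y, hy⟩ := hne
  have htop : ediam t ≠ ⊤ := ne_top_of_le_ne_top ENNReal.ofReal_ne_top ht
  -- A floor for the radius: pieces of zero or tiny diameter are inflated to at most η^(1/γ), which
  -- costs at most η in the γ-sum.
  set e : ℝ := min (1 / 8) ((η : ℝ) ^ (1 / γ)) with he
  have he0 : 0 < e := lt_min (by norm_num) (Real.rpow_pos_of_pos (by exact_mod_cast hη) _)
  set ρ : ℝ := max (ediam t).toReal e with hρ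
  have hρ0 : 0 < ρ := lt_max_of_lt_right he0
  have hd8 : (ediam t).toReal ≤ 1 / 8 := ENNReal.toReal_le_of_le_ofReal (by norm_num) ht
  have hρ8 : ρ ≤ 1 / 8 := max_le hd8 (min_le_left _ _)
  -- The ball of radius 2ρ has diameter at most 4ρ, and 2^(-m) is the dyadic scale just above it.
  obtain ⟨m, hm1, hm2⟩ := exists_nat_pow_near_of_lt_one (x := 4 * ρ) (y := (1 / 2 : ℝ))
    (by positivity) (by linarith) (by norm_num) (by norm_num)
  refine ⟨ball y (2 * ρ), m, isOpen_ball, fun x hx => ?_, fun x hx z hz => ?_, fun _ => ?_⟩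
  · have : edist x y ≤ ediam t := edist_le_ediam_of_mem hx hy
    have h2 : dist x y ≤ (ediam t).toReal := by
      rw [dist_edist]; exact ENNReal.toReal_mono htop this
    have h3 : (ediam t).toReal ≤ ρ := le_max_left _ _
    simp only [mem_ball]; linarith
  · simp only [mem_ball, mem_closedBall] at *
    have := dist_triangle_right z x y
    linarith
  · have hiS : (⨆ _ : t.Nonempty, ediam t ^ γ) = ediam t ^ γ := by
      simp [show t.Nonempty from ⟨y, hy⟩]
    rw [hiS]
    have h1 : (1 / 2 : ℝ) ^ m ≤ 8 * ρ := by rw [pow_succ] at hm1; linarith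
    have h2 : ((1 / 2 : ℝ) ^ (m * γ)) ≤ 8 ^ γ * ρ ^ γ := by
      rw [← Real.mul_rpow (by norm_num) hρ0.le, Real.rpow_mul (by norm_num), Real.rpow_natCast]
      exact Real.rpow_le_rpow (by positivity) h1 hγ.le
    have h3 : ENNReal.ofReal (ρ ^ γ) ≤ ediam t ^ γ + η := by
      rcases max_choice (ediam t).toReal e with h | h
      · rw [hρ, h, ← ENNReal.ofReal_rpow_of_nonneg ENNReal.toReal_nonneg hγ.le,
          ENNReal.ofReal_toReal htop]
        exact le_self_add
      · rw [hρ, h]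
        have : e ^ γ ≤ η := by
          calc e ^ γ ≤ ((η : ℝ) ^ (1 / γ)) ^ γ :=
                Real.rpow_le_rpow he0.le (min_le_right _ _) hγ.le
            _ = η := by rw [← Real.rpow_mul η.coe_nonneg, one_div_mul_cancel hγ.ne', Real.rpow_one]
        calc ENNReal.ofReal (e ^ γ) ≤ ENNReal.ofReal η := ENNReal.ofReal_le_ofReal this
          _ = η := ENNReal.ofReal_coe_nnreal
          _ ≤ _ := le_add_self
    calc ENNReal.ofReal ((1 / 2) ^ (m * γ)) ≤ ENNReal.ofReal (8 ^ γ * ρ ^ γ) :=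
          ENNReal.ofReal_le_ofReal h2
      _ = ENNReal.ofReal (8 ^ γ) * ENNReal.ofReal (ρ ^ γ) := ENNReal.ofReal_mul (by positivity)
      _ ≤ _ := by gcongr

/-- One term of a series is at most its sum: a bounded potential at `x` forces Frostman growth of
all dyadic balls centred at `x`. -/
theorem two_rpow_mul_le_of_sum_le {E : Type*} [PseudoMetricSpace E] [MeasurableSpace E] {γ : ℝ}
    {μ : Measure E} {M : ℝ≥0∞} {x : E}
    (h : ∑' m : ℕ, ENNReal.ofReal (2 ^ (m * γ)) * μ (closedBall x ((1 / 2) ^ m)) ≤ M) (m : ℕ) :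
    μ (closedBall x ((1 / 2) ^ m)) ≤ M * ENNReal.ofReal ((1 / 2) ^ (m * γ)) := by
  have h1 := (ENNReal.le_tsum m).trans h
  have h2 : ENNReal.ofReal (2 ^ (m * γ)) * ENNReal.ofReal ((1 / 2) ^ (m * γ)) = 1 := by
    rw [← ENNReal.ofReal_mul (by positivity), ← Real.mul_rpow (by norm_num) (by norm_num)]
    norm_num
  calc μ (closedBall x ((1 / 2) ^ m))
      = (ENNReal.ofReal (2 ^ (m * γ)) * μ (closedBall x ((1 / 2) ^ m)))
        * ENNReal.ofReal ((1 / 2) ^ (m * γ)) := by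
        rw [mul_right_comm, h2, one_mul]
    _ ≤ _ := by gcongr

/-- Frostman's energy method along a sequence of measures concentrating on a compact set. -/
theorem le_dimH_of_dyadicEnergy {E : Type*} [MetricSpace E] [MeasurableSpace E] [BorelSpace E]
    [SecondCountableTopology E] {K : Set E} (hK : IsCompact K) {γ : ℝ≥0} (hγ : 0 < γ)
    (μ : ℕ → Measure E) [∀ n, IsFiniteMeasure (μ n)] {c L : ℝ≥0} (hc : 0 < c)
    (hconc : ∀ U, IsOpen U → K ⊆ U → ∀ᶠ n in atTop, μ n Uᶜ = 0)
    (hfreq : ∃ᶠ n in atTop, c ≤ μ n univ ∧ dyadicEnergy γ (μ n) ≤ L) : γ ≤ dimH K := by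
  by_contra! hlt
  have hzero : Measure.hausdorffMeasure (γ : ℝ) K = 0 := hausdorffMeasure_of_dimH_lt hlt
  have hγ' : (0 : ℝ) < γ := by exact_mod_cast hγ
  -- By Markov's inequality, points with potential at least `M` carry mass at most L/M ≤ c/4.
  set M : ℝ≥0 := 4 * L / c + 1 with hM
  have hM0 : 0 < M := by positivity
  set B : ℝ≥0 := ⟨8 ^ (γ : ℝ), by positivity⟩ with hB
  have hB0 : 0 < B := by
    rw [← NNReal.coe_pos]; change (0 : ℝ) < 8 ^ (γ : ℝ); positivity
  have hBof : ENNReal.ofReal (8 ^ (γ : ℝ)) = B := by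
    rw [ENNReal.ofReal, Real.toNNReal_of_nonneg (by positivity)]; rfl
  -- Makes M·B·(η + η) equal to c/4; one η pays for the cover, the other for its enlargement to open
  -- sets.
  set η : ℝ≥0 := c / (8 * M * B) with hη
  have hη0 : 0 < η := by positivity
  obtain ⟨t, htK, htd, hts⟩ : ∃ t : ℕ → Set E, K ⊆ ⋃ n, t n ∧
      (∀ n, ediam (t n) ≤ ENNReal.ofReal (1 / 8)) ∧
      ∑' n, ⨆ _ : (t n).Nonempty, ediam (t n) ^ (γ : ℝ) < η := by
    rw [Measure.hausdorffMeasure_apply] at hzero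
    have h1 : (⨅ (t : ℕ → Set E) (_ : K ⊆ ⋃ n, t n)
        (_ : ∀ n, ediam (t n) ≤ ENNReal.ofReal (1 / 8)),
        ∑' n, ⨆ _ : (t n).Nonempty, ediam (t n) ^ (γ : ℝ)) < η := by
      refine lt_of_le_of_lt ?_ (ENNReal.coe_pos.2 hη0)
      rw [← hzero]
      exact le_iSup₂ (f := fun (r : ℝ≥0∞) (_ : 0 < r) => ⨅ (t : ℕ → Set E) (_ : K ⊆ ⋃ n, t n)
        (_ : ∀ n, ediam (t n) ≤ r), ∑' n, ⨆ _ : (t n).Nonempty, ediam (t n) ^ (γ : ℝ))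
        (ENNReal.ofReal (1 / 8)) (by simp)
    simp only [iInf_lt_iff] at h1
    obtain ⟨t, h1, h2, h3⟩ := h1
    exact ⟨t, h1, h2, h3⟩
  obtain ⟨ε, hε0, hεsum⟩ := ENNReal.exists_pos_sum_of_countable (ε := (η : ℝ≥0∞))
    (by exact_mod_cast hη0.ne') ℕ
  choose V m hVo htV hVb hVs using fun n =>
    exists_open_superset_dyadic hγ' (htd n) (hε0 n)
  -- Compactness gives a finite open cover, on which `μ n` eventually lives; this replaces the
  -- passage to a weak limit.
  obtain ⟨F, hF⟩ := hK.elim_finite_subcover V hVo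
    (htK.trans (iUnion_mono htV))
  set U := ⋃ i ∈ F, V i with hU
  obtain ⟨n, ⟨hcn, hLn⟩, hUn⟩ := (hfreq.and_eventually
    (hconc U (isOpen_biUnion fun i _ => hVo i) hF)).exists
  set φ : E → ℝ≥0∞ := fun x =>
    ∑' m : ℕ, ENNReal.ofReal (2 ^ (m * (γ : ℝ))) * μ n (closedBall x ((1 / 2) ^ m)) with hφ
  have hφm : Measurable φ := Measurable.tsum fun k =>
    (measurable_measure_closedBall (μ n) _).const_mul _
  have hφL : ∫⁻ x, φ x ∂(μ n) ≤ L := by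
    rw [hφ, lintegral_tsum fun k =>
      ((measurable_measure_closedBall (μ n) _).const_mul _).aemeasurable]
    refine le_trans (le_of_eq ?_) hLn
    refine tsum_congr fun k => ?_
    rw [lintegral_const_mul _ (measurable_measure_closedBall (μ n) _)]
  have hA : μ n {x | (M : ℝ≥0∞) ≤ φ x} ≤ (c / 4 : ℝ≥0) := by
    have h1 := (mul_meas_ge_le_lintegral hφm (M : ℝ≥0∞)).trans hφL
    have h2 : (L : ℝ≥0∞) ≤ M * (c / 4 : ℝ≥0) := by
      have : L ≤ M * (c / 4) := by
        rw [hM, add_mul, one_mul]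
        have : 4 * L / c * (c / 4) = L := by field_simp
        rw [this]; exact le_self_add
      exact_mod_cast this
    exact (ENNReal.mul_le_mul_iff_right (by exact_mod_cast hM0.ne') ENNReal.coe_ne_top).1
      (h1.trans h2)
  -- If `V i` contains a point of small potential, it lies in a dyadic ball about that point, whose
  -- mass is controlled.
  have hV : ∀ i, μ n (V i \ {x | (M : ℝ≥0∞) ≤ φ x}) ≤
      M * (B * ((⨆ _ : (t i).Nonempty, ediam (t i) ^ (γ : ℝ)) + ε i)) := by
    intro i
    rcases (V i \ {x | (M : ℝ≥0∞) ≤ φ x}).eq_empty_or_nonempty with h | ⟨x, hxV, hxφ⟩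
    · rw [h]; simp
    · have h1 := two_rpow_mul_le_of_sum_le (le_of_lt (not_le.1 hxφ)) (m i)
      calc μ n (V i \ {x | (M : ℝ≥0∞) ≤ φ x}) ≤ μ n (closedBall x ((1 / 2) ^ m i)) :=
            measure_mono (sdiff_subset.trans (hVb i x hxV))
        _ ≤ _ := h1
        _ ≤ _ := by
          gcongr
          have := hVs i ⟨x, hxV⟩
          rwa [hBof] at this
  have hsum : ∑ i ∈ F, μ n (V i \ {x | (M : ℝ≥0∞) ≤ φ x}) ≤ (c / 4 : ℝ≥0) := by
    calc ∑ i ∈ F, μ n (V i \ {x | (M : ℝ≥0∞) ≤ φ x})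
        ≤ ∑ i ∈ F, M * (B * ((⨆ _ : (t i).Nonempty, ediam (t i) ^ (γ : ℝ)) + ε i)) :=
          Finset.sum_le_sum fun i _ => hV i
      _ ≤ ∑' i, M * (B * ((⨆ _ : (t i).Nonempty, ediam (t i) ^ (γ : ℝ)) + ε i)) :=
          ENNReal.sum_le_tsum _
      _ = M * (B * (∑' i, (⨆ _ : (t i).Nonempty, ediam (t i) ^ (γ : ℝ)) + ∑' i, (ε i : ℝ≥0∞))) := by
          rw [ENNReal.tsum_mul_left, ENNReal.tsum_mul_left, ENNReal.tsum_add]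
      _ ≤ M * (B * (η + η)) := by gcongr
      _ = (c / 4 : ℝ≥0) := by
          have : M * (B * (η + η)) = c / 4 := by rw [hη]; field_simp; norm_num
          rw [← this]; push_cast; rfl
  have hfin : (c : ℝ≥0∞) ≤ (c / 4 + c / 4 : ℝ≥0) := by
    calc (c : ℝ≥0∞) ≤ μ n univ := hcn
      _ ≤ μ n ((⋃ i ∈ F, (V i \ {x | (M : ℝ≥0∞) ≤ φ x})) ∪ Uᶜ ∪ {x | (M : ℝ≥0∞) ≤ φ x}) := by
          refine measure_mono fun x _ => ?_
          by_cases hx : (M : ℝ≥0∞) ≤ φ x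
          · exact Or.inr hx
          · by_cases hxU : x ∈ U
            · obtain ⟨i, hi, hxi⟩ := by simpa [hU] using hxU
              exact Or.inl (Or.inl (mem_biUnion hi ⟨hxi, hx⟩))
            · exact Or.inl (Or.inr hxU)
      _ ≤ μ n (⋃ i ∈ F, (V i \ {x | (M : ℝ≥0∞) ≤ φ x})) + μ n Uᶜ +
            μ n {x | (M : ℝ≥0∞) ≤ φ x} :=
          (measure_union_le _ _).trans (add_le_add_left (measure_union_le _ _) _)
      _ ≤ (c / 4 : ℝ≥0) + 0 + (c / 4 : ℝ≥0) := by
          gcongr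
          · exact (measure_biUnion_finset_le _ _).trans hsum
          · exact hUn.le
      _ = _ := by push_cast; ring
  have : c ≤ c / 4 + c / 4 := by exact_mod_cast hfin
  have h' : (c : ℝ) ≤ c / 4 + c / 4 := by exact_mod_cast this
  have : (0 : ℝ) < c := by exact_mod_cast hc
  linarith

end AnisoField

namespace AnisoField

open Filter Topology Metric Set
open scoped NNReal

/-! ### Product integrals -/

theorem lintegral_pi_prod {N : ℕ} (g : Fin N → ℝ → ℝ≥0∞) (hg : ∀ j, Measurable (g j)) :
    ∫⁻ x : Fin N → ℝ, ∏ j, g j (x j) = ∏ j, ∫⁻ y, g j y := by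
  induction N with
  | zero => simp [volume_pi]
  | succ n ih =>
    have h := (volume_preserving_piFinSuccAbove (fun _ : Fin (n + 1) => ℝ) 0).symm
    rw [← h.lintegral_comp_emb (MeasurableEquiv.measurableEmbedding _)]
    simp_rw [MeasurableEquiv.piFinSuccAbove_symm_apply, Fin.insertNthEquiv,
      Fin.prod_univ_succ, Fin.insertNth_zero]
    simp only [Equiv.coe_fn_mk, Fin.cons_zero, Fin.cons_succ, cast_eq]
    rw [Measure.volume_eq_prod, lintegral_prod_mul (f := g 0)
      (g := fun x : Fin n → ℝ => ∏ i : Fin n, g i.succ (x i)) (hg 0).aemeasurable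
      (Finset.measurable_fun_prod _ fun i _ =>
        (hg i.succ).comp (measurable_pi_apply i)).aemeasurable, ih _ fun j => hg j.succ]

theorem lintegral_euclidean_prod {N : ℕ} (g : Fin N → ℝ → ℝ≥0∞) (hg : ∀ j, Measurable (g j)) :
    ∫⁻ x : EuclideanSpace ℝ (Fin N), ∏ j, g j (x j) = ∏ j, ∫⁻ y, g j y := by
  rw [← lintegral_pi_prod g hg]
  exact (PiLp.volume_preserving_ofLp (Fin N)).lintegral_comp
    (f := fun x : Fin N → ℝ => ∏ j, g j (x j)) (by fun_prop)

/-- The cube `[-ρ, ρ]^N`. -/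
def cube (N : ℕ) (ρ : ℝ) : Set (EuclideanSpace ℝ (Fin N)) := {h | ∀ j, |h j| ≤ ρ}

theorem measurableSet_coord_box {N : ℕ} {S : Fin N → Set ℝ} (hS : ∀ j, MeasurableSet (S j)) :
    MeasurableSet {x : EuclideanSpace ℝ (Fin N) | ∀ j, x j ∈ S j} := by
  have : {x : EuclideanSpace ℝ (Fin N) | ∀ j, x j ∈ S j} = ⋂ j, (fun x => x j) ⁻¹' S j := by
    ext; simp
  rw [this]
  exact MeasurableSet.iInter fun j => (by fun_prop : Measurable fun x :
    EuclideanSpace ℝ (Fin N) => x j) (hS j)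

theorem setLIntegral_euclidean_prod {N : ℕ} (g : Fin N → ℝ → ℝ≥0∞) (hg : ∀ j, Measurable (g j))
    {S : Fin N → Set ℝ} (hS : ∀ j, MeasurableSet (S j)) :
    ∫⁻ x in {x : EuclideanSpace ℝ (Fin N) | ∀ j, x j ∈ S j}, ∏ j, g j (x j) =
      ∏ j, ∫⁻ y in S j, g j y := by
  rw [← lintegral_indicator (measurableSet_coord_box hS)]
  simp_rw [← lintegral_indicator (hS _)]
  rw [← lintegral_euclidean_prod _ fun j => (hg j).indicator (hS j)]
  refine lintegral_congr fun x => ?_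
  by_cases hx : ∀ j, x j ∈ S j
  · rw [indicator_of_mem (by exact hx)]
    exact Finset.prod_congr rfl fun j _ => (indicator_of_mem (hx j) _).symm
  · rw [indicator_of_notMem (by exact hx)]
    push Not at hx
    obtain ⟨j, hj⟩ := hx
    exact (Finset.prod_eq_zero (Finset.mem_univ j) (indicator_of_notMem hj _)).symm

theorem volume_coord_box {N : ℕ} {S : Fin N → Set ℝ} (hS : ∀ j, MeasurableSet (S j)) :
    volume {x : EuclideanSpace ℝ (Fin N) | ∀ j, x j ∈ S j} = ∏ j, volume (S j) := by
  have := setLIntegral_euclidean_prod (fun _ _ => 1) (fun _ => measurable_const) hS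
  simpa using this

theorem measurableSet_cube (N : ℕ) (ρ : ℝ) : MeasurableSet (cube N ρ) := by
  have := measurableSet_coord_box (N := N) (S := fun _ => Icc (-ρ) ρ) fun _ => measurableSet_Icc
  simpa [cube, abs_le] using this

theorem lintegral_Icc_abs_rpow_neg {s ρ : ℝ} (hs : s < 1) (hρ : 0 ≤ ρ) :
    ∫⁻ y in Icc (-ρ) ρ, ENNReal.ofReal (|y| ^ (-s)) ≤
      ENNReal.ofReal (2 / (1 - s) * ρ ^ (1 - s)) := by
  have h1 : ∫⁻ y in Icc 0 ρ, ENNReal.ofReal (|y| ^ (-s)) =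
      ENNReal.ofReal (1 / (1 - s) * ρ ^ (1 - s)) := by
    have hint : IntervalIntegrable (fun y : ℝ => y ^ (-s)) volume 0 ρ :=
      intervalIntegral.intervalIntegrable_rpow' (by linarith)
    have h2 : ∫⁻ y in Icc 0 ρ, ENNReal.ofReal (|y| ^ (-s)) =
        ∫⁻ y in Ioc 0 ρ, ENNReal.ofReal (y ^ (-s)) := by
      rw [Measure.restrict_congr_set Ioc_ae_eq_Icc.symm]
      refine setLIntegral_congr_fun measurableSet_Ioc fun y hy => ?_
      simp only [abs_of_pos hy.1]
    rw [h2, ← ofReal_integral_eq_lintegral_ofReal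
      ((intervalIntegrable_iff_integrableOn_Ioc_of_le hρ).1 hint)]
    · rw [← intervalIntegral.integral_of_le hρ, integral_rpow (Or.inl (by linarith)),
        Real.zero_rpow (by linarith)]
      congr 1
      rw [show -s + 1 = 1 - s by ring]
      ring
    · filter_upwards [ae_restrict_mem measurableSet_Ioc] with y hy
      exact Real.rpow_nonneg hy.1.le _
  have h3 : ∫⁻ y in Icc (-ρ) 0, ENNReal.ofReal (|y| ^ (-s)) =
      ∫⁻ y in Icc 0 ρ, ENNReal.ofReal (|y| ^ (-s)) := by
    have := (Measure.measurePreserving_neg (volume : Measure ℝ)).setLIntegral_comp_preimage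
      (s := Icc 0 ρ) measurableSet_Icc (f := fun y => ENNReal.ofReal (|y| ^ (-s))) (by fun_prop)
    rw [← this]
    simp
  have hu : Icc (-ρ) ρ = Icc (-ρ) 0 ∪ Icc 0 ρ := by
    rw [Icc_union_Icc_eq_Icc] <;> linarith
  rw [hu]
  refine (lintegral_union_le _ _ _).trans ?_
  rw [h3, h1, ← ENNReal.ofReal_add]
  · exact ENNReal.ofReal_le_ofReal (le_of_eq (by ring))
  all_goals
    have : 0 < 1 - s := by linarith
    positivity

/-- The integral factors into one-dimensional ones, finite because each `s j < 1`. The power of `ρ`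
is the source of the exponent N - ∑ H_j w_j in the dimension formulas. -/
theorem setLIntegral_cube_prod_rpow {N : ℕ} {s : Fin N → ℝ} (hs : ∀ j, s j < 1) :
    ∃ C : ℝ, 0 < C ∧ ∀ ρ : ℝ, 0 < ρ →
      ∫⁻ h in cube N ρ, ENNReal.ofReal (∏ j, |h j| ^ (-s j)) ≤
        ENNReal.ofReal (C * ρ ^ ((N : ℝ) - ∑ j, s j)) := by
  have hpos : ∀ j, 0 < 1 - s j := fun j => by linarith [hs j]
  refine ⟨∏ j, (2 / (1 - s j)), Finset.prod_pos fun j _ => div_pos two_pos (hpos j),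
    fun ρ hρ => ?_⟩
  have h1 := setLIntegral_euclidean_prod (fun j y => ENNReal.ofReal (|y| ^ (-s j)))
    (fun j => by fun_prop) (S := fun _ => Icc (-ρ) ρ) fun _ => measurableSet_Icc
  have hc : cube N ρ = {x : EuclideanSpace ℝ (Fin N) | ∀ j, x j ∈ Icc (-ρ) ρ} := by
    ext; simp [cube, abs_le]
  rw [hc]
  simp_rw [ENNReal.ofReal_prod_of_nonneg fun j _ => Real.rpow_nonneg (abs_nonneg _) _]
  rw [h1]
  calc ∏ j, ∫⁻ y in Icc (-ρ) ρ, ENNReal.ofReal (|y| ^ (-s j))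
      ≤ ∏ j, ENNReal.ofReal (2 / (1 - s j) * ρ ^ (1 - s j)) :=
        Finset.prod_le_prod' fun j _ => lintegral_Icc_abs_rpow_neg (hs j) hρ.le
    _ = ENNReal.ofReal (∏ j, (2 / (1 - s j) * ρ ^ (1 - s j))) :=
        (ENNReal.ofReal_prod_of_nonneg fun j _ => by have := hpos j; positivity).symm
    _ = _ := by
        rw [Finset.prod_mul_distrib, ← Real.rpow_sum_of_pos hρ]
        simp

/-! ### The optimal distribution of exponents -/

theorem sum_ite_lt_eq {N : ℕ} (k : Fin N) (a : Fin N → ℝ) (b : ℝ) :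
    ∑ j, (if j < k then a j else if j = k then b else 0) = ∑ j ∈ Finset.Iio k, a j + b := by
  have : ∀ j, (if j < k then a j else if j = k then b else 0) =
      (if j < k then a j else 0) + (if j = k then b else 0) := by
    intro j
    rcases lt_trichotomy j k with h | h | h
    · simp [h, h.ne]
    · simp [h]
    · simp [h.not_gt, h.ne']
  simp_rw [this, Finset.sum_add_distrib]
  rw [← Finset.sum_filter]
  simp [Finset.filter_gt_eq_Iio]

theorem sum_Iic_eq_sum_Iio_add {N : ℕ} (k : Fin N) (a : Fin N → ℝ) :
    ∑ j ∈ Finset.Iic k, a j = ∑ j ∈ Finset.Iio k, a j + a k := by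
  rw [← Finset.Iio_insert, Finset.sum_insert (by simp), add_comm]

/-- Greedy filling: take w_j = 1/H_j for j < k and put the rest of `q` on coordinate k, where k is
the first index at which the partial sums of 1/H_j exceed `q`. Then N - ∑ H_j w_j is exactly the
k-th term bounding `η`. The condition H_j w_j < 1 must be strict, so the saturated weights are
shrunk by 1 - δ, which the strict inequality for `η` absorbs. -/
theorem exists_weights {N : ℕ} {H : Fin N → ℝ} (hpos : ∀ j, 0 < H j) {q η : ℝ} (hq : 0 ≤ q)
    (hqH : q < ∑ j, 1 / H j)
    (hη : ∀ k, η < ∑ j ∈ Finset.Iic k, H k / H j + ((N : ℝ) - ((k : ℕ) + 1 : ℝ)) - H k * q) :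
    ∃ w : Fin N → ℝ, (∀ j, 0 ≤ w j) ∧ ∑ j, w j = q ∧ (∀ j, H j * w j < 1) ∧
      η ≤ N - ∑ j, H j * w j := by
  have hne : (Finset.univ.filter fun k : Fin N => q < ∑ j ∈ Finset.Iic k, 1 / H j).Nonempty := by
    rcases N with _ | n
    · simp at hqH; linarith
    · refine ⟨Fin.last n, ?_⟩
      simp only [Finset.mem_filter, Finset.mem_univ, true_and]
      rwa [show Finset.Iic (Fin.last n) = Finset.univ by
        ext j; simp [Fin.le_last]]
  set k := (Finset.univ.filter fun k : Fin N => q < ∑ j ∈ Finset.Iic k, 1 / H j).min' hne with hk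
  have hk1 : q < ∑ j ∈ Finset.Iic k, 1 / H j := by
    have := Finset.min'_mem _ hne
    rw [← hk] at this
    simpa using this
  have hk2 : ∑ j ∈ Finset.Iio k, 1 / H j ≤ q := by
    by_cases h0 : (k : ℕ) = 0
    · have : Finset.Iio k = ∅ := by
        ext j; simp [Fin.lt_def, h0]
      rw [this]; simpa using hq
    · by_contra! hcon
      set k' : Fin N := ⟨k - 1, by omega⟩ with hk'
      have hI : Finset.Iic k' = Finset.Iio k := by
        ext j; simp only [Finset.mem_Iic, Finset.mem_Iio, Fin.lt_def, Fin.le_def, hk']; omega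
      have := Finset.min'_le (Finset.univ.filter fun k : Fin N => q < ∑ j ∈ Finset.Iic k, 1 / H j)
        k' (by simp only [Finset.mem_filter, Finset.mem_univ, true_and]; rwa [hI])
      rw [← hk, Fin.le_def] at this
      simp only [hk'] at this
      omega
  set S := ∑ j ∈ Finset.Iio k, 1 / H j with hS
  rw [sum_Iic_eq_sum_Iio_add, ← hS] at hk1
  have hηk := hη k
  rw [sum_Iic_eq_sum_Iio_add, div_self (hpos k).ne'] at hηk
  have hSk : ∑ j ∈ Finset.Iio k, H k / H j = H k * S := by
    rw [hS, Finset.mul_sum]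
    exact Finset.sum_congr rfl fun j _ => by ring
  rw [hSk] at hηk
  -- Both requirements hold strictly at δ = 0, hence for small δ > 0.
  obtain ⟨δ, hδ0, hδ1, hδ2, hδ3⟩ : ∃ δ : ℝ, 0 < δ ∧ δ < 1 ∧
      η < H k * S + 1 + (N - ((k : ℕ) + 1)) - H k * q + δ * (k - H k * S) ∧
      q - S + δ * S < 1 / H k := by
    have e1 : ∀ᶠ δ in 𝓝[>] (0 : ℝ), η < H k * S + 1 + (N - ((k : ℕ) + 1)) - H k * q
        + δ * (k - H k * S) := by
      have : Tendsto (fun δ : ℝ => H k * S + 1 + ((N : ℝ) - ((k : ℕ) + 1)) - H k * q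
        + δ * (k - H k * S)) (𝓝[>] 0) (𝓝 (H k * S + 1 + (N - ((k : ℕ) + 1)) - H k * q
        + 0 * (k - H k * S))) :=
        (Continuous.tendsto (by fun_prop) 0).mono_left nhdsWithin_le_nhds
      exact this.eventually_const_lt (by linarith)
    have e2 : ∀ᶠ δ in 𝓝[>] (0 : ℝ), q - S + δ * S < 1 / H k := by
      have : Tendsto (fun δ : ℝ => q - S + δ * S) (𝓝[>] 0) (𝓝 (q - S + 0 * S)) :=
        (Continuous.tendsto (by fun_prop) 0).mono_left nhdsWithin_le_nhds
      exact this.eventually_lt_const (by linarith)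
    have e3 : ∀ᶠ δ in 𝓝[>] (0 : ℝ), δ < 1 :=
      nhdsWithin_le_nhds (eventually_lt_nhds one_pos)
    obtain ⟨δ, h1, h2, h3, h4⟩ := (e1.and (e2.and (e3.and self_mem_nhdsWithin))).exists
    exact ⟨δ, h4, h3, h1, h2⟩
  have hS0 : 0 ≤ S := Finset.sum_nonneg fun j _ => by have := hpos j; positivity
  have hmul : ∀ j, H j * (if j < k then (1 - δ) / H j else if j = k then q - (1 - δ) * S else 0) =
      if j < k then (1 - δ) else if j = k then H k * (q - (1 - δ) * S) else 0 := by
    intro j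
    have := (hpos j).ne'
    split_ifs with h1 h2
    · field_simp
    · rw [h2]
    · simp
  have hk3 : H k * (q - (1 - δ) * S) < 1 := by
    have h := mul_lt_mul_of_pos_left hδ3 (hpos k)
    rw [mul_one_div_cancel (hpos k).ne'] at h
    linarith
  refine ⟨fun j => if j < k then (1 - δ) / H j else if j = k then q - (1 - δ) * S else 0,
    fun j => ?_, ?_, fun j => ?_, ?_⟩
  · dsimp only
    split_ifs
    · exact div_nonneg (by linarith) (hpos j).le
    · nlinarith
    · exact le_rfl
  · rw [sum_ite_lt_eq]
    have : ∑ j ∈ Finset.Iio k, (1 - δ) / H j = (1 - δ) * S := by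
      rw [hS, Finset.mul_sum]
      exact Finset.sum_congr rfl fun j _ => by ring
    rw [this]; ring
  · rw [hmul]
    split_ifs
    · linarith
    · exact hk3
    · exact one_pos
  · simp_rw [hmul]
    rw [sum_ite_lt_eq, Finset.sum_const, Fin.card_Iio, nsmul_eq_mul]
    nlinarith

end AnisoField

namespace AnisoField

open Filter Topology Metric Set
open scoped NNReal

/-! ### The variogram -/

/-- The integrand `|exp(i⟨h,ξ⟩) - 1|²` of the variogram. -/
noncomputable def vkernel {N : ℕ} (h ξ : EuclideanSpace ℝ (Fin N)) : ℝ := 2 * (1 - Real.cos (inner ℝ h ξ))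

/-- The variogram `E (X(t + h) - X(t))²`. -/
noncomputable def variogram {N : ℕ} (f : EuclideanSpace ℝ (Fin N) → ℝ)
    (h : EuclideanSpace ℝ (Fin N)) : ℝ := ∫ ξ, vkernel h ξ ∂(spectralMeasure f)

variable {N : ℕ} {f : EuclideanSpace ℝ (Fin N) → ℝ}

theorem vkernel_nonneg (h ξ : EuclideanSpace ℝ (Fin N)) : 0 ≤ vkernel h ξ := by
  have := Real.cos_le_one (inner ℝ h ξ); unfold vkernel; linarith

theorem vkernel_le_four (h ξ : EuclideanSpace ℝ (Fin N)) : vkernel h ξ ≤ 4 := by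
  have := Real.neg_one_le_cos (inner ℝ h ξ); unfold vkernel; linarith

theorem vkernel_le_inner_sq (h ξ : EuclideanSpace ℝ (Fin N)) :
    vkernel h ξ ≤ (inner ℝ h ξ : ℝ) ^ 2 := by
  have := Real.one_sub_sq_div_two_le_cos (x := inner ℝ h ξ); unfold vkernel; linarith

theorem vkernel_le_norm_sq (h ξ : EuclideanSpace ℝ (Fin N)) :
    vkernel h ξ ≤ ‖h‖ ^ 2 * ‖ξ‖ ^ 2 := by
  refine (vkernel_le_inner_sq h ξ).trans ?_
  rw [← mul_pow, ← sq_abs]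
  exact pow_le_pow_left₀ (abs_nonneg _) (abs_real_inner_le_norm h ξ) 2

theorem continuous_vkernel : Continuous fun q : EuclideanSpace ℝ (Fin N) ×
    EuclideanSpace ℝ (Fin N) => vkernel q.1 q.2 := by
  unfold vkernel; fun_prop

theorem measurable_vkernel (h : EuclideanSpace ℝ (Fin N)) : Measurable (vkernel h) :=
  (continuous_vkernel.comp (Continuous.prodMk_right h)).measurable

/-- The weight appearing in the Lévy condition. -/
noncomputable def levyWeight (ξ : EuclideanSpace ℝ (Fin N)) : ℝ := ‖ξ‖ ^ 2 / (1 + ‖ξ‖ ^ 2)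

theorem levyWeight_nonneg (ξ : EuclideanSpace ℝ (Fin N)) : 0 ≤ levyWeight ξ := by
  unfold levyWeight; positivity

theorem vkernel_le_levyWeight (h ξ : EuclideanSpace ℝ (Fin N)) :
    vkernel h ξ ≤ (4 + ‖h‖ ^ 2) * levyWeight ξ := by
  have h1 := vkernel_le_four h ξ
  have h2 := vkernel_le_norm_sq h ξ
  unfold levyWeight
  rw [mul_div_assoc', le_div_iff₀ (by positivity)]
  nlinarith [mul_le_mul_of_nonneg_right h1 (sq_nonneg ‖ξ‖)]

theorem norm_sq_le_levyWeight {R : ℝ} {ξ : EuclideanSpace ℝ (Fin N)} (h : ‖ξ‖ ≤ R) :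
    ‖ξ‖ ^ 2 ≤ (1 + R ^ 2) * levyWeight ξ := by
  unfold levyWeight
  rw [mul_div_assoc', le_div_iff₀ (by positivity)]
  have : ‖ξ‖ ^ 2 ≤ R ^ 2 := pow_le_pow_left₀ (norm_nonneg _) h 2
  nlinarith [sq_nonneg ‖ξ‖]

theorem one_le_levyWeight {R : ℝ} (hR : 0 < R) {ξ : EuclideanSpace ℝ (Fin N)} (h : R ≤ ‖ξ‖) :
    1 ≤ (1 + 1 / R ^ 2) * levyWeight ξ := by
  unfold levyWeight
  rw [mul_div_assoc', le_div_iff₀ (by positivity)]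
  have : R ^ 2 ≤ ‖ξ‖ ^ 2 := pow_le_pow_left₀ hR.le h 2
  have h2 : 1 ≤ 1 / R ^ 2 * ‖ξ‖ ^ 2 := by
    rw [one_div, inv_mul_eq_div, le_div_iff₀ (by positivity)]; linarith
  nlinarith

theorem variogram_nonneg (h : EuclideanSpace ℝ (Fin N)) : 0 ≤ variogram f h :=
  integral_nonneg (vkernel_nonneg h)

namespace IsLegitimateSpectralDensity

theorem integrable_vkernel (hf : IsLegitimateSpectralDensity f) (h : EuclideanSpace ℝ (Fin N)) :
    Integrable (vkernel h) (spectralMeasure f) := by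
  refine (hf.integrable.const_mul (4 + ‖h‖ ^ 2)).mono'
    (measurable_vkernel h).aestronglyMeasurable (ae_of_all _ fun ξ => ?_)
  rw [Real.norm_of_nonneg (vkernel_nonneg h ξ)]
  exact vkernel_le_levyWeight h ξ

theorem ofReal_variogram (hf : IsLegitimateSpectralDensity f) (h : EuclideanSpace ℝ (Fin N)) :
    ENNReal.ofReal (variogram f h) = ∫⁻ ξ, ENNReal.ofReal (vkernel h ξ) ∂(spectralMeasure f) :=
  ofReal_integral_eq_lintegral_ofReal (hf.integrable_vkernel h) (ae_of_all _ (vkernel_nonneg h))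

theorem measure_norm_ge_lt_top (hf : IsLegitimateSpectralDensity f) {R : ℝ} (hR : 0 < R) :
    spectralMeasure f {ξ | R ≤ ‖ξ‖} < ⊤ := by
  have h1 : Integrable (fun ξ => (1 + 1 / R ^ 2) * levyWeight ξ) (spectralMeasure f) :=
    hf.integrable.const_mul _
  refine lt_of_le_of_lt (measure_mono ?_) (h1.measure_norm_ge_lt_top one_pos)
  intro ξ hξ
  have : 1 ≤ (1 + 1 / R ^ 2) * levyWeight ξ := one_le_levyWeight hR hξ
  exact this.trans (le_abs_self _)

theorem tendsto_measure_norm_ge (hf : IsLegitimateSpectralDensity f) :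
    Tendsto (fun n : ℕ => spectralMeasure f {ξ | (n : ℝ) + 1 ≤ ‖ξ‖}) atTop (𝓝 0) := by
  have hm : ∀ n : ℕ, MeasurableSet {ξ : EuclideanSpace ℝ (Fin N) | (n : ℝ) + 1 ≤ ‖ξ‖} := fun n =>
    measurableSet_le measurable_const measurable_norm
  have := tendsto_measure_iInter_atTop (μ := spectralMeasure f)
    (s := fun n : ℕ => {ξ | (n : ℝ) + 1 ≤ ‖ξ‖}) (fun n => (hm n).nullMeasurableSet)
    (fun m n hmn ξ hξ => by
      have : (m : ℝ) ≤ n := by exact_mod_cast hmn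
      simp only [mem_ofPred_eq] at *; linarith)
    ⟨0, (hf.measure_norm_ge_lt_top (by positivity)).ne⟩
  have he : ⋂ n : ℕ, {ξ : EuclideanSpace ℝ (Fin N) | (n : ℝ) + 1 ≤ ‖ξ‖} = ∅ := by
    ext ξ
    simp only [mem_iInter, mem_ofPred_eq, mem_empty_iff_false, iff_false, not_forall, not_le]
    obtain ⟨n, hn⟩ := exists_nat_gt ‖ξ‖
    exact ⟨n, by linarith⟩
  rwa [he, measure_empty] at this

theorem continuous_variogram (hf : IsLegitimateSpectralDensity f) : Continuous (variogram f) := by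
  rw [continuous_iff_continuousAt]
  intro h₀
  refine continuousAt_of_dominated (bound := fun ξ => (4 + (‖h₀‖ + 1) ^ 2) * levyWeight ξ)
    (Eventually.of_forall fun h => (measurable_vkernel h).aestronglyMeasurable) ?_
    (hf.integrable.const_mul _) (ae_of_all _ fun ξ => ?_)
  · filter_upwards [Metric.ball_mem_nhds h₀ one_pos] with h hh
    refine ae_of_all _ fun ξ => ?_
    rw [Real.norm_of_nonneg (vkernel_nonneg h ξ)]
    refine (vkernel_le_levyWeight h ξ).trans ?_
    have h1 : ‖h‖ ≤ ‖h₀‖ + 1 := by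
      have := norm_sub_norm_le h h₀
      rw [mem_ball, dist_eq_norm] at hh
      linarith
    have := levyWeight_nonneg ξ
    gcongr
  · exact (continuous_vkernel.comp (Continuous.prodMk_left ξ)).continuousAt

/-- A Cauchy–Schwarz bound of the covariance of `X(s)` and `X(s+h) - X(s)` which is localized in
the frequency domain. -/
theorem abs_cross_le (hf : IsLegitimateSpectralDensity f) {s h : EuclideanSpace ℝ (Fin N)} {R η : ℝ} (hη : 0 < η)
    (hs : 0 < variogram f s) (hh : 0 < variogram f h)
    (h1 : ∫ ξ in {ξ | R ≤ ‖ξ‖}ᶜ, vkernel h ξ ∂(spectralMeasure f) ≤ η * variogram f h)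
    (h2 : ∫ ξ in {ξ | R ≤ ‖ξ‖}, vkernel s ξ ∂(spectralMeasure f) ≤ η * variogram f s) :
    (variogram f (s + h) - variogram f s - variogram f h) ^ 2 ≤
      16 * η * (variogram f s * variogram f h) := by
  set A : Set (EuclideanSpace ℝ (Fin N)) := {ξ | R ≤ ‖ξ‖} with hA
  have hAm : MeasurableSet A := measurableSet_le measurable_const measurable_norm
  set a := variogram f s with ha
  set b := variogram f h with hb
  have hD : variogram f (s + h) - a - b =
      ∫ ξ, (vkernel (s + h) ξ - vkernel s ξ - vkernel h ξ) ∂(spectralMeasure f) := by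
    have e1 := integral_sub (hf.integrable_vkernel (s + h)) (hf.integrable_vkernel s)
    have e2 := integral_sub ((hf.integrable_vkernel (s + h)).sub (hf.integrable_vkernel s))
      (hf.integrable_vkernel h)
    simp only [Pi.sub_apply] at e2
    rw [e2, e1]
    rfl
  have hpt : ∀ (x : ℝ), 0 < x → ∀ ξ, |vkernel (s + h) ξ - vkernel s ξ - vkernel h ξ| ≤
      x * vkernel s ξ + x⁻¹ * vkernel h ξ := by
    intro x hx ξ
    -- In half-angles the cross term is 8 cos(u+w) sin u sin w, while the kernels are 4 sin² u and 4
    -- sin² w; the arithmetic-geometric inequality with a free weight x does the rest.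
    have key : ∀ u w : ℝ, |2 * (1 - Real.cos (2 * u + 2 * w)) - 2 * (1 - Real.cos (2 * u)) -
        2 * (1 - Real.cos (2 * w))| ≤
        x * (2 * (1 - Real.cos (2 * u))) + x⁻¹ * (2 * (1 - Real.cos (2 * w))) := by
      intro u w
      have e1 : 1 - Real.cos (2 * u) = 2 * Real.sin u ^ 2 := by
        rw [Real.cos_two_mul, Real.cos_sq']; ring
      have e2 : 1 - Real.cos (2 * w) = 2 * Real.sin w ^ 2 := by
        rw [Real.cos_two_mul, Real.cos_sq']; ring
      have e3 : 2 * (1 - Real.cos (2 * u + 2 * w)) - 2 * (1 - Real.cos (2 * u)) -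
        2 * (1 - Real.cos (2 * w)) = 8 * (Real.cos (u + w) * (Real.sin u * Real.sin w)) := by
        rw [show 2 * u + 2 * w = 2 * (u + w) by ring, e1, e2, Real.cos_two_mul, Real.cos_add]
        have hu := Real.sin_sq_add_cos_sq u
        have hw := Real.sin_sq_add_cos_sq w
        have hu' : Real.cos u ^ 2 = 1 - Real.sin u ^ 2 := by linarith
        have hw' : Real.cos w ^ 2 = 1 - Real.sin w ^ 2 := by linarith
        ring_nf
        rw [hu', hw']
        ring
      rw [e3, e1, e2, abs_mul, abs_mul, abs_mul]
      have hc := Real.abs_cos_le_one (u + w)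
      have h8 : |Real.cos (u + w)| * (|Real.sin u| * |Real.sin w|) ≤
          1 * (|Real.sin u| * |Real.sin w|) := by gcongr
      have h9 : 2 * (|Real.sin u| * |Real.sin w|) ≤
          x * Real.sin u ^ 2 + x⁻¹ * Real.sin w ^ 2 := by
        have := sq_nonneg (x * |Real.sin u| - |Real.sin w|)
        have h3 : x * (2 * (|Real.sin u| * |Real.sin w|)) ≤
          x * (x * Real.sin u ^ 2 + x⁻¹ * Real.sin w ^ 2) := by
          rw [mul_add, ← mul_assoc x x⁻¹, mul_inv_cancel₀ hx.ne', ← sq_abs (Real.sin u),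
            ← sq_abs (Real.sin w)]
          nlinarith
        exact le_of_mul_le_mul_left h3 hx
      rw [abs_of_pos (by norm_num : (0 : ℝ) < 8)]
      linarith
    have := key (inner ℝ s ξ / 2) (inner ℝ h ξ / 2)
    unfold vkernel
    rw [inner_add_left]
    convert this using 2 <;> ring_nf
  have hint : Integrable (fun ξ => vkernel (s + h) ξ - vkernel s ξ - vkernel h ξ)
      (spectralMeasure f) :=
    ((hf.integrable_vkernel _).sub (hf.integrable_vkernel _)).sub (hf.integrable_vkernel _)
  have hpart : ∀ (B : Set (EuclideanSpace ℝ (Fin N))) (x : ℝ), 0 < x →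
      |∫ ξ in B, (vkernel (s + h) ξ - vkernel s ξ - vkernel h ξ) ∂(spectralMeasure f)| ≤
      x * ∫ ξ in B, vkernel s ξ ∂(spectralMeasure f) +
      x⁻¹ * ∫ ξ in B, vkernel h ξ ∂(spectralMeasure f) := by
    intro B x hx
    rw [← integral_const_mul, ← integral_const_mul, ← integral_add
      ((hf.integrable_vkernel _).integrableOn.const_mul _)
      ((hf.integrable_vkernel _).integrableOn.const_mul _)]
    refine (abs_integral_le_integral_abs).trans ?_
    exact integral_mono hint.abs.integrableOn
      (((hf.integrable_vkernel _).integrableOn.const_mul _).add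
        ((hf.integrable_vkernel _).integrableOn.const_mul _)) (hpt x hx)
  have hle : ∀ (B : Set (EuclideanSpace ℝ (Fin N))) t,
      ∫ ξ in B, vkernel t ξ ∂(spectralMeasure f) ≤ variogram f t := fun B t =>
    setIntegral_le_integral (hf.integrable_vkernel t) (ae_of_all _ (vkernel_nonneg t))
  have hr : Real.sqrt (η * (a * b)) ^ 2 = η * (a * b) := Real.sq_sqrt (by positivity)
  set r := Real.sqrt (η * (a * b)) with hr'
  have hr0 : 0 < r := Real.sqrt_pos.2 (by positivity)
  -- The weights are tuned to r = √(ηab) so that each of the four pieces is at most r. Low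
  -- frequencies exploit the smallness of the `h`-part, high frequencies that of the `s`-part.
  have p1 := hpart Aᶜ (r / a) (by positivity)
  have p2 := hpart A (r / (η * a)) (by positivity)
  have q1 : r / a * ∫ ξ in Aᶜ, vkernel s ξ ∂(spectralMeasure f) ≤ r := by
    calc _ ≤ r / a * a := by gcongr; exact hle _ _
      _ = r := by field_simp
  have q2 : (r / a)⁻¹ * ∫ ξ in Aᶜ, vkernel h ξ ∂(spectralMeasure f) ≤ r := by
    calc _ ≤ (r / a)⁻¹ * (η * b) := by gcongr
      _ = r ^ 2 / r := by rw [hr]; field_simp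
      _ = r := by field_simp
  have q3 : r / (η * a) * ∫ ξ in A, vkernel s ξ ∂(spectralMeasure f) ≤ r := by
    calc _ ≤ r / (η * a) * (η * a) := by gcongr
      _ = r := by field_simp
  have q4 : (r / (η * a))⁻¹ * ∫ ξ in A, vkernel h ξ ∂(spectralMeasure f) ≤ r := by
    calc _ ≤ (r / (η * a))⁻¹ * b := by gcongr; exact hle _ _
      _ = r ^ 2 / r := by rw [hr]; field_simp
      _ = r := by field_simp
  have hfin : |variogram f (s + h) - a - b| ≤ 4 * r := by
    rw [hD, ← integral_add_compl hAm hint]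
    refine (abs_add_le _ _).trans ?_
    linarith
  rw [← sq_abs]
  calc _ ≤ (4 * r) ^ 2 := pow_le_pow_left₀ (abs_nonneg _) hfin 2
    _ = _ := by rw [mul_pow, hr]; ring

end IsLegitimateSpectralDensity

end AnisoField

namespace AnisoField

open Filter Topology Metric Set
open scoped NNReal

variable {N : ℕ} {f : EuclideanSpace ℝ (Fin N) → ℝ} {β : Fin N → ℝ} {γ : ℝ}

theorem setLIntegral_spectralMeasure (hm : Measurable f) {A : Set (EuclideanSpace ℝ (Fin N))}
    (hA : MeasurableSet A) {g : EuclideanSpace ℝ (Fin N) → ℝ≥0∞} (hg : Measurable g) :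
    ∫⁻ ξ in A, g ξ ∂(spectralMeasure f) = ∫⁻ ξ in A, ENNReal.ofReal (f ξ) * g ξ := by
  rw [spectralMeasure, setLIntegral_withDensity_eq_setLIntegral_mul _ (by fun_prop) hg hA]
  rfl

namespace SpectralCondition

theorem hurst_pos (hc : SpectralCondition β γ f) (j : Fin N) : 0 < hurst β γ j := by
  have := hc.beta_pos j
  have := hc.gamma_gt
  unfold hurst
  exact mul_pos (by positivity) (by linarith)

theorem hurstBar_pos (hc : SpectralCondition β γ f) (j : Fin N) : 0 < hurstBar β γ j :=
  lt_min one_pos (hc.hurst_pos j)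

/-! ### Upper bound of the variogram -/

theorem exists_coord_le {c₃ : ℝ} (hc₃ : 0 < c₃) {ξ : EuclideanSpace ℝ (Fin N)} (hξ : c₃ ≤ ‖ξ‖) :
    ∃ i, c₃ / N ≤ |ξ i| := by
  by_contra! hcon
  have h0 : N ≠ 0 := by
    rintro rfl
    have : ξ = 0 := Subsingleton.elim _ _
    rw [this, norm_zero] at hξ; linarith
  have hN : (0 : ℝ) < N := by positivity
  have : NeZero N := ⟨h0⟩
  have h1 : ‖ξ‖ ≤ ∑ i, |ξ i| := by
    rw [EuclideanSpace.norm_eq]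
    refine Real.sqrt_le_iff.2 ⟨Finset.sum_nonneg fun i _ => abs_nonneg _, ?_⟩
    simpa using Finset.sum_sq_le_sq_sum_of_nonneg (s := Finset.univ) (f := fun i => |ξ i|)
      (fun i _ => abs_nonneg (ξ i))
  have h2 : ∑ i, |ξ i| < ∑ _i : Fin N, c₃ / N :=
    Finset.sum_lt_sum_of_nonempty Finset.univ_nonempty fun i _ => hcon i
  rw [Finset.sum_const, Finset.card_univ, Fintype.card_fin, nsmul_eq_mul,
    mul_div_cancel₀ _ hN.ne'] at h2
  linarith

/-- Away from the origin some coordinate is at least c₃/N, so the sum is bounded below and absorbs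
the additive 1. -/
theorem one_add_abs_rpow_le (hβ : ∀ j, 0 < β j) {c₃ : ℝ} (hc₃ : 0 < c₃) :
    ∃ D : ℝ, 0 < D ∧ ∀ ξ : EuclideanSpace ℝ (Fin N), c₃ ≤ ‖ξ‖ →
      ∀ i, (1 + |ξ i|) ^ β i ≤ D * ∑ j, |ξ j| ^ β j := by
  set T := ∑ i, ((c₃ / N) ^ β i)⁻¹ with hT
  have hcN : 0 ≤ c₃ / N := by positivity
  have hT0 : 0 ≤ T := Finset.sum_nonneg fun i _ => by positivity
  set W := ∑ i, (2 : ℝ) ^ β i with hW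
  have hW0 : 0 ≤ W := Finset.sum_nonneg fun i _ => by positivity
  refine ⟨W * (1 + T) + 1, by positivity, fun ξ hξ i => ?_⟩
  set S := ∑ j, |ξ j| ^ β j with hS
  have hSi : ∀ i, |ξ i| ^ β i ≤ S := fun i => Finset.single_le_sum
    (f := fun j => |ξ j| ^ β j) (fun j _ => by positivity) (Finset.mem_univ i)
  have hS0 : 0 ≤ S := Finset.sum_nonneg fun i _ => by positivity
  have hWi : (2 : ℝ) ^ β i ≤ W := Finset.single_le_sum
    (f := fun j => (2 : ℝ) ^ β j) (fun j _ => by positivity) (Finset.mem_univ i)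
  have hTS : 1 ≤ T * S := by
    obtain ⟨k, hk⟩ := exists_coord_le hc₃ hξ
    have hN : (0 : ℝ) < N := by
      have := k.pos; positivity
    have h1 : ((c₃ / N) ^ β k)⁻¹ ≤ T := Finset.single_le_sum
      (f := fun j => ((c₃ / N) ^ β j)⁻¹) (fun j _ => by positivity) (Finset.mem_univ k)
    have h2 : (c₃ / N) ^ β k ≤ S :=
      (Real.rpow_le_rpow hcN hk (hβ k).le).trans (hSi k)
    have h3 : 0 < (c₃ / N) ^ β k := Real.rpow_pos_of_pos (by positivity) _
    calc 1 = ((c₃ / N) ^ β k)⁻¹ * (c₃ / N) ^ β k := by field_simp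
      _ ≤ T * S := mul_le_mul h1 h2 h3.le hT0
  have hmain : (1 + |ξ i|) ^ β i ≤ 2 ^ β i * ((1 + T) * S) := by
    rcases le_total 1 |ξ i| with h | h
    · calc (1 + |ξ i|) ^ β i ≤ (2 * |ξ i|) ^ β i :=
            Real.rpow_le_rpow (by positivity) (by linarith) (hβ i).le
        _ = 2 ^ β i * |ξ i| ^ β i := Real.mul_rpow (by norm_num) (abs_nonneg _)
        _ ≤ 2 ^ β i * ((1 + T) * S) := by
            gcongr
            have := hSi i
            nlinarith
    · calc (1 + |ξ i|) ^ β i ≤ 2 ^ β i :=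
            Real.rpow_le_rpow (by positivity) (by linarith) (hβ i).le
        _ ≤ 2 ^ β i * ((1 + T) * S) := by
            refine le_mul_of_one_le_right (by positivity) ?_
            nlinarith
  calc (1 + |ξ i|) ^ β i ≤ 2 ^ β i * ((1 + T) * S) := hmain
    _ ≤ W * ((1 + T) * S) := by gcongr
    _ ≤ (W * (1 + T) + 1) * S := by nlinarith

theorem lintegral_one_add_abs_lt_top {s : ℝ} (hs : 1 < s) :
    ∫⁻ y : ℝ, ENNReal.ofReal ((1 + |y|) ^ (-s)) < ⊤ := by
  have h := integrable_one_add_norm (E := ℝ) (μ := volume) (r := s) (by simpa using hs)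
  have h2 := h.2
  rw [hasFiniteIntegral_iff_ofReal (ae_of_all _ fun x => by positivity)] at h2
  simpa using h2

/-- Write γ = ∑ g_i and bound S^γ below by the product of the ((1+|ξ_i|)^(β_i)/D)^(g_i). Each
coordinate gets 1/β_i, coordinate `j` gets 2a/β_j more to pay for |ξ_j|^(2a), and the surplus τ is
shared equally. Positivity of τ is exactly `a < hurst β γ j`, and it pushes every remaining exponent
above 1. -/
theorem exists_product_bound (hc : SpectralCondition β γ f)
    {j : Fin N} {a : ℝ} (ha0 : 0 ≤ a) (ha : a < hurst β γ j) {c₂ c₃ : ℝ} (hc₂ : 0 < c₂)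
    (hc₃ : 0 < c₃)
    (hub : ∀ ξ : EuclideanSpace ℝ (Fin N), c₃ ≤ ‖ξ‖ → f ξ ≤ c₂ / (∑ j, |ξ j| ^ β j) ^ γ) :
    ∃ (C : ℝ) (s : Fin N → ℝ), 0 < C ∧ (∀ i, 1 < s i) ∧
      ∀ ξ : EuclideanSpace ℝ (Fin N), c₃ ≤ ‖ξ‖ →
        f ξ * |ξ j| ^ (2 * a) ≤ C * ∏ i, (1 + |ξ i|) ^ (-s i) := by
  have hNpos : (0 : ℝ) < N := by have := j.pos; positivity
  obtain ⟨D, hD0, hD⟩ := one_add_abs_rpow_le hc.beta_pos hc₃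
  obtain ⟨τ, hτ⟩ : ∃ τ, τ = γ - ∑ i, 1 / β i - 2 * a / β j := ⟨_, rfl⟩
  have hβj := hc.beta_pos j
  have hτ0 : 0 < τ := by
    have h1 : 2 * a / β j < γ - ∑ i, 1 / β i := by
      rw [div_lt_iff₀ hβj]
      unfold hurst at ha
      linarith
    rw [hτ]; linarith
  obtain ⟨g, hg⟩ : ∃ g : Fin N → ℝ,
      g = fun i => 1 / β i + τ / N + (if i = j then 2 * a / β j else 0) := ⟨_, rfl⟩
  have hgsum : ∑ i, g i = γ := by
    simp only [hg, Finset.sum_add_distrib, Finset.sum_const, Finset.card_univ, Fintype.card_fin,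
      nsmul_eq_mul, Finset.sum_ite_eq', Finset.mem_univ, if_true]
    rw [mul_div_cancel₀ _ hNpos.ne', hτ]; ring
  have hg0 : ∀ i, 0 ≤ g i := fun i => by
    have := hc.beta_pos i
    simp only [hg]
    split_ifs <;> positivity
  obtain ⟨s, hs⟩ : ∃ s : Fin N → ℝ, s = fun i => β i * g i - (if i = j then 2 * a else 0) :=
    ⟨_, rfl⟩
  have hs1 : ∀ i, 1 < s i := fun i => by
    have hβi := hc.beta_pos i
    have h2 : 0 < β i * (τ / N) := by positivity
    have h3 : s i = 1 + β i * (τ / N) := by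
      simp only [hs, hg]
      split_ifs with h
      · subst h; field_simp; ring
      · field_simp; ring
    rw [h3]; linarith
  refine ⟨c₂ * D ^ γ, s, by positivity, hs1, fun ξ hξ => ?_⟩
  have hS := hD ξ hξ
  have hub' := hub ξ hξ
  set S := ∑ i, |ξ i| ^ β i with hSdef
  have hS0 : 0 < S := by
    have h1 := hS j
    have h2 : 0 < (1 + |ξ j|) ^ β j := by positivity
    exact pos_of_mul_pos_right (h2.trans_le h1) hD0.le
  have hprod : ∏ i, (1 + |ξ i|) ^ (β i * g i) ≤ D ^ γ * S ^ γ := by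
    rw [← Real.mul_rpow hD0.le hS0.le, ← hgsum, Real.rpow_sum_of_pos (by positivity)]
    refine Finset.prod_le_prod (fun i _ => by positivity) fun i _ => ?_
    rw [Real.rpow_mul (by positivity)]
    exact Real.rpow_le_rpow (by positivity) (hS i) (hg0 i)
  have hP0 : 0 < ∏ i, (1 + |ξ i|) ^ (β i * g i) := Finset.prod_pos fun i _ => by positivity
  have hprod2 : ∏ i, (1 + |ξ i|) ^ (-s i) =
      (∏ i, (1 + |ξ i|) ^ (β i * g i))⁻¹ * (1 + |ξ j|) ^ (2 * a) := by
    have h3 : ∀ i, (1 + |ξ i|) ^ (-s i) = ((1 + |ξ i|) ^ (β i * g i))⁻¹ *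
        (if i = j then (1 + |ξ j|) ^ (2 * a) else 1) := by
      intro i
      rw [← Real.rpow_neg (by positivity)]
      split_ifs with h
      · subst h
        rw [← Real.rpow_add (by positivity)]
        simp only [hs, if_true]
        congr 1; ring
      · simp [hs, h]
    simp_rw [h3, Finset.prod_mul_distrib, Finset.prod_inv_distrib]
    simp
  rw [hprod2]
  calc f ξ * |ξ j| ^ (2 * a) ≤ c₂ / S ^ γ * (1 + |ξ j|) ^ (2 * a) := by
        refine mul_le_mul hub' ?_ (by positivity) (by positivity)
        exact Real.rpow_le_rpow (abs_nonneg _) (by linarith) (by linarith)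
    _ ≤ c₂ * D ^ γ * (∏ i, (1 + |ξ i|) ^ (β i * g i))⁻¹ * (1 + |ξ j|) ^ (2 * a) := by
        refine mul_le_mul_of_nonneg_right ?_ (by positivity)
        rw [← div_eq_mul_inv, div_le_div_iff₀ (by positivity) hP0, mul_assoc]
        exact mul_le_mul_of_nonneg_left hprod hc₂.le
    _ = _ := by ring

/-- Finiteness of the fractional moments of the spectral density at infinity. -/
theorem lintegral_rpow_lt_top (hc : SpectralCondition β γ f) (hf : IsLegitimateSpectralDensity f)
    {j : Fin N} {a : ℝ} (ha0 : 0 ≤ a) (ha : a < hurst β γ j) {c₂ c₃ : ℝ} (hc₂ : 0 < c₂)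
    (hc₃ : 0 < c₃)
    (hub : ∀ ξ : EuclideanSpace ℝ (Fin N), c₃ ≤ ‖ξ‖ → f ξ ≤ c₂ / (∑ j, |ξ j| ^ β j) ^ γ) :
    ∫⁻ ξ in {ξ | c₃ ≤ ‖ξ‖}, ENNReal.ofReal (|ξ j| ^ (2 * a)) ∂(spectralMeasure f) < ⊤ := by
  obtain ⟨C, s, hC, hs1, hbound⟩ := hc.exists_product_bound ha0 ha hc₂ hc₃ hub
  obtain ⟨A, hA⟩ : ∃ A : Set (EuclideanSpace ℝ (Fin N)), A = {ξ | c₃ ≤ ‖ξ‖} := ⟨_, rfl⟩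
  have hm : MeasurableSet A := by
    rw [hA]; exact measurableSet_le measurable_const measurable_norm
  have hg : Measurable fun ξ : EuclideanSpace ℝ (Fin N) => ENNReal.ofReal (|ξ j| ^ (2 * a)) := by
    fun_prop
  rw [← hA, setLIntegral_spectralMeasure hf.measurable hm hg]
  have h1 : ∫⁻ ξ in A, ENNReal.ofReal (f ξ) * ENNReal.ofReal (|ξ j| ^ (2 * a)) ≤
      ∫⁻ ξ in A, ENNReal.ofReal C * ∏ i, ENNReal.ofReal ((1 + |ξ i|) ^ (-s i)) := by
    refine setLIntegral_mono' hm fun ξ hξ => ?_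
    rw [← ENNReal.ofReal_mul' (by positivity),
      ← ENNReal.ofReal_prod_of_nonneg fun i _ => by positivity, ← ENNReal.ofReal_mul hC.le]
    exact ENNReal.ofReal_le_ofReal (hbound ξ (by rw [hA] at hξ; exact hξ))
  have h2 : ∫⁻ ξ : EuclideanSpace ℝ (Fin N), ENNReal.ofReal C *
      ∏ i, ENNReal.ofReal ((1 + |ξ i|) ^ (-s i)) =
      ENNReal.ofReal C * ∏ i, ∫⁻ y : ℝ, ENNReal.ofReal ((1 + |y|) ^ (-s i)) := by
    rw [lintegral_const_mul' _ _ ENNReal.ofReal_ne_top]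
    rw [lintegral_euclidean_prod (fun i y => ENNReal.ofReal ((1 + |y|) ^ (-s i)))
      fun i => by fun_prop]
  refine (h1.trans (setLIntegral_le_lintegral _ _)).trans_lt ?_
  rw [h2]
  exact ENNReal.mul_lt_top ENNReal.ofReal_lt_top
    (ENNReal.prod_lt_top fun i _ => lintegral_one_add_abs_lt_top (hs1 i))

/-- Interpolation between the constant and the quadratic bound. If all |x_j| ≤ 1, Cauchy–Schwarz
applies and squares are dominated by the powers 2a_j ≤ 2; otherwise some summand is at least 1 and
the bound 4 suffices. -/
theorem min_four_sq_sum_le {x a : Fin N → ℝ} (ha0 : ∀ j, 0 ≤ a j) (ha1 : ∀ j, a j ≤ 1) {y : ℝ}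
    (h4 : y ≤ 4) (hy : y ≤ (∑ j, x j) ^ 2) : y ≤ (4 + N) * ∑ j, |x j| ^ (2 * a j) := by
  have hnn : ∀ j, 0 ≤ |x j| ^ (2 * a j) := fun j => by positivity
  have hsum0 : 0 ≤ ∑ j, |x j| ^ (2 * a j) := Finset.sum_nonneg fun j _ => hnn j
  by_cases hall : ∀ j, |x j| ≤ 1
  · have h1 : (∑ j, x j) ^ 2 ≤ N * ∑ j, x j ^ 2 := by
      simpa using sq_sum_le_card_mul_sum_sq (s := Finset.univ) (f := x)
    have h2 : ∑ j, x j ^ 2 ≤ ∑ j, |x j| ^ (2 * a j) := by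
      refine Finset.sum_le_sum fun j _ => ?_
      rcases (abs_nonneg (x j)).eq_or_lt with h | h
      · have hx : x j = 0 := abs_eq_zero.1 h.symm
        rw [hx]; simpa using (by positivity : (0 : ℝ) ≤ 0 ^ (2 * a j))
      · rw [← sq_abs, ← Real.rpow_natCast]
        exact Real.rpow_le_rpow_of_exponent_ge h (hall j) (by push_cast; linarith [ha1 j])
    have hN : (0 : ℝ) ≤ N := Nat.cast_nonneg N
    nlinarith [mul_le_mul_of_nonneg_left h2 hN]
  · push Not at hall
    obtain ⟨j, hj⟩ := hall
    have h1 : 1 ≤ |x j| ^ (2 * a j) := Real.one_le_rpow hj.le (by linarith [ha0 j])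
    have h2 : |x j| ^ (2 * a j) ≤ ∑ j, |x j| ^ (2 * a j) :=
      Finset.single_le_sum (f := fun j => |x j| ^ (2 * a j)) (fun j _ => hnn j) (Finset.mem_univ j)
    have hN : (0 : ℝ) ≤ N := Nat.cast_nonneg N
    nlinarith

/-- High frequencies: the interpolated kernel bound meets a finite fractional moment of `f`. Low
frequencies: the kernel is at most ‖h‖²‖ξ‖², and on bounded sets ‖h‖² is dominated by the powers
with exponent 2a_j ≤ 2. -/
theorem exists_variogram_le (hc : SpectralCondition β γ f) (hf : IsLegitimateSpectralDensity f)
    {a : Fin N → ℝ} (ha0 : ∀ j, 0 ≤ a j) (ha : ∀ j, a j < hurstBar β γ j) (M : ℝ) :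
    ∃ C : ℝ, 0 < C ∧ ∀ h : EuclideanSpace ℝ (Fin N), (∀ j, |h j| ≤ M) →
      variogram f h ≤ C * ∑ j, |h j| ^ (2 * a j) := by
  obtain ⟨c₁, c₂, c₃, hc₁, hc₂, hc₃, hb⟩ := hc.bounds
  have ha1 : ∀ j, a j ≤ 1 := fun j => (ha j).le.trans (min_le_left _ _)
  have haH : ∀ j, a j < hurst β γ j := fun j => (ha j).trans_le (min_le_right _ _)
  set A : Set (EuclideanSpace ℝ (Fin N)) := {ξ | c₃ ≤ ‖ξ‖} with hA
  have hAm : MeasurableSet A := measurableSet_le measurable_const measurable_norm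
  have hI : ∀ j, IntegrableOn (fun ξ : EuclideanSpace ℝ (Fin N) => |ξ j| ^ (2 * a j)) A
      (spectralMeasure f) := fun j => by
    refine ⟨(by fun_prop : Measurable fun ξ : EuclideanSpace ℝ (Fin N) =>
      |ξ j| ^ (2 * a j)).aestronglyMeasurable, ?_⟩
    rw [hasFiniteIntegral_iff_ofReal (ae_of_all _ fun ξ => by positivity)]
    exact hc.lintegral_rpow_lt_top hf (ha0 j) (haH j) hc₂ hc₃ fun ξ hξ => (hb ξ hξ).2
  obtain ⟨I, hIdef⟩ : ∃ I : Fin N → ℝ,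
      I = fun j => ∫ ξ in A, |ξ j| ^ (2 * a j) ∂(spectralMeasure f) := ⟨_, rfl⟩
  have hI0 : ∀ j, 0 ≤ I j := fun j => by
    rw [hIdef]; exact integral_nonneg fun ξ => by positivity
  obtain ⟨G, hG⟩ : ∃ G, G = ∫ ξ, levyWeight ξ ∂(spectralMeasure f) := ⟨_, rfl⟩
  have hG0 : 0 ≤ G := by rw [hG]; exact integral_nonneg levyWeight_nonneg
  have hN : (0 : ℝ) ≤ N := Nat.cast_nonneg N
  -- At least 1, so that powers of it increase with the exponent.
  set M' := max M 0 + 1 with hM'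
  have hM1 : 1 ≤ M' := by have := le_max_right M 0; linarith
  refine ⟨(4 + N) * ∑ j, I j + M' ^ 2 * ((1 + c₃ ^ 2) * G) + 1, by
    have := Finset.sum_nonneg fun j (_ : j ∈ Finset.univ) => hI0 j
    positivity, fun h hh => ?_⟩
  set Sh := ∑ j, |h j| ^ (2 * a j) with hS
  have hSj : ∀ j, |h j| ^ (2 * a j) ≤ Sh := fun j =>
    Finset.single_le_sum (f := fun j => |h j| ^ (2 * a j)) (fun j _ => by positivity)
      (Finset.mem_univ j)
  have hS0 : 0 ≤ Sh := Finset.sum_nonneg fun j _ => by positivity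
  have hnorm : ‖h‖ ^ 2 ≤ M' ^ 2 * Sh := by
    rw [EuclideanSpace.norm_sq_eq, hS, Finset.mul_sum]
    refine Finset.sum_le_sum fun j _ => ?_
    rw [Real.norm_eq_abs]
    have hjM : |h j| ≤ M' := (hh j).trans (by have := le_max_left M 0; linarith)
    rcases (abs_nonneg (h j)).eq_or_lt with h0 | h0
    · rw [← h0]
      have : (0 : ℝ) ≤ 0 ^ (2 * a j) := by positivity
      simpa using by positivity
    · calc |h j| ^ 2 = |h j| ^ (2 - 2 * a j) * |h j| ^ (2 * a j) := by
            rw [← Real.rpow_add h0, ← Real.rpow_natCast]; norm_num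
        _ ≤ M' ^ 2 * |h j| ^ (2 * a j) := by
            gcongr
            calc |h j| ^ (2 - 2 * a j) ≤ M' ^ (2 - 2 * a j) :=
                  Real.rpow_le_rpow h0.le hjM (by linarith [ha1 j])
              _ ≤ M' ^ (2 : ℝ) := Real.rpow_le_rpow_of_exponent_le hM1 (by linarith [ha0 j])
              _ = M' ^ 2 := by norm_num
  have h1 : ∫ ξ in A, vkernel h ξ ∂(spectralMeasure f) ≤ (4 + N) * ∑ j, (I j * Sh) := by
    have hle : ∀ ξ, vkernel h ξ ≤ (4 + N) * ∑ j, (|ξ j| ^ (2 * a j) * |h j| ^ (2 * a j)) := by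
      intro ξ
      have h3 : (inner ℝ h ξ : ℝ) = ∑ j, ξ j * h j := by
        simp [PiLp.inner_apply]
      have := min_four_sq_sum_le (x := fun j => ξ j * h j) ha0 ha1 (vkernel_le_four h ξ)
        (by rw [← h3]; exact vkernel_le_inner_sq h ξ)
      simpa only [abs_mul, Real.mul_rpow (abs_nonneg _) (abs_nonneg _)] using this
    calc ∫ ξ in A, vkernel h ξ ∂(spectralMeasure f)
        ≤ ∫ ξ in A, (4 + N) * ∑ j, (|ξ j| ^ (2 * a j) * |h j| ^ (2 * a j))
            ∂(spectralMeasure f) :=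
          integral_mono (hf.integrable_vkernel h).integrableOn
            ((integrable_finsetSum _ fun j _ => (hI j).mul_const _).const_mul _) hle
      _ = (4 + N) * ∑ j, (I j * |h j| ^ (2 * a j)) := by
          rw [integral_const_mul, integral_finsetSum _ fun j _ => (hI j).mul_const _]
          simp_rw [integral_mul_const, hIdef]
      _ ≤ _ := by
          refine mul_le_mul_of_nonneg_left (Finset.sum_le_sum fun j _ => ?_) (by positivity)
          exact mul_le_mul_of_nonneg_left (hSj j) (hI0 j)
  have h2 : ∫ ξ in Aᶜ, vkernel h ξ ∂(spectralMeasure f) ≤ ‖h‖ ^ 2 * ((1 + c₃ ^ 2) * G) := by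
    calc ∫ ξ in Aᶜ, vkernel h ξ ∂(spectralMeasure f)
        ≤ ∫ ξ in Aᶜ, ‖h‖ ^ 2 * ((1 + c₃ ^ 2) * levyWeight ξ) ∂(spectralMeasure f) := by
          refine setIntegral_mono_on (hf.integrable_vkernel h).integrableOn
            ((hf.integrable.const_mul _).const_mul _).integrableOn hAm.compl fun ξ hξ => ?_
          have hξ' : ‖ξ‖ ≤ c₃ := by
            rw [mem_compl_iff, hA, mem_ofPred_eq, not_le] at hξ
            exact hξ.le
          exact (vkernel_le_norm_sq h ξ).trans
            (mul_le_mul_of_nonneg_left (norm_sq_le_levyWeight hξ') (by positivity))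
      _ ≤ ∫ ξ, ‖h‖ ^ 2 * ((1 + c₃ ^ 2) * levyWeight ξ) ∂(spectralMeasure f) :=
          setIntegral_le_integral ((hf.integrable.const_mul _).const_mul _)
            (ae_of_all _ fun ξ => by have := levyWeight_nonneg ξ; positivity)
      _ = _ := by rw [integral_const_mul, integral_const_mul, hG]
  have h3 : variogram f h = ∫ ξ in A, vkernel h ξ ∂(spectralMeasure f) +
      ∫ ξ in Aᶜ, vkernel h ξ ∂(spectralMeasure f) :=
    (integral_add_compl hAm (hf.integrable_vkernel h)).symm
  rw [← Finset.sum_mul] at h1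
  have h4 : ‖h‖ ^ 2 * ((1 + c₃ ^ 2) * G) ≤ M' ^ 2 * Sh * ((1 + c₃ ^ 2) * G) :=
    mul_le_mul_of_nonneg_right hnorm (by positivity)
  rw [h3]
  have h5 : ((4 + N) * ∑ j, I j + M' ^ 2 * ((1 + c₃ ^ 2) * G) + 1) * Sh =
      (4 + N) * ((∑ j, I j) * Sh) + M' ^ 2 * Sh * ((1 + c₃ ^ 2) * G) + Sh := by ring
  linarith

end SpectralCondition

end AnisoField

namespace AnisoField

open Filter Topology Metric Set
open scoped NNReal

variable {N : ℕ} {f : EuclideanSpace ℝ (Fin N) → ℝ} {β : Fin N → ℝ} {γ : ℝ}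

/-! ### Lower bounds of the variogram -/

/-- The sides of an anisotropic box of frequencies with `j`-th coordinate of order `R`. -/
def freqSide (β : Fin N → ℝ) (j : Fin N) (R : ℝ) (i : Fin N) : Set ℝ :=
  {y | |y| ≤ R ^ (β j / β i) ∧ (i = j → R / 2 < |y|)}

/-- An anisotropic box of frequencies with `j`-th coordinate of order `R`. -/
def freqBox (β : Fin N → ℝ) (j : Fin N) (R : ℝ) : Set (EuclideanSpace ℝ (Fin N)) :=
  {ξ | ∀ i, ξ i ∈ freqSide β j R i}

theorem measurableSet_freqSide (β : Fin N → ℝ) (j : Fin N) (R : ℝ) (i : Fin N) :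
    MeasurableSet (freqSide β j R i) := by
  have h1 : MeasurableSet {y : ℝ | |y| ≤ R ^ (β j / β i)} :=
    measurableSet_le (f := fun y : ℝ => |y|) continuous_abs.measurable measurable_const
  have h2 : MeasurableSet {y : ℝ | i = j → R / 2 < |y|} := by
    by_cases h : i = j
    · simpa only [h, forall_const] using
        measurableSet_lt (g := fun y : ℝ => |y|) measurable_const continuous_abs.measurable
    · simp [h]
  exact h1.inter h2

theorem measurableSet_freqBox (β : Fin N → ℝ) (j : Fin N) (R : ℝ) :
    MeasurableSet (freqBox β j R) :=
  measurableSet_coord_box (measurableSet_freqSide β j R)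

theorem le_volume_freqSide (hβ : ∀ j, 0 < β j) (j : Fin N) {R : ℝ} (hR : 0 < R) (i : Fin N) :
    ENNReal.ofReal (1 / 2 * R ^ (β j / β i)) ≤ volume (freqSide β j R i) := by
  have hsub : Ioc (1 / 2 * R ^ (β j / β i)) (R ^ (β j / β i)) ⊆ freqSide β j R i := by
    intro y hy
    have hy0 : 0 < y := lt_trans (by positivity) hy.1
    refine ⟨by rw [abs_of_pos hy0]; exact hy.2, fun h => ?_⟩
    subst h
    rw [abs_of_pos hy0]
    have := hy.1
    rw [div_self (hβ i).ne', Real.rpow_one] at this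
    linarith
  refine le_trans ?_ (measure_mono hsub)
  rw [Real.volume_Ioc]
  exact ENNReal.ofReal_le_ofReal (by linarith)

theorem le_volume_freqBox (hβ : ∀ j, 0 < β j) (j : Fin N) {R : ℝ} (hR : 0 < R) :
    ENNReal.ofReal ((1 / 2) ^ N * R ^ (β j * ∑ i, 1 / β i)) ≤ volume (freqBox β j R) := by
  unfold freqBox
  rw [volume_coord_box (measurableSet_freqSide β j R)]
  refine le_trans (le_of_eq ?_) (Finset.prod_le_prod' fun i _ => le_volume_freqSide hβ j hR i)
  rw [← ENNReal.ofReal_prod_of_nonneg fun i _ => by positivity, Finset.prod_mul_distrib,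
    ← Real.rpow_sum_of_pos hR, Finset.mul_sum]
  simp [div_eq_mul_inv]

/-- Reflection of the `j`-th coordinate. -/
noncomputable def reflectCoord (j : Fin N) (ξ : EuclideanSpace ℝ (Fin N)) :
    EuclideanSpace ℝ (Fin N) := WithLp.toLp 2 fun i => if i = j then -ξ i else ξ i

theorem measurePreserving_reflectCoord (j : Fin N) :
    MeasurePreserving (reflectCoord j) (volume : Measure (EuclideanSpace ℝ (Fin N))) volume := by
  have h1 : MeasurePreserving (fun (a : Fin N → ℝ) i => if i = j then -a i else a i)
      volume volume := by
    refine volume_preserving_pi (f := fun (i : Fin N) (y : ℝ) => if i = j then -y else y)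
      fun i => ?_
    by_cases h : i = j
    · simpa [h] using Measure.measurePreserving_neg (volume : Measure ℝ)
    · simp only [h, if_false]
      exact MeasurePreserving.id (volume : Measure ℝ)
  exact (PiLp.volume_preserving_toLp (Fin N)).comp (h1.comp (PiLp.volume_preserving_ofLp (Fin N)))

/-- Since cos(y+x) + cos(y-x) = 2 cos y cos x ≤ 2 cos x when cos x ≥ 0, symmetrizing in x removes
the uncontrolled phase y. -/
theorem sq_le_two_sub_cos (x y : ℝ) (hx : |x| ≤ 1) :
    x ^ 2 ≤ 2 * (1 - Real.cos (y + x)) + 2 * (1 - Real.cos (y - x)) := by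
  have h1 := abs_le.1 (Real.cos_bound hx)
  have h0 : |x| ^ 4 ≤ x ^ 2 := by
    rw [← sq_abs x]
    exact pow_le_pow_of_le_one (abs_nonneg _) hx (by norm_num)
  have hx2 : x ^ 2 ≤ 1 := by rw [← sq_abs]; exact pow_le_one₀ (abs_nonneg _) hx
  have hc0 : 0 ≤ Real.cos x := by nlinarith [h1.1]
  have hc : Real.cos x ≤ 1 - x ^ 2 / 4 := by linarith [h1.2]
  rw [Real.cos_add, Real.cos_sub]
  have := mul_le_of_le_one_left hc0 (Real.cos_le_one y)
  linarith

/-- Reflecting one frequency coordinate changes the sign of h_j ξ_j only. Hence the other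
coordinates of `h`, however large, cannot cancel the contribution of `h j`. -/
theorem sq_le_vkernel_add_reflect (h ξ : EuclideanSpace ℝ (Fin N)) (j : Fin N)
    (hj : |h j * ξ j| ≤ 1) :
    (h j * ξ j) ^ 2 ≤ vkernel h ξ + vkernel h (reflectCoord j ξ) := by
  obtain ⟨y, hy⟩ : ∃ y, y = ∑ i ∈ Finset.univ.erase j, ξ i * h i := ⟨_, rfl⟩
  have h1 : (inner ℝ h ξ : ℝ) = y + h j * ξ j := by
    rw [PiLp.inner_apply, ← Finset.sum_erase_add _ _ (Finset.mem_univ j), hy]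
    simp [mul_comm]
  have h2 : (inner ℝ h (reflectCoord j ξ) : ℝ) = y - h j * ξ j := by
    rw [PiLp.inner_apply, ← Finset.sum_erase_add _ _ (Finset.mem_univ j), hy]
    have : ∑ i ∈ Finset.univ.erase j, inner ℝ (h i) (reflectCoord j ξ i) =
        ∑ i ∈ Finset.univ.erase j, ξ i * h i := by
      refine Finset.sum_congr rfl fun i hi => ?_
      simp [reflectCoord, (Finset.mem_erase.1 hi).1]
    rw [this]
    simp [reflectCoord]
    ring
  unfold vkernel
  rw [h1, h2]
  exact sq_le_two_sub_cos _ _ hj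

theorem le_setLIntegral_vkernel (hβ : ∀ j, 0 < β j) (j : Fin N) {R : ℝ} (hR : 0 < R)
    {h : EuclideanSpace ℝ (Fin N)} (hh : |h j| * R ≤ 1) :
    ENNReal.ofReal (h j ^ 2 * R ^ 2 / 8) * volume (freqBox β j R) ≤
      ∫⁻ ξ in freqBox β j R, ENNReal.ofReal (vkernel h ξ) := by
  obtain ⟨B, hB⟩ : ∃ B, B = freqBox β j R := ⟨_, rfl⟩
  have hBm : MeasurableSet B := hB ▸ measurableSet_freqBox β j R
  -- The box is invariant under the reflection, so the kernel and its reflection have equal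
  -- integrals over it.
  have hrefl : ∫⁻ ξ in B, ENNReal.ofReal (vkernel h (reflectCoord j ξ)) =
      ∫⁻ ξ in B, ENNReal.ofReal (vkernel h ξ) := by
    have h1 := (measurePreserving_reflectCoord j).setLIntegral_comp_preimage hBm
      (f := fun ξ => ENNReal.ofReal (vkernel h ξ)) (measurable_vkernel h).ennreal_ofReal
    have h2 : reflectCoord j ⁻¹' B = B := by
      ext ξ
      simp only [hB, freqBox, mem_preimage, mem_ofPred_eq]
      refine forall_congr' fun i => ?_
      simp only [reflectCoord, freqSide, mem_ofPred_eq]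
      split_ifs <;> simp
    rw [h2] at h1
    exact h1
  have hsum : ENNReal.ofReal (h j ^ 2 * R ^ 2 / 4) * volume B ≤
      2 * ∫⁻ ξ in B, ENNReal.ofReal (vkernel h ξ) := by
    rw [two_mul]
    nth_rw 2 [← hrefl]
    rw [← lintegral_add_left (measurable_vkernel h).ennreal_ofReal, ← setLIntegral_const]
    refine setLIntegral_mono' hBm fun ξ hξ => ?_
    rw [← ENNReal.ofReal_add (vkernel_nonneg _ _) (vkernel_nonneg _ _)]
    refine ENNReal.ofReal_le_ofReal ?_
    rw [hB] at hξ
    have hξj := hξ j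
    simp only [freqSide, mem_ofPred_eq, div_self (hβ j).ne', Real.rpow_one, forall_const] at hξj
    refine le_trans ?_ (sq_le_vkernel_add_reflect h ξ j ?_)
    · rw [mul_pow, ← sq_abs (ξ j)]
      have : R ^ 2 / 4 ≤ |ξ j| ^ 2 := by nlinarith [hξj.2]
      nlinarith [sq_nonneg (h j)]
    · rw [abs_mul]
      exact le_trans (mul_le_mul_of_nonneg_left hξj.1 (abs_nonneg _)) hh
  have e : ENNReal.ofReal (h j ^ 2 * R ^ 2 / 4) = 2 * ENNReal.ofReal (h j ^ 2 * R ^ 2 / 8) := by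
    rw [two_mul, ← ENNReal.ofReal_add (by positivity) (by positivity)]
    congr 1; ring
  rw [e, mul_assoc] at hsum
  rw [← hB]
  exact (ENNReal.mul_le_mul_iff_right two_ne_zero ENNReal.ofNat_ne_top).1 hsum

namespace SpectralCondition

/-- On the box, ∑ |ξ_i|^(β_i) ≤ N R^(β_j), so `f` is at least of order R^(-γβ_j). The volume is of
order R^(β_j ∑ 1/β_i) and the mean kernel of order h_j² R²; the exponents of R add up to 2 - 2H_j.
-/
theorem exists_le_setLIntegral_freqBox (hc : SpectralCondition β γ f)
    (hf : IsLegitimateSpectralDensity f) (j : Fin N) :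
    ∃ c R₀ : ℝ, 0 < c ∧ 0 < R₀ ∧ ∀ R, R₀ ≤ R → ∀ h : EuclideanSpace ℝ (Fin N), |h j| * R ≤ 1 →
      ENNReal.ofReal (c * (h j ^ 2 * R ^ (2 - 2 * hurst β γ j))) ≤
        ∫⁻ ξ in freqBox β j R, ENNReal.ofReal (vkernel h ξ) ∂(spectralMeasure f) := by
  obtain ⟨c₁, c₂, c₃, hc₁, hc₂, hc₃, hb⟩ := hc.bounds
  have hN : (0 : ℝ) < N := by have := j.pos; positivity
  refine ⟨c₁ * (N : ℝ) ^ (-γ) * (1 / 2) ^ N / 8, 2 * c₃, by positivity, by positivity,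
    fun R hR h hh => ?_⟩
  have hR0 : 0 < R := by linarith
  rw [setLIntegral_spectralMeasure hf.measurable (measurableSet_freqBox β j R)
    (measurable_vkernel h).ennreal_ofReal]
  have hlow : ∀ ξ ∈ freqBox β j R, c₁ / (N * R ^ β j) ^ γ ≤ f ξ := by
    intro ξ hξ
    have hξj := hξ j
    simp only [freqSide, mem_ofPred_eq, div_self (hc.beta_pos j).ne', Real.rpow_one,
      forall_const] at hξj
    have hnorm : c₃ ≤ ‖ξ‖ := by
      have := PiLp.norm_apply_le ξ j
      rw [Real.norm_eq_abs] at this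
      linarith [hξj.2]
    have hS : ∑ i, |ξ i| ^ β i ≤ N * R ^ β j := by
      have : ∀ i ∈ Finset.univ, |ξ i| ^ β i ≤ R ^ β j := fun i _ => by
        have h1 := (hξ i).1
        calc |ξ i| ^ β i ≤ (R ^ (β j / β i)) ^ β i :=
              Real.rpow_le_rpow (abs_nonneg _) h1 (hc.beta_pos i).le
          _ = R ^ β j := by
              rw [← Real.rpow_mul hR0.le, div_mul_cancel₀ _ (hc.beta_pos i).ne']
      simpa using Finset.sum_le_sum this
    have hS0 : 0 < ∑ i, |ξ i| ^ β i := by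
      refine Finset.sum_pos' (fun i _ => by positivity) ⟨j, Finset.mem_univ j, ?_⟩
      exact Real.rpow_pos_of_pos (by linarith [hξj.2]) _
    refine le_trans ?_ (hb ξ hnorm).1
    exact div_le_div_of_nonneg_left hc₁.le (Real.rpow_pos_of_pos hS0 _)
      (Real.rpow_le_rpow hS0.le hS hc.gamma_pos.le)
  calc ENNReal.ofReal (c₁ * (N : ℝ) ^ (-γ) * (1 / 2) ^ N / 8 *
        (h j ^ 2 * R ^ (2 - 2 * hurst β γ j)))
      = ENNReal.ofReal (c₁ / (N * R ^ β j) ^ γ) * (ENNReal.ofReal (h j ^ 2 * R ^ 2 / 8) *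
          ENNReal.ofReal ((1 / 2) ^ N * R ^ (β j * ∑ i, 1 / β i))) := by
        rw [← ENNReal.ofReal_mul (by positivity), ← ENNReal.ofReal_mul (by positivity)]
        congr 1
        rw [Real.mul_rpow hN.le (by positivity), ← Real.rpow_mul hR0.le, Real.rpow_neg hN.le]
        have e : R ^ (2 - 2 * hurst β γ j) =
            R ^ 2 * R ^ (β j * ∑ i, 1 / β i) * (R ^ (β j * γ))⁻¹ := by
          rw [← Real.rpow_natCast, ← Real.rpow_neg hR0.le, ← Real.rpow_add hR0,
            ← Real.rpow_add hR0]
          congr 1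
          unfold hurst
          push_cast
          ring
        rw [e]
        field_simp
    _ ≤ ENNReal.ofReal (c₁ / (N * R ^ β j) ^ γ) *
          ∫⁻ ξ in freqBox β j R, ENNReal.ofReal (vkernel h ξ) := by
        gcongr
        refine le_trans ?_ (le_setLIntegral_vkernel hc.beta_pos j hR0 hh)
        gcongr
        exact le_volume_freqBox hc.beta_pos j hR0
    _ = ∫⁻ ξ in freqBox β j R, ENNReal.ofReal (c₁ / (N * R ^ β j) ^ γ) *
          ENNReal.ofReal (vkernel h ξ) :=
        (lintegral_const_mul' _ _ ENNReal.ofReal_ne_top).symm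
    _ ≤ _ := by
        refine setLIntegral_mono' (measurableSet_freqBox β j R) fun ξ hξ => ?_
        gcongr
        exact hlow ξ hξ

/-- If H_j ≤ 1, the box at frequency R = 1/|h_j| gives |h_j|^(2H_j). If H_j ≥ 1, the fixed frequency
R₀ already gives h_j². -/
theorem exists_le_variogram_coord (hc : SpectralCondition β γ f)
    (hf : IsLegitimateSpectralDensity f) (j : Fin N) :
    ∃ c δ : ℝ, 0 < c ∧ 0 < δ ∧ ∀ h : EuclideanSpace ℝ (Fin N), |h j| ≤ δ →
      c * |h j| ^ (2 * hurstBar β γ j) ≤ variogram f h := by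
  obtain ⟨c, R₀, hc0, hR₀, hb⟩ := hc.exists_le_setLIntegral_freqBox hf j
  have hle : ∀ R, R₀ ≤ R → ∀ h : EuclideanSpace ℝ (Fin N), |h j| * R ≤ 1 →
      c * (h j ^ 2 * R ^ (2 - 2 * hurst β γ j)) ≤ variogram f h := fun R hR h hh => by
    have := (hb R hR h hh).trans (setLIntegral_le_lintegral _ _)
    rw [← hf.ofReal_variogram] at this
    exact (ENNReal.ofReal_le_ofReal_iff (variogram_nonneg h)).1 this
  refine ⟨c * min 1 (R₀ ^ (2 - 2 * hurst β γ j)), 1 / R₀, by positivity, by positivity,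
    fun h hh => ?_⟩
  have hhR : |h j| * R₀ ≤ 1 := by rwa [le_div_iff₀ hR₀] at hh
  rcases (abs_nonneg (h j)).eq_or_lt with h0 | h0
  · rw [← h0, Real.zero_rpow (by have := hc.hurstBar_pos j; positivity), mul_zero]
    exact variogram_nonneg h
  rcases le_total (hurst β γ j) 1 with hH | hH
  · have hbar : hurstBar β γ j = hurst β γ j := min_eq_right hH
    have := hle (1 / |h j|) (by rw [le_div_iff₀ h0]; linarith) h
      (by field_simp; exact le_rfl)
    have e : h j ^ 2 * (1 / |h j|) ^ (2 - 2 * hurst β γ j) = |h j| ^ (2 * hurst β γ j) := by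
      rw [one_div, Real.inv_rpow h0.le, ← Real.rpow_neg h0.le, ← sq_abs, ← Real.rpow_natCast,
        ← Real.rpow_add h0]
      congr 1; push_cast; ring
    rw [e] at this
    rw [hbar]
    refine le_trans ?_ this
    have : c * min 1 (R₀ ^ (2 - 2 * hurst β γ j)) ≤ c * 1 := by gcongr; exact min_le_left _ _
    rw [mul_one] at this
    gcongr
  · have hbar : hurstBar β γ j = 1 := min_eq_left hH
    have := hle R₀ le_rfl h hhR
    rw [hbar, mul_one, ← Nat.cast_ofNat, Real.rpow_natCast, sq_abs]
    refine le_trans ?_ this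
    rw [mul_assoc, mul_comm (h j ^ 2)]
    gcongr
    exact min_le_right _ _

/-- Lower bound of the variogram near the origin. -/
theorem exists_le_variogram (hc : SpectralCondition β γ f) (hf : IsLegitimateSpectralDensity f) :
    ∃ c δ : ℝ, 0 < c ∧ 0 < δ ∧ ∀ h : EuclideanSpace ℝ (Fin N), (∀ j, |h j| ≤ δ) → ∀ j,
      c * |h j| ^ (2 * hurstBar β γ j) ≤ variogram f h := by
  choose c δ hc0 hδ hb using fun j => hc.exists_le_variogram_coord hf j
  obtain ⟨c', hc'0, hc'⟩ : ∃ c', 0 < c' ∧ ∀ j, c' ≤ c j := by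
    have : ∀ᶠ x in 𝓝[>] (0 : ℝ), ∀ j, x < c j := by
      rw [eventually_all]
      exact fun j => nhdsWithin_le_nhds (eventually_lt_nhds (hc0 j))
    obtain ⟨x, hx, hx0⟩ := (this.and self_mem_nhdsWithin).exists
    exact ⟨x, hx0, fun j => (hx j).le⟩
  obtain ⟨δ', hδ'0, hδ'⟩ : ∃ c', 0 < c' ∧ ∀ j, c' ≤ δ j := by
    have : ∀ᶠ x in 𝓝[>] (0 : ℝ), ∀ j, x < δ j := by
      rw [eventually_all]
      exact fun j => nhdsWithin_le_nhds (eventually_lt_nhds (hδ j))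
    obtain ⟨x, hx, hx0⟩ := (this.and self_mem_nhdsWithin).exists
    exact ⟨x, hx0, fun j => (hx j).le⟩
  refine ⟨c', δ', hc'0, hδ'0, fun h hh j => le_trans ?_ (hb j h ((hh j).trans (hδ' j)))⟩
  gcongr
  exact hc' j

/-- The boxes at frequencies R₀2^m, m < L, are disjoint, and each contributes at least a fixed
multiple of h_j² because 2 - 2H_j ≥ 0. Taking L large beats any `K`. This covers H_j = 1, where the
power bound alone is merely quadratic. -/
theorem exists_mul_sq_le_variogram_coord (hc : SpectralCondition β γ f)
    (hf : IsLegitimateSpectralDensity f) (j : Fin N) (hj : hurst β γ j ≤ 1) (K : ℝ) :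
    ∃ δ : ℝ, 0 < δ ∧ ∀ h : EuclideanSpace ℝ (Fin N), |h j| ≤ δ →
      K * h j ^ 2 ≤ variogram f h := by
  obtain ⟨c, R₀, hc0, hR₀, hb⟩ := hc.exists_le_setLIntegral_freqBox hf j
  obtain ⟨a, ha⟩ : ∃ a, a = c * R₀ ^ (2 - 2 * hurst β γ j) := ⟨_, rfl⟩
  have ha0 : 0 < a := by rw [ha]; positivity
  obtain ⟨L, hL⟩ := exists_nat_gt (K / a)
  rw [div_lt_iff₀ ha0] at hL
  -- Small enough that |h_j| times the frequency is at most 1 in all L boxes.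
  refine ⟨1 / (R₀ * 2 ^ L), by positivity, fun h hh => ?_⟩
  rw [le_div_iff₀ (by positivity)] at hh
  have hdisj : Set.PairwiseDisjoint (Finset.range L : Set ℕ)
      fun m => freqBox β j (R₀ * 2 ^ m) := by
    have key : ∀ m n : ℕ, m < n →
        Disjoint (freqBox β j (R₀ * 2 ^ m)) (freqBox β j (R₀ * 2 ^ n)) := by
      intro m n hmn
      rw [Set.disjoint_left]
      intro ξ h1 h2
      have e1 := (h1 j).1
      have e2 := (h2 j).2 rfl
      rw [div_self (hc.beta_pos j).ne', Real.rpow_one] at e1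
      have : (2 : ℝ) ^ (m + 1) ≤ 2 ^ n := pow_le_pow_right₀ (by norm_num) hmn
      rw [pow_succ] at this
      nlinarith
    intro m _ n _ hmn
    rcases lt_or_gt_of_ne hmn with h' | h'
    · exact key m n h'
    · exact (key n m h').symm
  have hsum : ∑ m ∈ Finset.range L, ENNReal.ofReal (a * h j ^ 2) ≤
      ENNReal.ofReal (variogram f h) := by
    rw [hf.ofReal_variogram]
    calc ∑ m ∈ Finset.range L, ENNReal.ofReal (a * h j ^ 2)
        ≤ ∑ m ∈ Finset.range L, ∫⁻ ξ in freqBox β j (R₀ * 2 ^ m),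
            ENNReal.ofReal (vkernel h ξ) ∂(spectralMeasure f) := by
          refine Finset.sum_le_sum fun m hm => ?_
          have h1m : (1 : ℝ) ≤ 2 ^ m := one_le_pow₀ (by norm_num)
          have hmL : (2 : ℝ) ^ m ≤ 2 ^ L :=
            pow_le_pow_right₀ (by norm_num) (Finset.mem_range.1 hm).le
          refine le_trans (ENNReal.ofReal_le_ofReal ?_) (hb (R₀ * 2 ^ m) (by nlinarith) h ?_)
          · rw [ha, mul_assoc, mul_comm (R₀ ^ _)]
            gcongr
            · linarith
            · nlinarith
          · refine le_trans ?_ hh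
            gcongr
      _ = ∫⁻ ξ in ⋃ m ∈ Finset.range L, freqBox β j (R₀ * 2 ^ m),
            ENNReal.ofReal (vkernel h ξ) ∂(spectralMeasure f) :=
          (lintegral_biUnion_finset hdisj (fun m _ => measurableSet_freqBox β j _) _).symm
      _ ≤ _ := setLIntegral_le_lintegral _ _
  rw [Finset.sum_const, Finset.card_range, nsmul_eq_mul, ← ENNReal.ofReal_natCast,
    ← ENNReal.ofReal_mul (by positivity),
    ENNReal.ofReal_le_ofReal_iff (variogram_nonneg h)] at hsum
  nlinarith [sq_nonneg (h j)]

/-- Non-smoothness: if all Hurst indices are at most one then the variogram dominates any multiple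
of the squared norm near the origin. -/
theorem exists_mul_norm_sq_le_variogram (hc : SpectralCondition β γ f)
    (hf : IsLegitimateSpectralDensity f) (hH : ∀ j, hurst β γ j ≤ 1) (K : ℝ) :
    ∃ δ : ℝ, 0 < δ ∧ ∀ h : EuclideanSpace ℝ (Fin N), ‖h‖ ≤ δ → K * ‖h‖ ^ 2 ≤ variogram f h := by
  choose δ hδ hb using fun j => hc.exists_mul_sq_le_variogram_coord hf j (hH j) (K * N)
  obtain ⟨δ', hδ'0, hδ'⟩ : ∃ c', 0 < c' ∧ ∀ j, c' ≤ δ j := by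
    have : ∀ᶠ x in 𝓝[>] (0 : ℝ), ∀ j, x < δ j := by
      rw [eventually_all]
      exact fun j => nhdsWithin_le_nhds (eventually_lt_nhds (hδ j))
    obtain ⟨x, hx, hx0⟩ := (this.and self_mem_nhdsWithin).exists
    exact ⟨x, hx0, fun j => (hx j).le⟩
  refine ⟨δ', hδ'0, fun h hh => ?_⟩
  rcases Nat.eq_zero_or_pos N with rfl | hN
  · have : h = 0 := Subsingleton.elim _ _
    rw [this]; simpa using variogram_nonneg _
  have hN' : (0 : ℝ) < N := by positivity
  have h1 : ∑ j, K * N * h j ^ 2 ≤ ∑ _j : Fin N, variogram f h :=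
    Finset.sum_le_sum fun j _ => hb j h <| by
      have := PiLp.norm_apply_le h j
      rw [Real.norm_eq_abs] at this
      exact this.trans (hh.trans (hδ' j))
  rw [← Finset.mul_sum, Finset.sum_const, Finset.card_univ, Fintype.card_fin, nsmul_eq_mul] at h1
  have h2 : ‖h‖ ^ 2 = ∑ j, h j ^ 2 := by
    rw [EuclideanSpace.norm_sq_eq]; simp
  rw [h2]
  have h3 : (N : ℝ) * (K * ∑ j, h j ^ 2) ≤ N * variogram f h := by linarith
  exact le_of_mul_le_mul_left h3 hN'

/-- At high frequencies `f` is positive, and there the kernel is positive on a nonempty open set. -/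
theorem variogram_pos (hc : SpectralCondition β γ f) (hf : IsLegitimateSpectralDensity f)
    {h : EuclideanSpace ℝ (Fin N)} (hh : h ≠ 0) : 0 < variogram f h := by
  obtain ⟨c₁, c₂, c₃, hc₁, hc₂, hc₃, hb⟩ := hc.bounds
  have hn : 0 < ‖h‖ := norm_pos_iff.2 hh
  obtain ⟨U, hU⟩ : ∃ U : Set (EuclideanSpace ℝ (Fin N)),
      U = {ξ | c₃ < ‖ξ‖ ∧ 0 < vkernel h ξ} := ⟨_, rfl⟩
  have hUo : IsOpen U := by
    rw [hU]
    exact (isOpen_lt continuous_const continuous_norm).inter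
      (isOpen_lt continuous_const (continuous_vkernel.comp (Continuous.prodMk_right h)))
  have hUne : U.Nonempty := by
    obtain ⟨k, hk⟩ := exists_nat_gt (c₃ * ‖h‖)
    -- The inner product with `h` is an odd multiple of π, where the kernel equals 4; large k pushes
    -- the point beyond c₃.
    refine ⟨((2 * k + 1) * Real.pi / ‖h‖ ^ 2) • h, ?_⟩
    rw [hU]
    constructor
    · rw [norm_smul, Real.norm_of_nonneg (by positivity)]
      have h1 : (2 * k + 1) * Real.pi / ‖h‖ ^ 2 * ‖h‖ = (2 * k + 1) * Real.pi / ‖h‖ := by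
        field_simp
      rw [h1, lt_div_iff₀ hn]
      have := Real.pi_gt_three
      have hk0 : (0 : ℝ) ≤ k := Nat.cast_nonneg k
      nlinarith
    · unfold vkernel
      rw [inner_smul_right, real_inner_self_eq_norm_sq, div_mul_cancel₀ _ (by positivity)]
      have : Real.cos ((2 * k + 1) * Real.pi) = -1 := by
        rw [show (2 * (k : ℝ) + 1) * Real.pi = Real.pi + k * (2 * Real.pi) by ring,
          Real.cos_add_nat_mul_two_pi, Real.cos_pi]
      rw [this]; norm_num
  have hvol : 0 < volume U := hUo.measure_pos volume hUne
  rw [← ENNReal.ofReal_pos, hf.ofReal_variogram]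
  refine lt_of_lt_of_le ?_ (setLIntegral_le_lintegral U _)
  rw [setLIntegral_spectralMeasure hf.measurable hUo.measurableSet
    (measurable_vkernel h).ennreal_ofReal]
  rw [setLIntegral_pos_iff (by have := hf.measurable; have := measurable_vkernel h; fun_prop)]
  refine lt_of_lt_of_le hvol (measure_mono fun ξ hξ => ⟨?_, hξ⟩)
  rw [hU] at hξ
  obtain ⟨k, hk⟩ := exists_coord_le hc₃ hξ.1.le
  have hN : (0 : ℝ) < N := by have := k.pos; positivity
  have hS0 : 0 < ∑ i, |ξ i| ^ β i := by
    refine Finset.sum_pos' (fun i _ => by positivity) ⟨k, Finset.mem_univ k, ?_⟩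
    exact Real.rpow_pos_of_pos (lt_of_lt_of_le (by positivity) hk) _
  have hf0 : 0 < f ξ := lt_of_lt_of_le (by positivity) (hb ξ hξ.1.le).1
  simp only [Function.mem_support, ne_eq, mul_eq_zero, ENNReal.ofReal_eq_zero, not_or, not_le]
  exact ⟨hf0, hξ.2⟩

/-- Increments of the field are asymptotically uncorrelated with its values. -/
theorem exists_cross_le (hc : SpectralCondition β γ f)
    (hf : IsLegitimateSpectralDensity f) (hH : ∀ j, hurst β γ j ≤ 1) {m : ℝ} (hm : 0 < m) :
    ∃ δ : ℝ, 0 < δ ∧ ∀ s h : EuclideanSpace ℝ (Fin N), m ≤ variogram f s → ‖h‖ ≤ δ → h ≠ 0 →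
      (variogram f (s + h) - variogram f s - variogram f h) ^ 2 ≤
        2 * (variogram f s * variogram f h) := by
  -- As the kernel is at most 4, a tail mass below m/32 leaves at most m/8 ≤ v(s)/8 of the variance
  -- of X(s) above frequency R.
  have hev : ∀ᶠ n : ℕ in atTop, spectralMeasure f {ξ | (n : ℝ) + 1 ≤ ‖ξ‖} <
      ENNReal.ofReal (m / 32) :=
    hf.tendsto_measure_norm_ge.eventually_lt_const (by positivity)
  obtain ⟨n, hn⟩ := hev.exists
  set R : ℝ := n + 1 with hR
  have hR0 : 0 < R := by positivity
  obtain ⟨A, hA⟩ : ∃ A : Set (EuclideanSpace ℝ (Fin N)), A = {ξ | R ≤ ‖ξ‖} := ⟨_, rfl⟩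
  have hAm : MeasurableSet A := by
    rw [hA]; exact measurableSet_le measurable_const measurable_norm
  obtain ⟨G, hG⟩ : ∃ G, G = ∫ ξ, levyWeight ξ ∂(spectralMeasure f) := ⟨_, rfl⟩
  have hG0 : 0 ≤ G := by rw [hG]; exact integral_nonneg levyWeight_nonneg
  -- With this multiple, frequencies below R carry at most v(h)/8. Both localizations then hold with
  -- η = 1/8, whence the constant 16/8 = 2.
  obtain ⟨δ, hδ, hb⟩ := hc.exists_mul_norm_sq_le_variogram hf hH
    (8 * ((1 + R ^ 2) * G))
  refine ⟨δ, hδ, fun s h hs hh hne => ?_⟩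
  have h2 : ∫ ξ in A, vkernel s ξ ∂(spectralMeasure f) ≤ 1 / 8 * variogram f s := by
    have hlt : spectralMeasure f A < ⊤ := by rw [hA]; exact hf.measure_norm_ge_lt_top hR0
    have : ∫ ξ in A, vkernel s ξ ∂(spectralMeasure f) ≤
        ∫ _ξ in A, (4 : ℝ) ∂(spectralMeasure f) :=
      integral_mono (hf.integrable_vkernel s).integrableOn
        (integrableOn_const hlt.ne) (vkernel_le_four s)
    rw [setIntegral_const, smul_eq_mul] at this
    have h3 : (spectralMeasure f).real A ≤ m / 32 :=
      ENNReal.toReal_le_of_le_ofReal (by positivity) (by rw [hA]; exact hn.le)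
    linarith
  have h1 : ∫ ξ in Aᶜ, vkernel h ξ ∂(spectralMeasure f) ≤ 1 / 8 * variogram f h := by
    have : ∫ ξ in Aᶜ, vkernel h ξ ∂(spectralMeasure f) ≤ ‖h‖ ^ 2 * ((1 + R ^ 2) * G) := by
      calc ∫ ξ in Aᶜ, vkernel h ξ ∂(spectralMeasure f)
          ≤ ∫ ξ in Aᶜ, ‖h‖ ^ 2 * ((1 + R ^ 2) * levyWeight ξ) ∂(spectralMeasure f) := by
            refine setIntegral_mono_on (hf.integrable_vkernel h).integrableOn
              ((hf.integrable.const_mul _).const_mul _).integrableOn hAm.compl fun ξ hξ => ?_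
            have hξ' : ‖ξ‖ ≤ R := by
              rw [mem_compl_iff, hA, mem_ofPred_eq, not_le] at hξ
              exact hξ.le
            exact (vkernel_le_norm_sq h ξ).trans
              (mul_le_mul_of_nonneg_left (norm_sq_le_levyWeight hξ') (by positivity))
        _ ≤ ∫ ξ, ‖h‖ ^ 2 * ((1 + R ^ 2) * levyWeight ξ) ∂(spectralMeasure f) :=
            setIntegral_le_integral ((hf.integrable.const_mul _).const_mul _)
              (ae_of_all _ fun ξ => by have := levyWeight_nonneg ξ; positivity)
        _ = _ := by rw [integral_const_mul, integral_const_mul, hG]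
    have := hb h hh
    linarith
  rw [hA] at h1 h2
  have := hf.abs_cross_le (by norm_num) (hm.trans_le hs) (hc.variogram_pos hf hne) h1 h2
  linarith

end SpectralCondition

end AnisoField

namespace AnisoField

open Filter Topology Metric Set
open scoped NNReal

/-! ### Estimates for Gaussian laws -/

theorem gaussianPDF_le {w : ℝ≥0} (hw : w ≠ 0) (y : ℝ) :
    gaussianPDF 0 w y ≤ ENNReal.ofReal (1 / (2 * Real.sqrt w)) := by
  unfold gaussianPDF gaussianPDFReal
  refine ENNReal.ofReal_le_ofReal ?_
  have hw0 : (0 : ℝ) < w := by exact_mod_cast pos_iff_ne_zero.2 hw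
  have h1 : Real.exp (-(y - 0) ^ 2 / (2 * w)) ≤ 1 := by
    rw [Real.exp_le_one_iff]
    exact div_nonpos_of_nonpos_of_nonneg (by nlinarith [sq_nonneg (y - 0)]) (by positivity)
  have h2 : 2 * Real.sqrt w ≤ Real.sqrt (2 * Real.pi * w) := by
    refine Real.le_sqrt_of_sq_le ?_
    rw [mul_pow, Real.sq_sqrt hw0.le]
    nlinarith [Real.pi_gt_three]
  have h3 : 0 < 2 * Real.sqrt w := by positivity
  calc (Real.sqrt (2 * Real.pi * w))⁻¹ * Real.exp (-(y - 0) ^ 2 / (2 * w))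
      ≤ (2 * Real.sqrt w)⁻¹ * 1 := by gcongr
    _ = _ := by rw [mul_one, one_div]

theorem gaussianReal_Icc_le {w : ℝ≥0} (hw : w ≠ 0) (x u : ℝ) :
    gaussianReal 0 w (Icc (x - u) (x + u)) ≤ ENNReal.ofReal (u / Real.sqrt w) := by
  rw [gaussianReal_apply 0 hw]
  calc ∫⁻ y in Icc (x - u) (x + u), gaussianPDF 0 w y
      ≤ ∫⁻ _y in Icc (x - u) (x + u), ENNReal.ofReal (1 / (2 * Real.sqrt w)) :=
        lintegral_mono fun y => gaussianPDF_le hw y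
    _ = ENNReal.ofReal (1 / (2 * Real.sqrt w)) * ENNReal.ofReal (2 * u) := by
        rw [setLIntegral_const, Real.volume_Icc]; congr 2; ring
    _ = ENNReal.ofReal (u / Real.sqrt w) := by
        rw [← ENNReal.ofReal_mul (by positivity)]
        congr 1
        have : 0 < Real.sqrt w := Real.sqrt_pos.2 (by exact_mod_cast pos_iff_ne_zero.2 hw)
        field_simp

theorem le_gaussianReal_Icc {w₀ w₁ M : ℝ} (hw₀ : 0 < w₀) (hw₁ : w₀ ≤ w₁) :
    ∃ c : ℝ, 0 < c ∧ ∀ (w : ℝ≥0) (x u : ℝ), w₀ ≤ w → w ≤ w₁ → |x| ≤ M → 0 < u → u ≤ 1 →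
      ENNReal.ofReal (c * u) ≤ gaussianReal 0 w (Icc (x - u) (x + u)) := by
  refine ⟨(Real.sqrt (2 * Real.pi * w₁))⁻¹ * Real.exp (-(M + 1) ^ 2 / (2 * w₀)) * 2,
    by have := hw₀.trans_le hw₁; positivity, fun w x u h0 h1 hx hu0 hu1 => ?_⟩
  have hwpos : (0 : ℝ) < w := hw₀.trans_le h0
  have hw : w ≠ 0 := by rintro rfl; simp at hwpos
  rw [gaussianReal_apply 0 hw]
  calc ENNReal.ofReal ((Real.sqrt (2 * Real.pi * w₁))⁻¹ * Real.exp (-(M + 1) ^ 2 / (2 * w₀)) * 2 * u)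
      = ∫⁻ _y in Icc (x - u) (x + u),
          ENNReal.ofReal ((Real.sqrt (2 * Real.pi * w₁))⁻¹ * Real.exp (-(M + 1) ^ 2 / (2 * w₀))) := by
        rw [setLIntegral_const, Real.volume_Icc, ← ENNReal.ofReal_mul (by positivity)]
        congr 1; ring
    _ ≤ _ := by
        refine setLIntegral_mono' measurableSet_Icc fun y hy => ?_
        unfold gaussianPDF gaussianPDFReal
        refine ENNReal.ofReal_le_ofReal ?_
        have hy2 : y ^ 2 ≤ (M + 1) ^ 2 := by
          have := abs_le.1 hx
          refine sq_le_sq' (by linarith [hy.1]) (by linarith [hy.2])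
        have h2 : -(M + 1) ^ 2 / (2 * w₀) ≤ -(y - 0) ^ 2 / (2 * w) := by
          rw [neg_div, neg_div, sub_zero, neg_le_neg_iff]
          exact div_le_div₀ (by positivity) hy2 (by positivity) (by linarith)
        gcongr

/-- The sub-Gaussian tail bound admits any variance proxy `c ≥ w` and includes the degenerate law `w
= 0`. -/
theorem gaussianReal_abs_ge_le {w c : ℝ≥0} (hwc : w ≤ c) {u : ℝ} (hu : 0 ≤ u) :
    gaussianReal 0 w {y | u ≤ |y|} ≤ ENNReal.ofReal (2 * Real.exp (-u ^ 2 / (2 * c))) := by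
  have hsub : HasSubgaussianMGF id c (gaussianReal 0 w) := by
    refine ⟨fun t => integrable_exp_mul_gaussianReal t, fun t => ?_⟩
    rw [mgf_id_gaussianReal]
    have : (w : ℝ) ≤ c := by exact_mod_cast hwc
    simp only [zero_mul, zero_add]
    gcongr
  have h1 := hsub.measure_ge_le hu
  have h2 := hsub.neg.measure_ge_le hu
  have hset : {y : ℝ | u ≤ |y|} ⊆ {y | u ≤ id y} ∪ {y | u ≤ (-id) y} := by
    intro y hy
    have hy' : u ≤ |y| := hy
    rcases le_abs.1 hy' with h | h
    · exact Or.inl h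
    · exact Or.inr h
  have h3 : (gaussianReal 0 w).real {y | u ≤ |y|} ≤ 2 * Real.exp (-u ^ 2 / (2 * c)) := by
    refine (measureReal_mono hset).trans ((measureReal_union_le _ _).trans ?_)
    linarith
  rw [← ofReal_measureReal]
  exact ENNReal.ofReal_le_ofReal h3

/-- Small ball estimate for a pair of jointly Gaussian variables. -/
theorem measure_pair_le {Ω : Type*} [MeasurableSpace Ω] {P : Measure Ω} [IsProbabilityMeasure P]
    {U V : Ω → ℝ} (h : HasGaussianLaw (fun ω => (U ω, V ω)) P) (hU0 : ∫ ω, U ω ∂P = 0)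
    (hV0 : ∫ ω, V ω ∂P = 0) {a b c : ℝ} (hUU : ∫ ω, U ω * U ω ∂P = a)
    (hVV : ∫ ω, V ω * V ω ∂P = b) (hUV : ∫ ω, U ω * V ω ∂P = c) (ha : 0 < a)
    (hd : 0 < b - c ^ 2 / a) (x y u : ℝ) (hu : 0 ≤ u) :
    P {ω | |U ω - x| ≤ u ∧ |V ω - y| ≤ u} ≤
      ENNReal.ofReal (u / Real.sqrt a * (u / Real.sqrt (b - c ^ 2 / a))) := by
  -- Regression of V on U: the residual V - kU is uncorrelated with U, hence independent of it, with
  -- variance b - c²/a.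
  set k := c / a with hk
  set Z : Ω → ℝ := fun ω => V ω - k * U ω with hZ
  have hU := h.fst
  have hV := h.snd
  have hUZ : HasGaussianLaw (fun ω => (U ω, Z ω)) P :=
    h.map_fun ((ContinuousLinearMap.fst ℝ ℝ ℝ).prod
      (ContinuousLinearMap.snd ℝ ℝ ℝ - k • ContinuousLinearMap.fst ℝ ℝ ℝ))
  have hZg := hUZ.snd
  have hU2 := hU.memLp_two
  have hV2 := hV.memLp_two
  have hZ2 := hZg.memLp_two
  have iUU : Integrable (fun ω => U ω * U ω) P := hU2.integrable_mul hU2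
  have iUV : Integrable (fun ω => U ω * V ω) P := hU2.integrable_mul hV2
  have iVV : Integrable (fun ω => V ω * V ω) P := hV2.integrable_mul hV2
  have hZ0 : ∫ ω, Z ω ∂P = 0 := by
    rw [hZ, integral_sub hV.integrable (hU.integrable.const_mul k), integral_const_mul, hU0, hV0]
    simp
  have hcov : cov[U, Z; P] = 0 := by
    rw [covariance_eq_sub hU2 hZ2, hU0, zero_mul, sub_zero]
    have : ∀ ω, (U * Z) ω = U ω * V ω - k * (U ω * U ω) := fun ω => by
      simp only [Pi.mul_apply, hZ]; ring
    simp_rw [this]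
    rw [integral_sub iUV (iUU.const_mul k), integral_const_mul, hUU, hUV, hk]
    field_simp
    ring
  have hvarU : Var[U; P] = a := by
    rw [variance_of_integral_eq_zero hU.aemeasurable hU0, ← hUU]
    simp_rw [sq]
  have hvarZ : Var[Z; P] = b - c ^ 2 / a := by
    rw [variance_of_integral_eq_zero hZg.aemeasurable hZ0]
    have : ∀ ω, Z ω ^ 2 = V ω * V ω - (2 * k) * (U ω * V ω) + k ^ 2 * (U ω * U ω) := fun ω => by
      simp only [hZ]; ring
    simp_rw [this]
    have e1 := integral_add (iVV.sub (iUV.const_mul (2 * k))) (iUU.const_mul (k ^ 2))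
    have e2 := integral_sub iVV (iUV.const_mul (2 * k))
    simp only [Pi.sub_apply] at e1
    rw [e1, e2, integral_const_mul, integral_const_mul, hUU, hVV, hUV, hk]
    field_simp
    ring
  have hind : IndepFun U Z P := hUZ.indepFun_of_covariance_eq_zero hcov
  have hmap := (indepFun_iff_map_prod_eq_prod_map_map hU.aemeasurable hZg.aemeasurable).1 hind
  have hlawU : P.map U = gaussianReal 0 a.toNNReal := by
    rw [hU.map_eq_gaussianReal, hU0, hvarU]
  have hlawZ : P.map Z = gaussianReal 0 (b - c ^ 2 / a).toNNReal := by
    rw [hZg.map_eq_gaussianReal, hZ0, hvarZ]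
  set S : Set (ℝ × ℝ) := {q | |q.1 - x| ≤ u ∧ |q.2 + k * q.1 - y| ≤ u} with hS
  have hSm : MeasurableSet S := by
    refine IsClosed.measurableSet ?_
    exact (isClosed_le (f := fun q : ℝ × ℝ => |q.1 - x|) (by fun_prop) continuous_const).inter
      (isClosed_le (f := fun q : ℝ × ℝ => |q.2 + k * q.1 - y|) (by fun_prop) continuous_const)
  have hpre : {ω | |U ω - x| ≤ u ∧ |V ω - y| ≤ u} = (fun ω => (U ω, Z ω)) ⁻¹' S := by
    ext ω
    simp [hS, hZ]
  rw [hpre, ← Measure.map_apply_of_aemeasurable hUZ.aemeasurable hSm, hmap, hlawU, hlawZ,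
    Measure.prod_apply hSm]
  have hwa : a.toNNReal ≠ 0 := by simpa using ha
  have hwd : (b - c ^ 2 / a).toNNReal ≠ 0 := by simpa using hd
  have hslice : ∀ q : ℝ, gaussianReal 0 (b - c ^ 2 / a).toNNReal (Prod.mk q ⁻¹' S) ≤
      (Icc (x - u) (x + u)).indicator
        (fun _ => ENNReal.ofReal (u / Real.sqrt (b - c ^ 2 / a))) q := by
    intro q
    by_cases hq : q ∈ Icc (x - u) (x + u)
    · rw [indicator_of_mem hq]
      have := gaussianReal_Icc_le hwd (y - k * q) u
      rw [Real.coe_toNNReal _ hd.le] at this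
      refine le_trans (measure_mono ?_) this
      intro z hz
      have := abs_le.1 hz.2
      exact ⟨by linarith [this.1], by linarith [this.2]⟩
    · rw [indicator_of_notMem hq]
      have : Prod.mk q ⁻¹' S = ∅ := by
        ext z
        simp only [hS, mem_preimage, mem_ofPred_eq, mem_empty_iff_false, iff_false, not_and]
        intro hq'
        exact absurd ⟨by linarith [(abs_le.1 hq').1], by linarith [(abs_le.1 hq').2]⟩ hq
      rw [this]; simp
  refine (lintegral_mono hslice).trans ?_
  rw [lintegral_indicator measurableSet_Icc, setLIntegral_const, mul_comm]
  have h1 := gaussianReal_Icc_le hwa x u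
  rw [Real.coe_toNNReal _ ha.le] at h1
  rw [ENNReal.ofReal_mul (by positivity)]
  gcongr

/-! ### Regular versions of the field -/

/-- A family of independent continuous centered Gaussian fields with variogram `v`. -/
structure IsRegularField {N p : ℕ} {Ω : Type*} [MeasurableSpace Ω]
    (X : Fin p → EuclideanSpace ℝ (Fin N) → Ω → ℝ) (P : Measure Ω)
    (v : EuclideanSpace ℝ (Fin N) → ℝ) : Prop where
  measurable : ∀ i t, Measurable (X i t)
  continuous : ∀ i ω, Continuous fun t => X i t ω
  indep : iIndepFun (fun i ω t => X i t ω) P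
  gaussian : ∀ i, IsGaussianProcess (X i) P
  centered : ∀ i t, ∫ ω, X i t ω ∂P = 0
  covariance : ∀ i s t, ∫ ω, X i s ω * X i t ω ∂P = (v s + v t - v (s - t)) / 2
  variogram_zero : v 0 = 0
  variogram_neg : ∀ t, v (-t) = v t

namespace IsRegularField

variable {N p : ℕ} {Ω : Type*} [MeasurableSpace Ω] {P : Measure Ω}
  {X : Fin p → EuclideanSpace ℝ (Fin N) → Ω → ℝ} {v : EuclideanSpace ℝ (Fin N) → ℝ}

theorem map_value (h : IsRegularField X P v) (i : Fin p) (t : EuclideanSpace ℝ (Fin N)) :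
    P.map (X i t) = gaussianReal 0 (v t).toNNReal := by
  have hg := (h.gaussian i).hasGaussianLaw_eval t
  rw [hg.map_eq_gaussianReal, h.centered,
    variance_of_integral_eq_zero hg.aemeasurable (h.centered i t)]
  have := h.covariance i t t
  rw [sub_self, h.variogram_zero] at this
  simp_rw [sq, this]
  congr 2; ring

theorem map_increment (h : IsRegularField X P v) (i : Fin p) (s t : EuclideanSpace ℝ (Fin N)) :
    P.map (fun ω => X i s ω - X i t ω) = gaussianReal 0 (v (s - t)).toNNReal := by
  have hg := (h.gaussian i).hasGaussianLaw_fun_sub (s := s) (t := t)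
  have hs := (h.gaussian i).hasGaussianLaw_eval s
  have ht := (h.gaussian i).hasGaussianLaw_eval t
  have h0 : ∫ ω, (X i s ω - X i t ω) ∂P = 0 := by
    rw [integral_sub hs.integrable ht.integrable, h.centered, h.centered, sub_zero]
  rw [hg.map_eq_gaussianReal, h0, variance_of_integral_eq_zero hg.aemeasurable h0]
  have e : ∀ ω, (X i s ω - X i t ω) ^ 2 =
      X i s ω * X i s ω - 2 * (X i s ω * X i t ω) + X i t ω * X i t ω := fun ω => by ring
  have iss := hs.memLp_two.integrable_mul hs.memLp_two
  have ist := hs.memLp_two.integrable_mul ht.memLp_two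
  have itt := ht.memLp_two.integrable_mul ht.memLp_two
  have hval : ∫ ω, (X i s ω - X i t ω) ^ 2 ∂P = v (s - t) := by
    simp_rw [e]
    have e1 := integral_add (iss.sub (ist.const_mul 2)) itt
    have e2 := integral_sub iss (ist.const_mul 2)
    simp only [Pi.mul_apply, Pi.sub_apply] at e1 e2
    rw [e1, e2, integral_const_mul, h.covariance, h.covariance, h.covariance, sub_self, sub_self,
      h.variogram_zero]
    ring
  rw [hval]

theorem measure_forall (h : IsRegularField X P v)
    {S : Fin p → Set (EuclideanSpace ℝ (Fin N) → ℝ)} (hS : ∀ i, MeasurableSet (S i)) :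
    P {ω | ∀ i, (fun t => X i t ω) ∈ S i} = ∏ i, P {ω | (fun t => X i t ω) ∈ S i} := by
  have := h.indep.measure_inter_preimage_eq_mul Finset.univ (sets := S) fun i _ => hS i
  have e : {ω | ∀ i, (fun t => X i t ω) ∈ S i} =
      ⋂ i ∈ Finset.univ, (fun ω t => X i t ω) ⁻¹' S i := by
    ext ω; simp
  rw [e, this]
  rfl

/-- Independence gives the exponent `p`. Lowering it to `q` is free: for a ratio at most 1 powers
decrease in the exponent, and for a larger ratio the bound exceeds 1. A `q` below `p` is what the
range needs when ∑ 1/H_j ≤ p. -/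
theorem measure_increment_le [IsProbabilityMeasure P] (h : IsRegularField X P v) {s t : EuclideanSpace ℝ (Fin N)}
    (hv : 0 < v (s - t)) {ρ : ℝ} (hρ : 0 < ρ) {q : ℝ} (hq0 : 0 ≤ q) (hqp : q ≤ p) :
    P {ω | ∀ i, |X i s ω - X i t ω| ≤ ρ} ≤
      ENNReal.ofReal ((ρ / Real.sqrt (v (s - t))) ^ q) := by
  have hsq : 0 < Real.sqrt (v (s - t)) := Real.sqrt_pos.2 hv
  rcases le_total 1 (ρ / Real.sqrt (v (s - t))) with h1 | h1
  · refine prob_le_one.trans ?_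
    rw [← ENNReal.ofReal_one]
    exact ENNReal.ofReal_le_ofReal (Real.one_le_rpow h1 hq0)
  have hm : ∀ _ : Fin p, MeasurableSet {g : EuclideanSpace ℝ (Fin N) → ℝ | |g s - g t| ≤ ρ} :=
    fun _ => measurableSet_le (by fun_prop) measurable_const
  have h2 := h.measure_forall hm
  simp only [mem_ofPred_eq] at h2
  rw [h2]
  have hw : (v (s - t)).toNNReal ≠ 0 := by simpa using hv
  have h3 : ∀ i ∈ Finset.univ, P {ω | |X i s ω - X i t ω| ≤ ρ} ≤
      ENNReal.ofReal (ρ / Real.sqrt (v (s - t))) := fun i _ => by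
    have := gaussianReal_Icc_le hw 0 ρ
    have hms : Measurable fun ω => X i s ω - X i t ω := (h.measurable i s).sub (h.measurable i t)
    rw [Real.coe_toNNReal _ hv.le, ← h.map_increment i,
      Measure.map_apply hms measurableSet_Icc] at this
    refine le_trans (measure_mono fun ω hω => ?_) this
    have := abs_le.1 (show |X i s ω - X i t ω| ≤ ρ from hω)
    exact ⟨by linarith [this.1], by linarith [this.2]⟩
  refine (Finset.prod_le_prod' h3).trans ?_
  rw [Finset.prod_const, Finset.card_univ, Fintype.card_fin,
    ← ENNReal.ofReal_pow (by positivity), ← Real.rpow_natCast]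
  exact ENNReal.ofReal_le_ofReal (Real.rpow_le_rpow_of_exponent_ge (by positivity) h1 hqp)

theorem measure_value_le (h : IsRegularField X P v) {t : EuclideanSpace ℝ (Fin N)}
    (hv : 0 < v t) (x : EuclideanSpace ℝ (Fin p)) {u : ℝ} (hu : 0 ≤ u) :
    P {ω | ∀ i, |X i t ω - x i| ≤ u} ≤ ENNReal.ofReal ((u / Real.sqrt (v t)) ^ p) := by
  have hm : ∀ i : Fin p, MeasurableSet {g : EuclideanSpace ℝ (Fin N) → ℝ | |g t - x i| ≤ u} :=
    fun _ => measurableSet_le (by fun_prop) measurable_const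
  have h2 := h.measure_forall hm
  simp only [mem_ofPred_eq] at h2
  rw [h2]
  have hw : (v t).toNNReal ≠ 0 := by simpa using hv
  have h3 : ∀ i ∈ Finset.univ, P {ω | |X i t ω - x i| ≤ u} ≤
      ENNReal.ofReal (u / Real.sqrt (v t)) := fun i _ => by
    have := gaussianReal_Icc_le hw (x i) u
    rw [Real.coe_toNNReal _ hv.le, ← h.map_value i,
      Measure.map_apply (h.measurable i t) measurableSet_Icc] at this
    refine le_trans (measure_mono fun ω hω => ?_) this
    have := abs_le.1 (show |X i t ω - x i| ≤ u from hω)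
    exact ⟨by linarith [this.1], by linarith [this.2]⟩
  refine (Finset.prod_le_prod' h3).trans ?_
  rw [Finset.prod_const, Finset.card_univ, Fintype.card_fin, ← ENNReal.ofReal_pow (by positivity)]

theorem exists_le_measure_value (h : IsRegularField X P v) {w₀ w₁ : ℝ} (hw₀ : 0 < w₀)
    (hw₁ : w₀ ≤ w₁) (x : EuclideanSpace ℝ (Fin p)) :
    ∃ c : ℝ, 0 < c ∧ ∀ t u, w₀ ≤ v t → v t ≤ w₁ → 0 < u → u ≤ 1 →
      ENNReal.ofReal (c * u ^ p) ≤ P {ω | ∀ i, |X i t ω - x i| ≤ u} := by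
  obtain ⟨c, hc, hb⟩ := le_gaussianReal_Icc (M := ‖x‖) hw₀ hw₁
  refine ⟨c ^ p, by positivity, fun t u h0 h1 hu0 hu1 => ?_⟩
  have hm : ∀ i : Fin p, MeasurableSet {g : EuclideanSpace ℝ (Fin N) → ℝ | |g t - x i| ≤ u} :=
    fun _ => measurableSet_le (by fun_prop) measurable_const
  have h2 := h.measure_forall hm
  simp only [mem_ofPred_eq] at h2
  rw [h2]
  have h3 : ∀ i ∈ Finset.univ, ENNReal.ofReal (c * u) ≤ P {ω | |X i t ω - x i| ≤ u} :=
    fun i _ => by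
    have hvt : 0 ≤ v t := hw₀.le.trans h0
    have := hb (v t).toNNReal (x i) u (by rwa [Real.coe_toNNReal _ hvt])
      (by rwa [Real.coe_toNNReal _ hvt]) (by
        have := PiLp.norm_apply_le x i
        rwa [Real.norm_eq_abs] at this) hu0 hu1
    rw [← h.map_value i, Measure.map_apply (h.measurable i t) measurableSet_Icc] at this
    refine this.trans (measure_mono fun ω hω => ?_)
    have hω' : X i t ω ∈ Icc (x i - u) (x i + u) := hω
    rw [mem_ofPred_eq, abs_le]
    exact ⟨by linarith [hω'.1], by linarith [hω'.2]⟩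
  refine le_trans (le_of_eq ?_) (Finset.prod_le_prod' h3)
  rw [Finset.prod_const, Finset.card_univ, Fintype.card_fin, ← ENNReal.ofReal_pow (by positivity),
    mul_pow]

/-- With D = v(t) - v(s) - v(t-s), the residual variance of X(t) given X(s) is v(t-s) - D²/(4v(s)),
which `hcross` makes at least v(t-s)/2. -/
theorem measure_two_values_le [IsProbabilityMeasure P] (h : IsRegularField X P v) {s t : EuclideanSpace ℝ (Fin N)}
    (hs : 0 < v s) (hst : 0 < v (t - s))
    (hcross : (v t - v s - v (t - s)) ^ 2 ≤ 2 * (v s * v (t - s)))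
    (x : EuclideanSpace ℝ (Fin p)) {u : ℝ} (hu : 0 ≤ u) :
    P {ω | ∀ i, |X i s ω - x i| ≤ u ∧ |X i t ω - x i| ≤ u} ≤
      ENNReal.ofReal ((u / Real.sqrt (v s) * (u / Real.sqrt (v (t - s) / 2))) ^ p) := by
  have hm : ∀ i : Fin p, MeasurableSet {g : EuclideanSpace ℝ (Fin N) → ℝ |
      |g s - x i| ≤ u ∧ |g t - x i| ≤ u} := fun i =>
    (measurableSet_le (f := fun g : EuclideanSpace ℝ (Fin N) → ℝ => |g s - x i|)
      (by fun_prop) measurable_const).inter (measurableSet_le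
      (f := fun g : EuclideanSpace ℝ (Fin N) → ℝ => |g t - x i|) (by fun_prop) measurable_const)
  have h2 := h.measure_forall hm
  simp only [mem_ofPred_eq] at h2
  rw [h2]
  have hcss : ∀ i, ∫ ω, X i s ω * X i s ω ∂P = v s := fun i => by
    rw [h.covariance, sub_self, h.variogram_zero]; ring
  have hctt : ∀ i, ∫ ω, X i t ω * X i t ω ∂P = v t := fun i => by
    rw [h.covariance, sub_self, h.variogram_zero]; ring
  have hcst : ∀ i, ∫ ω, X i s ω * X i t ω ∂P = (v s + v t - v (t - s)) / 2 := fun i => by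
    rw [h.covariance, ← h.variogram_neg (s - t), neg_sub]
  have hd : v (t - s) / 2 ≤ v t - ((v s + v t - v (t - s)) / 2) ^ 2 / v s := by
    rw [le_sub_iff_add_le, ← le_sub_iff_add_le', div_le_iff₀ hs]
    nlinarith
  have h3 : ∀ i ∈ Finset.univ, P {ω | |X i s ω - x i| ≤ u ∧ |X i t ω - x i| ≤ u} ≤
      ENNReal.ofReal (u / Real.sqrt (v s) * (u / Real.sqrt (v (t - s) / 2))) := fun i _ => by
    refine (measure_pair_le (h.gaussian i).hasGaussianLaw_prodMk (h.centered i s)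
      (h.centered i t) (hcss i) (hctt i) (hcst i) hs (lt_of_lt_of_le (by positivity) hd)
      (x i) (x i) u hu).trans ?_
    refine ENNReal.ofReal_le_ofReal ?_
    have : 0 < Real.sqrt (v (t - s) / 2) := Real.sqrt_pos.2 (by positivity)
    gcongr
  refine (Finset.prod_le_prod' h3).trans ?_
  rw [Finset.prod_const, Finset.card_univ, Fintype.card_fin, ← ENNReal.ofReal_pow (by positivity)]

theorem measure_increment_ge_le (h : IsRegularField X P v) (i : Fin p)
    {s t : EuclideanSpace ℝ (Fin N)} {w u : ℝ} (hw : v (s - t) ≤ w) (hw0 : 0 ≤ w) (hu : 0 ≤ u) :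
    P {ω | u ≤ |X i s ω - X i t ω|} ≤ ENNReal.ofReal (2 * Real.exp (-u ^ 2 / (2 * w))) := by
  have := gaussianReal_abs_ge_le (Real.toNNReal_le_toNNReal hw) hu
  have hms : Measurable fun ω => X i s ω - X i t ω := (h.measurable i s).sub (h.measurable i t)
  have hset : MeasurableSet {y : ℝ | u ≤ |y|} :=
    (isClosed_le continuous_const continuous_abs).measurableSet
  rw [← h.map_increment i, Real.coe_toNNReal _ hw0, Measure.map_apply hms hset] at this
  exact this

end IsRegularField

end AnisoField

namespace AnisoField

open Filter Topology Metric Set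
open scoped NNReal

variable {N p : ℕ}

/-! ### Anisotropic Hölder continuity of the sample functions -/

/-- The mesh of the `n`-th anisotropic grid in direction `j`. -/
noncomputable def mesh (b : Fin N → ℝ) (n : ℕ) (j : Fin N) : ℝ := (1 / 2) ^ ((n : ℝ) / b j)

/-- The points of the `n`-th anisotropic grid. -/
noncomputable def gridPoint (b : Fin N → ℝ) (n : ℕ) (z : Fin N → ℤ) : EuclideanSpace ℝ (Fin N) :=
  WithLp.toLp 2 fun j => z j * mesh b n j

/-- The index of the grid point below `t`. -/
noncomputable def gridIndex (b : Fin N → ℝ) (n : ℕ) (t : EuclideanSpace ℝ (Fin N)) (j : Fin N) :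
    ℤ := ⌊t j / mesh b n j⌋

theorem mesh_pos (b : Fin N → ℝ) (n : ℕ) (j : Fin N) : 0 < mesh b n j :=
  Real.rpow_pos_of_pos (by norm_num) _

theorem mesh_rpow {b : Fin N → ℝ} (hb : ∀ j, 0 < b j) (n : ℕ) (j : Fin N) :
    mesh b n j ^ b j = (1 / 2) ^ n := by
  rw [mesh, ← Real.rpow_mul (by norm_num), div_mul_cancel₀ _ (hb j).ne', Real.rpow_natCast]

theorem mesh_antitone {b : Fin N → ℝ} (hb : ∀ j, 0 < b j) {m n : ℕ} (h : m ≤ n) (j : Fin N) :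
    mesh b n j ≤ mesh b m j := by
  refine Real.rpow_le_rpow_of_exponent_ge (by norm_num) (by norm_num) ?_
  have := hb j
  gcongr

theorem tendsto_mesh {b : Fin N → ℝ} (hb : ∀ j, 0 < b j) (j : Fin N) :
    Tendsto (fun n => mesh b n j) atTop (𝓝 0) := by
  have h : ∀ n, mesh b n j = ((1 / 2 : ℝ) ^ (1 / b j)) ^ n := fun n => by
    rw [mesh, ← Real.rpow_natCast, ← Real.rpow_mul (by norm_num)]; congr 1; ring
  simp_rw [h]
  exact tendsto_pow_atTop_nhds_zero_of_lt_one (by positivity)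
    (Real.rpow_lt_one (by norm_num) (by norm_num) (by have := hb j; positivity))

theorem abs_sub_gridPoint_le (b : Fin N → ℝ) (n : ℕ) (t : EuclideanSpace ℝ (Fin N)) (j : Fin N) :
    |t j - gridPoint b n (gridIndex b n t) j| ≤ mesh b n j := by
  have hm := mesh_pos b n j
  have h1 := Int.floor_le (t j / mesh b n j)
  have h2 := (Int.lt_floor_add_one (t j / mesh b n j)).le
  rw [le_div_iff₀ hm] at h1
  rw [div_le_iff₀ hm] at h2
  simp only [gridPoint, gridIndex]
  rw [abs_le]
  constructor <;> linarith

theorem tendsto_gridPoint {b : Fin N → ℝ} (hb : ∀ j, 0 < b j) (t : EuclideanSpace ℝ (Fin N)) :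
    Tendsto (fun n => gridPoint b n (gridIndex b n t)) atTop (𝓝 t) := by
  have h : Tendsto (fun n => (gridPoint b n (gridIndex b n t)).ofLp) atTop (𝓝 t.ofLp) := by
    rw [tendsto_pi_nhds]
    intro j
    rw [tendsto_iff_dist_tendsto_zero]
    refine squeeze_zero (fun _ => dist_nonneg) (fun n => ?_) (tendsto_mesh hb j)
    rw [dist_comm, Real.dist_eq]
    exact abs_sub_gridPoint_le b n t j
  exact ((PiLp.continuous_toLp 2 _).tendsto _).comp h

theorem isCompact_cube (N : ℕ) (M : ℝ) : IsCompact (cube N M) := by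
  have h : IsCompact (Set.pi univ fun _ : Fin N => Icc (-M) M) :=
    isCompact_univ_pi fun _ => isCompact_Icc
  have := h.image (PiLp.continuous_toLp 2 fun _ : Fin N => ℝ)
  convert this using 1
  ext t
  simp only [cube, mem_ofPred_eq, abs_le, mem_image, Set.mem_pi, mem_univ, forall_const, mem_Icc]
  constructor
  · exact fun h => ⟨t.ofLp, h, rfl⟩
  · rintro ⟨x, hx, rfl⟩
    exact hx

/-- Chaining along the anisotropic grids. -/
theorem exists_holder_of_grid {g : EuclideanSpace ℝ (Fin N) → ℝ} (hg : Continuous g)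
    {b : Fin N → ℝ} (hb : ∀ j, 0 < b j) {θ : ℝ} (hθ : 0 < θ) {M : ℝ} {n₀ : ℕ}
    (H : ∀ n, n₀ ≤ n → ∀ s ∈ cube N M, ∀ t ∈ cube N M, ∀ m, (m = n ∨ m = n + 1) →
      (∀ j, |gridPoint b n (gridIndex b n s) j - gridPoint b m (gridIndex b m t) j| ≤
        3 * mesh b n j) →
      |g (gridPoint b n (gridIndex b n s)) - g (gridPoint b m (gridIndex b m t))| ≤
        ((1 / 2) ^ θ) ^ n) :
    ∃ K : ℝ, 0 < K ∧ ∀ s ∈ cube N M, ∀ t ∈ cube N M,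
      |g s - g t| ≤ K * ∑ j, |s j - t j| ^ (θ * b j) := by
  set r : ℝ := (1 / 2) ^ θ with hr
  have hr0 : 0 < r := by positivity
  have hr1 : r < 1 := Real.rpow_lt_one (by norm_num) (by norm_num) hθ
  have h1r : 0 < 1 - r := by linarith
  -- Telescoping along the grid points below `t`: consecutive ones are within 2 meshes, so `H` with
  -- m = n + 1 applies and the differences sum geometrically.
  have happ : ∀ n, n₀ ≤ n → ∀ t ∈ cube N M,
      |g (gridPoint b n (gridIndex b n t)) - g t| ≤ r ^ n / (1 - r) := by
    intro n hn t ht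
    have htend : Tendsto (fun k => g (gridPoint b (n + k) (gridIndex b (n + k) t))) atTop
        (𝓝 (g t)) :=
      (hg.tendsto t).comp ((tendsto_gridPoint hb t).comp
        (tendsto_atTop_mono (fun k => Nat.le_add_left k n) tendsto_id))
    have := dist_le_of_le_geometric_of_tendsto₀ r (r ^ n) hr1 (fun k => ?_) htend
    · simpa [Real.dist_eq] using this
    · rw [Real.dist_eq, ← pow_add]
      refine H (n + k) (by omega) t ht t ht (n + k + 1) (Or.inr rfl) fun j => ?_
      have e1 := abs_sub_gridPoint_le b (n + k) t j
      have e2 := (abs_sub_gridPoint_le b (n + k + 1) t j).trans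
        (mesh_antitone hb (Nat.le_succ (n + k)) j)
      have e3 := mesh_pos b (n + k) j
      rw [abs_le] at *
      constructor <;> linarith [e1.1, e1.2, e2.1, e2.2]
  obtain ⟨B, hB⟩ := (isCompact_cube N M).exists_bound_of_continuousOn hg.continuousOn
  set K₁ : ℝ := 2 / (1 - r) + 1 with hK₁
  have hK₁0 : 0 < K₁ := by positivity
  have hclose : ∀ n, n₀ ≤ n → ∀ s ∈ cube N M, ∀ t ∈ cube N M,
      (∀ j, |s j - t j| ≤ mesh b n j) → |g s - g t| ≤ K₁ * r ^ n := by
    intro n hn s hs t ht hst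
    have e1 := abs_le.1 (happ n hn s hs)
    have e2 := abs_le.1 (happ n hn t ht)
    -- Two rounding errors and |s_j - t_j| add up to 3 meshes, hence the constant in `H`.
    have e3 := abs_le.1 (H n hn s hs t ht n (Or.inl rfl) fun j => by
      have e1 := abs_le.1 (abs_sub_gridPoint_le b n s j)
      have e2 := abs_le.1 (abs_sub_gridPoint_le b n t j)
      have e3 := abs_le.1 (hst j)
      rw [abs_le]
      constructor <;> linarith [e1.1, e1.2, e2.1, e2.2, e3.1, e3.2])
    have e4 : K₁ * r ^ n = r ^ n / (1 - r) + r ^ n / (1 - r) + r ^ n := by rw [hK₁]; ring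
    rw [e4, abs_le]
    constructor <;> linarith [e1.1, e1.2, e2.1, e2.2, e3.1, e3.2]
  -- The first term serves close pairs, with r⁻¹ for passing from scale n to n + 1; the second
  -- serves distant pairs through the sup bound; the 1 ensures positivity.
  set K : ℝ := K₁ * r⁻¹ + 2 * |B| * (r ^ n₀)⁻¹ + 1 with hK
  have hK0 : 0 < K := by positivity
  refine ⟨K, hK0, fun s hs t ht => ?_⟩
  have hsum0 : ∀ j ∈ Finset.univ, 0 ≤ |s j - t j| ^ (θ * b j) := fun j _ => by positivity
  rcases Nat.eq_zero_or_pos N with rfl | hN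
  · have : s = t := Subsingleton.elim _ _
    rw [this]; simp
  have : NeZero N := ⟨hN.ne'⟩
  obtain ⟨j₀, -, hj₀⟩ := Finset.exists_max_image Finset.univ (fun j => |s j - t j| ^ b j)
    Finset.univ_nonempty
  set y := |s j₀ - t j₀| ^ b j₀ with hy
  have hy0 : 0 ≤ y := by positivity
  have hysum : y ^ θ ≤ ∑ j, |s j - t j| ^ (θ * b j) := by
    have : y ^ θ = |s j₀ - t j₀| ^ (θ * b j₀) := by
      rw [hy, ← Real.rpow_mul (abs_nonneg _), mul_comm]
    rw [this]
    exact Finset.single_le_sum (f := fun j => |s j - t j| ^ (θ * b j)) hsum0 (Finset.mem_univ j₀)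
  refine le_trans ?_ (mul_le_mul_of_nonneg_left hysum hK0.le)
  have hr_pow : ∀ n : ℕ, r ^ n = ((1 / 2 : ℝ) ^ n) ^ θ := fun n => by
    rw [hr, ← Real.rpow_natCast, ← Real.rpow_natCast, ← Real.rpow_mul (by norm_num),
      ← Real.rpow_mul (by norm_num), mul_comm]
  rcases hy0.eq_or_lt with h0 | h0
  · have : s = t := by
      ext j
      have h1 := hj₀ j (Finset.mem_univ j)
      rw [← h0] at h1
      have h2 : |s j - t j| ^ b j = 0 := le_antisymm h1 (by positivity)
      rw [Real.rpow_eq_zero (abs_nonneg _) (hb j).ne', abs_eq_zero, sub_eq_zero] at h2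
      exact h2
    rw [this, sub_self, abs_zero]
    positivity
  rcases lt_or_ge ((1 / 2 : ℝ) ^ n₀) y with hbig | hsmall
  · have h1 : |g s - g t| ≤ 2 * |B| := by
      have e1 := abs_le.1 ((hB s hs).trans (le_abs_self B))
      have e2 := abs_le.1 ((hB t ht).trans (le_abs_self B))
      rw [abs_le]; constructor <;> linarith [e1.1, e1.2, e2.1, e2.2]
    have h2 : r ^ n₀ ≤ y ^ θ := by
      rw [hr_pow]
      exact Real.rpow_le_rpow (by positivity) hbig.le hθ.le
    calc |g s - g t| ≤ 2 * |B| * (r ^ n₀)⁻¹ * r ^ n₀ := by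
          rw [mul_assoc, inv_mul_cancel₀ (by positivity), mul_one]; exact h1
      _ ≤ K * y ^ θ := by
          refine mul_le_mul ?_ h2 (by positivity) hK0.le
          have : 0 < K₁ * r⁻¹ := by positivity
          linarith
  · obtain ⟨n, hn1, hn2⟩ := exists_nat_pow_near_of_lt_one h0
      (hsmall.trans (pow_le_one₀ (by norm_num) (by norm_num)))
      (by norm_num : (0 : ℝ) < 1 / 2) (by norm_num)
    have hn : n₀ ≤ n := by
      by_contra! hlt
      have : (1 / 2 : ℝ) ^ n₀ ≤ (1 / 2) ^ (n + 1) :=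
        pow_le_pow_of_le_one (by norm_num) (by norm_num) hlt
      linarith
    have hst : ∀ j, |s j - t j| ≤ mesh b n j := fun j => by
      have h1 := (hj₀ j (Finset.mem_univ j)).trans hn2
      rw [← mesh_rpow hb n j] at h1
      exact (Real.rpow_le_rpow_iff (abs_nonneg _) (mesh_pos b n j).le (hb j)).1 h1
    have h2 : r ^ (n + 1) ≤ y ^ θ := by
      rw [hr_pow]
      exact Real.rpow_le_rpow (by positivity) hn1.le hθ.le
    calc |g s - g t| ≤ K₁ * r ^ n := hclose n hn s hs t ht hst
      _ = K₁ * r⁻¹ * r ^ (n + 1) := by rw [pow_succ]; field_simp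
      _ ≤ K * y ^ θ := by
          refine mul_le_mul ?_ h2 (by positivity) hK0.le
          have : 0 ≤ 2 * |B| * (r ^ n₀)⁻¹ := by positivity
          linarith

/-- The exponential series gives exp(-x) ≤ k!/x^k. With 2D < ρ^k this leaves a geometric series of
ratio 1/2. -/
theorem summable_pow_mul_exp_neg {A D κ ρ : ℝ} (hD : 0 < D) (hκ : 0 < κ) (hρ : 1 < ρ) :
    Summable fun n : ℕ => A * D ^ n * Real.exp (-(κ * ρ ^ n)) := by
  obtain ⟨k, hk⟩ := pow_unbounded_of_one_lt (2 * D) hρ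
  have hρ0 : 0 < ρ := by linarith
  have hgeo : Summable fun n : ℕ => |A| * (k.factorial / κ ^ k) * (1 / 2 : ℝ) ^ n :=
    (summable_geometric_of_lt_one (by norm_num) (by norm_num)).mul_left _
  refine Summable.of_norm_bounded hgeo fun n => ?_
  have hx : 0 < κ * ρ ^ n := by positivity
  have h1 := Real.pow_div_factorial_le_exp (κ * ρ ^ n) hx.le k
  have h2 : Real.exp (-(κ * ρ ^ n)) ≤ k.factorial / (κ * ρ ^ n) ^ k := by
    rw [Real.exp_neg, inv_le_comm₀ (Real.exp_pos _) (by positivity), inv_div]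
    exact h1
  have h3 : D ^ n / (ρ ^ n) ^ k ≤ (1 / 2) ^ n := by
    rw [← pow_mul, mul_comm n k, pow_mul, ← div_pow]
    refine pow_le_pow_left₀ (by positivity) ?_ n
    rw [div_le_iff₀ (by positivity)]
    linarith
  rw [Real.norm_eq_abs, abs_mul, abs_mul, abs_of_pos (Real.exp_pos _),
    abs_of_pos (pow_pos hD n)]
  calc |A| * D ^ n * Real.exp (-(κ * ρ ^ n))
      ≤ |A| * D ^ n * (k.factorial / (κ * ρ ^ n) ^ k) := by gcongr
    _ = |A| * (k.factorial / κ ^ k) * (D ^ n / (ρ ^ n) ^ k) := by rw [mul_pow]; field_simp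
    _ ≤ _ := by gcongr

/-- The finite set of grid indices used for the cube of side `M`. -/
noncomputable def gridSet (N : ℕ) (L B n : ℕ) : Finset (Fin N → ℤ) :=
  Fintype.piFinset fun _ => Finset.Icc (-((L * 2 ^ (B * n) : ℕ) : ℤ)) ((L * 2 ^ (B * n) : ℕ) : ℤ)

theorem card_gridSet_le (N : ℕ) {L : ℕ} (hL : 0 < L) (B n : ℕ) :
    (gridSet N L B n).card ≤ (3 * L * 2 ^ (B * n)) ^ N := by
  have h1 : 0 < L * 2 ^ (B * n) := by positivity
  rw [gridSet, Fintype.card_piFinset, Finset.prod_const, Finset.card_univ, Fintype.card_fin]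
  refine Nat.pow_le_pow_left ?_ N
  rw [Int.card_Icc, mul_assoc]
  omega

theorem gridIndex_mem_gridSet {b : Fin N → ℝ} {B L : ℕ} (hB : ∀ j, 1 / b j ≤ B) {M : ℝ}
    (hM : 0 ≤ M) (hL : M + 1 ≤ L) (n : ℕ) {t : EuclideanSpace ℝ (Fin N)} (ht : t ∈ cube N M) :
    gridIndex b n t ∈ gridSet N L B n := by
  rw [gridSet, Fintype.mem_piFinset]
  intro j
  have hm := mesh_pos b n j
  have hinv : (mesh b n j)⁻¹ ≤ (2 : ℝ) ^ (B * n) := by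
    rw [mesh, ← Real.inv_rpow (by norm_num), ← Real.rpow_natCast]
    norm_num
    have := mul_le_mul_of_nonneg_right (hB j) (Nat.cast_nonneg (α := ℝ) n)
    calc (n : ℝ) / b j = 1 / b j * n := by ring
      _ ≤ _ := this
  have h2 : (1 : ℝ) ≤ 2 ^ (B * n) := one_le_pow₀ (by norm_num)
  have hq : |t j / mesh b n j| ≤ M * 2 ^ (B * n) := by
    rw [abs_div, abs_of_pos hm, div_eq_mul_inv]
    exact mul_le_mul (ht j) hinv (by positivity) hM
  have hq' := abs_le.1 hq
  have h3 : (M + 1) * 2 ^ (B * n) ≤ L * 2 ^ (B * n) := by gcongr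
  rw [Finset.mem_Icc]
  constructor
  · rw [gridIndex, Int.le_floor]
    push_cast
    nlinarith [hq'.1]
  · rw [gridIndex]
    refine Int.floor_le_iff.2 ?_
    push_cast
    nlinarith [hq'.2]

end AnisoField

/-! ### Borel–Cantelli for the increments along the grids -/

namespace AnisoField

open Filter Topology Metric Set
open scoped NNReal

variable {N p : ℕ}

namespace IsRegularField

variable {Ω : Type*} [MeasurableSpace Ω] {P : Measure Ω}
  {X : Fin p → EuclideanSpace ℝ (Fin N) → Ω → ℝ} {v : EuclideanSpace ℝ (Fin N) → ℝ}

/-- The event that some increment of the `i`-th component along the grids is large. -/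
def badEvent (X : Fin p → EuclideanSpace ℝ (Fin N) → Ω → ℝ) (b : Fin N → ℝ) (L B : ℕ) (θ : ℝ)
    (i : Fin p) (n : ℕ) : Set Ω :=
  ⋃ m ∈ ({n, n + 1} : Finset ℕ), ⋃ z ∈ gridSet N L B n, ⋃ z' ∈ gridSet N L B m,
    {ω | (∀ j, |gridPoint b n z j - gridPoint b m z' j| ≤ 3 * mesh b n j) ∧
      ((1 / 2) ^ θ) ^ n ≤ |X i (gridPoint b n z) ω - X i (gridPoint b m z') ω|}

/-- Close grid points have increments of standard deviation of order 2^(-n), to be compared with the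
threshold 2^(-θn). For θ < 1 the tail is doubly exponentially small, with rate 4^((1-θ)n), and beats
the exponential number of pairs. -/
theorem measure_badEvent_le (h : IsRegularField X P v) {b : Fin N → ℝ} (hb : ∀ j, 0 < b j)
    {θ : ℝ} {L B : ℕ} (hL : 0 < L) {C : ℝ} (hC : 0 < C)
    (hv : ∀ t : EuclideanSpace ℝ (Fin N), (∀ j, |t j| ≤ 3) → v t ≤ C * ∑ j, |t j| ^ (2 * b j)) :
    ∃ A D κ : ℝ, 0 < D ∧ 0 < κ ∧ ∀ i n, P (badEvent X b L B θ i n) ≤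
      ENNReal.ofReal (A * D ^ n * Real.exp (-(κ * (((1 / 2 : ℝ) ^ (2 * (θ - 1)))) ^ n))) := by
  set C' : ℝ := C * ∑ j, (3 : ℝ) ^ (2 * b j) + 1 with hC'
  have hC'0 : 0 < C' := by
    have : 0 ≤ ∑ j, (3 : ℝ) ^ (2 * b j) := Finset.sum_nonneg fun j _ => by positivity
    positivity
  have hone : ∀ n (m : ℕ) (z z' : Fin N → ℤ) i,
      P {ω | (∀ j, |gridPoint b n z j - gridPoint b m z' j| ≤ 3 * mesh b n j) ∧
      ((1 / 2) ^ θ) ^ n ≤ |X i (gridPoint b n z) ω - X i (gridPoint b m z') ω|} ≤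
      ENNReal.ofReal (2 * Real.exp (-((2 * C')⁻¹ * ((1 / 2 : ℝ) ^ (2 * (θ - 1))) ^ n))) := by
    intro n m z z' i
    by_cases hclose : ∀ j, |gridPoint b n z j - gridPoint b m z' j| ≤ 3 * mesh b n j
    · have hm1 : ∀ j, mesh b n j ≤ 1 := fun j =>
        (mesh_antitone hb (Nat.zero_le n) j).trans (by simp [mesh])
      have hvar : v (gridPoint b n z - gridPoint b m z') ≤ C' * ((1 / 2) ^ n) ^ 2 := by
        refine (hv _ fun j => (hclose j).trans (by linarith [hm1 j])).trans ?_
        have : ∀ j ∈ Finset.univ, |(gridPoint b n z - gridPoint b m z') j| ^ (2 * b j) ≤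
            3 ^ (2 * b j) * ((1 / 2) ^ n) ^ 2 := fun j _ => by
          have hbj := hb j
          calc |(gridPoint b n z - gridPoint b m z') j| ^ (2 * b j)
              ≤ (3 * mesh b n j) ^ (2 * b j) :=
                Real.rpow_le_rpow (abs_nonneg _) (hclose j) (by positivity)
            _ = _ := by
                rw [Real.mul_rpow (by norm_num) (mesh_pos b n j).le, mul_comm 2 (b j),
                  Real.rpow_mul (mesh_pos b n j).le, mesh_rpow hb]
                norm_num
        have h1 := Finset.sum_le_sum this
        rw [← Finset.sum_mul] at h1
        have h2 := mul_le_mul_of_nonneg_left h1 hC.le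
        have h3 : (0 : ℝ) ≤ ((1 / 2) ^ n) ^ 2 := by positivity
        rw [hC', add_mul, mul_assoc]
        linarith
      refine (measure_mono fun ω hω => hω.2).trans ((h.measure_increment_ge_le i hvar
        (by positivity) (pow_nonneg (Real.rpow_nonneg (by norm_num) _) _)).trans
        (ENNReal.ofReal_le_ofReal (le_of_eq ?_)))
      congr 2
      have e : ((1 / 2 : ℝ) ^ (2 * (θ - 1))) ^ n = (((1 / 2) ^ θ) ^ n) ^ 2 / ((1 / 2) ^ n) ^ 2 := by
        simp only [← Real.rpow_natCast]
        have h2 : (0 : ℝ) ≤ 1 / 2 := by norm_num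
        rw [← Real.rpow_mul h2, ← Real.rpow_mul h2, ← Real.rpow_mul h2, ← Real.rpow_mul h2,
          ← Real.rpow_sub (by norm_num)]
        congr 1; push_cast; ring
      rw [e]
      field_simp
    · simp [hclose]
  -- One factor 2 is for the two values of m, the other for the two-sided tail; D = 2^(2BN) is the
  -- growth rate of the number of index pairs.
  refine ⟨2 * (2 * ((3 * L : ℕ) ^ N * (3 * L * 2 ^ B : ℕ) ^ N : ℝ)), (2 ^ (2 * B * N) : ℝ),
    (2 * C')⁻¹, by positivity, by positivity, fun i n => ?_⟩
  obtain ⟨ε, hε⟩ : ∃ ε, ε = ENNReal.ofReal (2 * Real.exp (-((2 * C')⁻¹ *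
    ((1 / 2 : ℝ) ^ (2 * (θ - 1))) ^ n))) := ⟨_, rfl⟩
  have hcard : ∀ m ∈ ({n, n + 1} : Finset ℕ), (gridSet N L B m).card ≤
      (3 * L * 2 ^ B * 2 ^ (B * n)) ^ N := fun m hm => by
    refine (card_gridSet_le N hL B m).trans (Nat.pow_le_pow_left ?_ N)
    have hmn : m ≤ n + 1 := by
      simp only [Finset.mem_insert, Finset.mem_singleton] at hm; omega
    rw [mul_assoc (3 * L), ← pow_add]
    refine Nat.mul_le_mul_left _ (Nat.pow_le_pow_right (by norm_num) ?_)
    nlinarith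
  calc P (badEvent X b L B θ i n)
      ≤ ∑ m ∈ ({n, n + 1} : Finset ℕ), ∑ z ∈ gridSet N L B n, ∑ z' ∈ gridSet N L B m, ε := by
        refine (measure_biUnion_finset_le _ _).trans (Finset.sum_le_sum fun m _ => ?_)
        refine (measure_biUnion_finset_le _ _).trans (Finset.sum_le_sum fun z _ => ?_)
        refine (measure_biUnion_finset_le _ _).trans (Finset.sum_le_sum fun z' _ => ?_)
        rw [hε]
        exact hone n m z z' i
    _ ≤ ∑ m ∈ ({n, n + 1} : Finset ℕ),
          ((((3 * L * 2 ^ (B * n)) ^ N * (3 * L * 2 ^ B * 2 ^ (B * n)) ^ N : ℕ)) : ℝ≥0∞) * ε := by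
        refine Finset.sum_le_sum fun m hm => ?_
        rw [Finset.sum_const, Finset.sum_const, nsmul_eq_mul, nsmul_eq_mul, ← mul_assoc,
          ← Nat.cast_mul]
        gcongr
        · exact card_gridSet_le N hL B n
        · exact hcard m hm
    _ = ENNReal.ofReal _ := by
        rw [Finset.sum_const, Finset.card_pair (by omega), nsmul_eq_mul, hε,
          ← ENNReal.ofReal_natCast, ← ENNReal.ofReal_natCast, ← ENNReal.ofReal_mul (by positivity),
          ← ENNReal.ofReal_mul (by positivity)]
        congr 1
        push_cast
        rw [mul_pow, mul_pow _ ((2 : ℝ) ^ (B * n))]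
        ring

/-- Almost sure anisotropic Hölder continuity. -/
theorem ae_holder (h : IsRegularField X P v) {b : Fin N → ℝ} (hb : ∀ j, 0 < b j) {θ : ℝ}
    (hθ0 : 0 < θ) (hθ1 : θ < 1) {C : ℝ} (hC : 0 < C)
    (hv : ∀ t : EuclideanSpace ℝ (Fin N), (∀ j, |t j| ≤ 3) → v t ≤ C * ∑ j, |t j| ^ (2 * b j))
    {M : ℝ} (hM : 0 ≤ M) :
    ∀ᵐ ω ∂P, ∃ K : ℝ, 0 < K ∧ ∀ i, ∀ s ∈ cube N M, ∀ t ∈ cube N M,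
      |X i s ω - X i t ω| ≤ K * ∑ j, |s j - t j| ^ (θ * b j) := by
  obtain ⟨L, hL⟩ := exists_nat_ge (M + 1)
  have hL0 : 0 < L := by
    have : (0 : ℝ) < L := by linarith
    exact_mod_cast this
  obtain ⟨B, hB⟩ : ∃ B : ℕ, ∀ j, 1 / b j ≤ B := by
    obtain ⟨B, hB⟩ := exists_nat_ge (∑ j, 1 / b j)
    exact ⟨B, fun j => le_trans (Finset.single_le_sum (f := fun j => 1 / b j)
      (fun j _ => by have := hb j; positivity) (Finset.mem_univ j)) hB⟩
  obtain ⟨A, D, κ, hD, hκ, hbad⟩ := h.measure_badEvent_le (B := B) (θ := θ) hb hL0 hC hv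
  have hρ : 1 < (1 / 2 : ℝ) ^ (2 * (θ - 1)) :=
    Real.one_lt_rpow_of_pos_of_lt_one_of_neg (by norm_num) (by norm_num) (by linarith)
  have hsum := summable_pow_mul_exp_neg (A := A) hD hκ hρ
  have hae : ∀ᵐ ω ∂P, ∀ i, ∀ᶠ n in atTop, ω ∉ badEvent X b L B θ i n := by
    rw [ae_all_iff]
    intro i
    refine ae_eventually_notMem (ne_top_of_le_ne_top ?_ (ENNReal.tsum_le_tsum (hbad i)))
    exact hsum.tsum_ofReal_ne_top
  filter_upwards [hae] with ω hω
  have hi : ∀ i, ∃ K : ℝ, 0 < K ∧ ∀ s ∈ cube N M, ∀ t ∈ cube N M,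
      |X i s ω - X i t ω| ≤ K * ∑ j, |s j - t j| ^ (θ * b j) := by
    intro i
    obtain ⟨n₀, hn₀⟩ := eventually_atTop.1 (hω i)
    refine exists_holder_of_grid (n₀ := n₀) (h.continuous i ω) hb hθ0
      fun n hn s hs t ht m hm hst => ?_
    by_contra! hcon
    refine hn₀ n hn ?_
    simp only [badEvent, mem_iUnion, exists_prop]
    exact ⟨m, by simpa using hm, _, gridIndex_mem_gridSet hB hM hL n hs, _,
      gridIndex_mem_gridSet hB hM hL m ht, hst, hcon.le⟩
  choose K hK0 hK using hi
  refine ⟨∑ i, K i + 1, by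
    have := Finset.sum_nonneg fun i (_ : i ∈ Finset.univ) => (hK0 i).le
    positivity, fun i s hs t ht => (hK i s hs t ht).trans ?_⟩
  have h1 : K i ≤ ∑ i, K i := Finset.single_le_sum (fun i _ => (hK0 i).le) (Finset.mem_univ i)
  have h2 : 0 ≤ ∑ j, |s j - t j| ^ (θ * b j) := Finset.sum_nonneg fun j _ => by positivity
  gcongr
  linarith

end IsRegularField

end AnisoField

namespace AnisoField

open Filter Topology Metric Set
open scoped NNReal

variable {N p : ℕ}

/-! ### Upper bounds for Hausdorff dimensions -/

theorem dimH_le_of_dyadic_cover {E ι : Type*} [MetricSpace E] {s : Set E} {d D C : ℝ} (hd : 0 ≤ d)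
    (hD : 0 ≤ D) (T : ℕ → Finset ι) (t : ℕ → ι → Set E)
    (hdiam : ∀ n, ∀ i ∈ T n, ∀ x ∈ t n i, ∀ y ∈ t n i, dist x y ≤ D * (1 / 2) ^ n)
    (hcover : ∀ᶠ n in atTop, s ⊆ ⋃ i ∈ T n, t n i)
    (hcard : ∃ᶠ n in atTop, ((T n).card : ℝ) * ((1 / 2) ^ n) ^ d ≤ C) :
    dimH s ≤ ENNReal.ofReal d := by
  refine dimH_le_of_cover (d := d.toNNReal) (C := ENNReal.ofReal (C * D ^ d))
    (r := fun n => ENNReal.ofReal (D * (1 / 2) ^ n)) ENNReal.ofReal_ne_top ?_ T t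
    (Eventually.of_forall fun n i hi => ?_) hcover (hcard.mono fun n hn => ?_)
  · have h : Tendsto (fun n : ℕ => D * (1 / 2 : ℝ) ^ n) atTop (𝓝 (D * 0)) :=
      (tendsto_pow_atTop_nhds_zero_of_lt_one (by norm_num) (by norm_num)).const_mul D
    simpa using ENNReal.tendsto_ofReal h
  · refine ediam_le fun x hx y hy => ?_
    rw [edist_dist]
    exact ENNReal.ofReal_le_ofReal (hdiam n i hi x hx y hy)
  · rw [Real.coe_toNNReal _ hd, ENNReal.ofReal_rpow_of_nonneg (by positivity) hd,
      ← ENNReal.ofReal_natCast, ← ENNReal.ofReal_mul (by positivity)]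
    refine ENNReal.ofReal_le_ofReal ?_
    rw [Real.mul_rpow hD (by positivity)]
    have := mul_le_mul_of_nonneg_right hn (Real.rpow_nonneg hD d)
    linarith

/-- The indices of the anisotropic grid cells meeting the cube. -/
noncomputable def cellSet (c : Fin N → ℝ) (M : ℝ) (n : ℕ) : Finset (Fin N → ℤ) :=
  Fintype.piFinset fun j => Finset.Icc ⌊-M / mesh c n j⌋ ⌊M / mesh c n j⌋

theorem gridIndex_mem_cellSet {c : Fin N → ℝ} {M : ℝ} {t : EuclideanSpace ℝ (Fin N)}
    (ht : t ∈ cube N M) (n : ℕ) : gridIndex c n t ∈ cellSet c M n := by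
  rw [cellSet, Fintype.mem_piFinset]
  intro j
  have hm := mesh_pos c n j
  have h := abs_le.1 (ht j)
  rw [Finset.mem_Icc, gridIndex]
  exact ⟨Int.floor_le_floor (by gcongr; exact h.1), Int.floor_le_floor (by gcongr; exact h.2)⟩

theorem card_Icc_floor_le {a b : ℝ} (hab : a ≤ b) :
    ((Finset.Icc ⌊a⌋ ⌊b⌋).card : ℝ) ≤ b - a + 2 := by
  rw [Int.card_Icc]
  have h1 := Int.floor_le b
  have h2 := Int.lt_floor_add_one a
  have h3 : ⌊a⌋ ≤ ⌊b⌋ := Int.floor_le_floor hab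
  have h4 : (((⌊b⌋ + 1 - ⌊a⌋).toNat : ℤ) : ℝ) = ((⌊b⌋ + 1 - ⌊a⌋ : ℤ) : ℝ) := by
    rw [Int.toNat_of_nonneg (by omega)]
  have h5 : (((⌊b⌋ + 1 - ⌊a⌋).toNat : ℕ) : ℝ) = ((⌊b⌋ + 1 - ⌊a⌋ : ℤ) : ℝ) := by
    exact (Int.cast_natCast _).symm.trans h4
  rw [h5]; push_cast; linarith

theorem mesh_inv (c : Fin N → ℝ) (n : ℕ) (j : Fin N) :
    (mesh c n j)⁻¹ = ((1 / 2 : ℝ) ^ n) ^ (-(1 / c j)) := by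
  rw [mesh, ← Real.rpow_neg (by norm_num), ← Real.rpow_natCast, ← Real.rpow_mul (by norm_num)]
  congr 1; ring

theorem card_cellSet_mul_le {c : Fin N → ℝ} (hc : ∀ j, 0 < c j) {M : ℝ} (hM : 0 ≤ M) (n : ℕ) :
    ((cellSet c M n).card : ℝ) * ((1 / 2) ^ n) ^ (∑ j, 1 / c j) ≤ (2 * M + 2) ^ N := by
  have h1 : ((cellSet c M n).card : ℝ) ≤ (2 * M + 2) ^ N * ((1 / 2) ^ n) ^ (-∑ j, 1 / c j) := by
    rw [cellSet, Fintype.card_piFinset, Nat.cast_prod, ← Finset.sum_neg_distrib,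
      Real.rpow_sum_of_pos (by positivity)]
    calc ∏ j, ((Finset.Icc ⌊-M / mesh c n j⌋ ⌊M / mesh c n j⌋).card : ℝ)
        ≤ ∏ j, ((2 * M + 2) * ((1 / 2 : ℝ) ^ n) ^ (-(1 / c j))) := by
          refine Finset.prod_le_prod (fun _ _ => by positivity) fun j _ => ?_
          have hm := mesh_pos c n j
          have hm1 : mesh c n j ≤ 1 := (mesh_antitone hc (Nat.zero_le n) j).trans (by simp [mesh])
          refine (card_Icc_floor_le (by gcongr; linarith)).trans ?_
          rw [← mesh_inv, ← div_eq_mul_inv, le_div_iff₀ hm]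
          have e : (M / mesh c n j - -M / mesh c n j + 2) * mesh c n j =
            2 * M + 2 * mesh c n j := by field_simp; ring
          rw [e]; linarith
      _ = _ := by
          rw [Finset.prod_mul_distrib, Finset.prod_const, Finset.card_univ, Fintype.card_fin]
  calc _ ≤ (2 * M + 2) ^ N * ((1 / 2) ^ n) ^ (-∑ j, 1 / c j) * ((1 / 2) ^ n) ^ (∑ j, 1 / c j) := by
        gcongr
    _ = _ := by
        rw [mul_assoc, ← Real.rpow_add (by positivity)]; simp

theorem abs_sub_le_of_gridIndex_eq {c : Fin N → ℝ} {n : ℕ} {s t : EuclideanSpace ℝ (Fin N)}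
    (h : gridIndex c n s = gridIndex c n t) (j : Fin N) : |s j - t j| ≤ mesh c n j := by
  have hm := mesh_pos c n j
  have h1 := (Int.abs_sub_lt_one_of_floor_eq_floor (congrFun h j)).le
  rw [← sub_div, abs_div, abs_of_pos hm, div_le_one hm] at h1
  exact h1

theorem norm_le_sum_abs {ι : Type*} [Fintype ι] (x : EuclideanSpace ℝ ι) : ‖x‖ ≤ ∑ i, |x i| := by
  rw [EuclideanSpace.norm_eq]
  refine Real.sqrt_le_iff.2 ⟨Finset.sum_nonneg fun _ _ => abs_nonneg _, ?_⟩
  simp only [Real.norm_eq_abs]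
  exact Finset.sum_sq_le_sq_sum_of_nonneg fun _ _ => abs_nonneg _

theorem dist_le_sum_abs {ι : Type*} [Fintype ι] (x y : EuclideanSpace ℝ ι) :
    dist x y ≤ ∑ i, |x i - y i| := by
  rw [dist_eq_norm]
  exact norm_le_sum_abs (x - y)

theorem prodLp_dist_le {E F : Type*} [SeminormedAddCommGroup E] [SeminormedAddCommGroup F]
    (x y : WithLp 2 (E × F)) : dist x y ≤ dist x.fst y.fst + dist x.snd y.snd := by
  rw [WithLp.prod_dist_eq_of_L2]
  refine Real.sqrt_le_iff.2 ⟨by positivity, ?_⟩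
  nlinarith [mul_nonneg (dist_nonneg (x := x.fst) (y := y.fst))
    (dist_nonneg (x := x.snd) (y := y.snd))]

/-- Image of a cube under an anisotropic Hölder map. -/
theorem dimH_image_cube_le {E : Type*} [MetricSpace E] {F : EuclideanSpace ℝ (Fin N) → E}
    {a : Fin N → ℝ} (ha : ∀ j, 0 < a j) {K M : ℝ} (hK : 0 ≤ K) (hM : 0 ≤ M)
    (hF : ∀ s ∈ cube N M, ∀ t ∈ cube N M, dist (F s) (F t) ≤ K * ∑ j, |s j - t j| ^ a j) :
    dimH (F '' cube N M) ≤ ENNReal.ofReal (∑ j, 1 / a j) := by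
  refine dimH_le_of_dyadic_cover (D := K * N) (C := (2 * M + 2) ^ N)
    (Finset.sum_nonneg fun j _ => by have := ha j; positivity) (by positivity)
    (fun n => cellSet a M n) (fun n z => F '' {t | t ∈ cube N M ∧ gridIndex a n t = z}) ?_
    (Eventually.of_forall fun n => ?_)
    (Eventually.of_forall fun n => card_cellSet_mul_le ha hM n).frequently
  · rintro n z - _ ⟨s, ⟨hs, rfl⟩, rfl⟩ _ ⟨t, ⟨ht, hst⟩, rfl⟩
    refine (hF s hs t ht).trans ?_
    rw [mul_assoc]
    refine mul_le_mul_of_nonneg_left ?_ hK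
    calc ∑ j, |s j - t j| ^ a j ≤ ∑ j : Fin N, (1 / 2 : ℝ) ^ n := by
          refine Finset.sum_le_sum fun j _ => ?_
          rw [← mesh_rpow ha n j]
          exact Real.rpow_le_rpow (abs_nonneg _) (abs_sub_le_of_gridIndex_eq hst.symm j) (ha j).le
      _ = _ := by simp
  · rintro _ ⟨t, ht, rfl⟩
    simp only [mem_iUnion, exists_prop]
    exact ⟨_, gridIndex_mem_cellSet ht n, t, ⟨ht, rfl⟩, rfl⟩

/-- Size of the image of a cell. -/
theorem sum_abs_rpow_le_of_cell {a c : Fin N → ℝ} (ha : ∀ j, 0 < a j) (hc : ∀ j, 0 < c j) {σ : ℝ}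
    (hac : ∀ j, σ * c j ≤ a j) {n : ℕ} {s t : EuclideanSpace ℝ (Fin N)}
    (hst : gridIndex c n s = gridIndex c n t) :
    ∑ j, |s j - t j| ^ a j ≤ N * ((1 / 2) ^ n) ^ σ := by
  calc ∑ j, |s j - t j| ^ a j ≤ ∑ j : Fin N, ((1 / 2 : ℝ) ^ n) ^ σ := by
        refine Finset.sum_le_sum fun j _ => ?_
        have hm := mesh_pos c n j
        have hm1 : mesh c n j ≤ 1 := (mesh_antitone hc (Nat.zero_le n) j).trans (by simp [mesh])
        calc |s j - t j| ^ a j ≤ mesh c n j ^ a j :=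
              Real.rpow_le_rpow (abs_nonneg _) (abs_sub_le_of_gridIndex_eq hst j) (ha j).le
          _ ≤ mesh c n j ^ (c j * σ) :=
              Real.rpow_le_rpow_of_exponent_ge hm hm1 (by linarith [hac j])
          _ = _ := by rw [Real.rpow_mul hm.le, mesh_rpow hc]
    _ = _ := by simp

theorem dist_le_of_cell {c : Fin N → ℝ} (hc : ∀ j, 0 < c j) (hc1 : ∀ j, c j ≤ 1) {n : ℕ}
    {s t : EuclideanSpace ℝ (Fin N)} (hst : gridIndex c n s = gridIndex c n t) :
    dist s t ≤ N * (1 / 2) ^ n := by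
  have h := sum_abs_rpow_le_of_cell (a := fun _ => 1) (σ := 1) (by simp) hc (by simpa using hc1) hst
  simp only [Real.rpow_one] at h
  exact (dist_le_sum_abs s t).trans h

/-- Graph over a cube of an anisotropic Hölder map, covered by cells and then by cubes of the
size of the cells. -/
theorem dimH_graphOver_cube_le {g : EuclideanSpace ℝ (Fin N) → EuclideanSpace ℝ (Fin p)}
    {a c : Fin N → ℝ} (ha : ∀ j, 0 < a j) (hc : ∀ j, 0 < c j) (hc1 : ∀ j, c j ≤ 1) {σ : ℝ}
    (hσ1 : σ ≤ 1) (hac : ∀ j, σ * c j ≤ a j) {K M : ℝ} (hK : 0 ≤ K) (hM : 0 ≤ M)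
    (hg : ∀ i, ∀ s ∈ cube N M, ∀ t ∈ cube N M, |g s i - g t i| ≤ K * ∑ j, |s j - t j| ^ a j) :
    dimH (graphOver g (cube N M)) ≤ ENNReal.ofReal (∑ j, 1 / c j + (1 - σ) * p) := by
  classical
  -- A representative point in every cell that meets the cube.
  obtain ⟨τ, hτ⟩ : ∃ τ : ℕ → (Fin N → ℤ) → EuclideanSpace ℝ (Fin N),
      ∀ n, ∀ s ∈ cube N M, τ n (gridIndex c n s) ∈ cube N M ∧
        gridIndex c n (τ n (gridIndex c n s)) = gridIndex c n s := by
    have : ∀ n z, ∃ t : EuclideanSpace ℝ (Fin N), ∀ s ∈ cube N M, gridIndex c n s = z →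
        t ∈ cube N M ∧ gridIndex c n t = z := fun n z => by
      by_cases h : ∃ s ∈ cube N M, gridIndex c n s = z
      · obtain ⟨s, hs, hz⟩ := h
        exact ⟨s, fun _ _ _ => ⟨hs, hz⟩⟩
      · exact ⟨0, fun s hs hz => absurd ⟨s, hs, hz⟩ h⟩
    choose τ hτ using this
    exact ⟨τ, fun n s hs => hτ n _ s hs rfl⟩
  -- Oscillation of a component of `g` on a cell, of order 2^(-nσ), measured in units of 2^(-n).
  set Q : ℕ → ℝ := fun n => K * N * ((1 / 2) ^ n) ^ (σ - 1) with hQ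
  have hQ0 : ∀ n, 0 ≤ Q n := fun n => by positivity
  set S : ℕ → Finset (Fin p → ℤ) := fun n =>
    Fintype.piFinset fun _ => Finset.Icc ⌊-Q n⌋ ⌊Q n⌋ with hS
  have hd : 0 ≤ ∑ j, 1 / c j + (1 - σ) * p := by
    have := Finset.sum_nonneg fun j (_ : j ∈ Finset.univ) => (one_div_pos.2 (hc j)).le
    have : 0 ≤ (1 - σ) * p := mul_nonneg (by linarith) (by positivity)
    linarith
  refine dimH_le_of_dyadic_cover (D := N + p) (C := (2 * M + 2) ^ N * (2 * (K * N) + 2) ^ p)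
    hd (by positivity) (fun n => cellSet c M n ×ˢ S n)
    (fun n z => (fun t => WithLp.toLp 2 (t, g t)) '' {t | t ∈ cube N M ∧ gridIndex c n t = z.1 ∧
      ∀ i, ⌊(g t i - g (τ n z.1) i) / (1 / 2) ^ n⌋ = z.2 i}) ?_
    (Eventually.of_forall fun n => ?_) (Eventually.of_forall fun n => ?_).frequently
  · rintro n ⟨z, y⟩ - _ ⟨s, ⟨hs, rfl, hsy⟩, rfl⟩ _ ⟨t, ⟨ht, hst, hty⟩, rfl⟩
    refine (prodLp_dist_le _ _).trans ?_
    have h1 : dist (g s) (g t) ≤ p * (1 / 2) ^ n := by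
      refine (dist_le_sum_abs _ _).trans ?_
      calc ∑ i, |g s i - g t i| ≤ ∑ i : Fin p, (1 / 2 : ℝ) ^ n := by
            refine Finset.sum_le_sum fun i _ => ?_
            have h := (Int.abs_sub_lt_one_of_floor_eq_floor ((hsy i).trans (hty i).symm)).le
            rw [← sub_div, abs_div, abs_of_pos (show (0 : ℝ) < (1 / 2) ^ n by positivity),
              div_le_one (by positivity), sub_sub_sub_cancel_right] at h
            exact h
        _ = _ := by simp
    have h2 := dist_le_of_cell hc hc1 hst.symm
    simp only [WithLp.toLp_fst, WithLp.toLp_snd]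
    linarith
  · rintro _ ⟨t, ht, rfl⟩
    simp only [mem_iUnion, exists_prop]
    refine ⟨(gridIndex c n t, fun i => ⌊(g t i - g (τ n (gridIndex c n t)) i) / (1 / 2) ^ n⌋),
      ?_, t, ⟨ht, rfl, fun _ => rfl⟩, rfl⟩
    rw [Finset.mem_product]
    refine ⟨gridIndex_mem_cellSet ht n, ?_⟩
    rw [hS, Fintype.mem_piFinset]
    intro i
    obtain ⟨h1, h2⟩ := hτ n t ht
    have h3 := (hg i t ht _ h1).trans (mul_le_mul_of_nonneg_left
      (sum_abs_rpow_le_of_cell ha hc hac h2.symm) hK)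
    have h4 : |(g t i - g (τ n (gridIndex c n t)) i) / (1 / 2) ^ n| ≤ Q n := by
      rw [abs_div, abs_of_pos (by positivity : (0 : ℝ) < (1 / 2) ^ n), div_le_iff₀ (by positivity),
        hQ, mul_assoc (K * N), ← Real.rpow_add_one (by positivity)]
      simpa [mul_assoc] using h3
    rw [Finset.mem_Icc]
    exact ⟨Int.floor_le_floor (abs_le.1 h4).1, Int.floor_le_floor (abs_le.1 h4).2⟩
  · have h1 : ((S n).card : ℝ) * ((1 / 2) ^ n) ^ ((1 - σ) * p) ≤ (2 * (K * N) + 2) ^ p := by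
      rw [hS, Fintype.card_piFinset, Finset.prod_const, Finset.card_univ, Fintype.card_fin,
        Nat.cast_pow, Real.rpow_mul_natCast (by positivity), ← mul_pow]
      refine pow_le_pow_left₀ (by positivity) ?_ p
      have h2 := card_Icc_floor_le (a := -Q n) (b := Q n) (by linarith [hQ0 n])
      have h3 : ((1 / 2 : ℝ) ^ n) ^ (1 - σ) ≤ 1 :=
        Real.rpow_le_one (by positivity) (pow_le_one₀ (by norm_num) (by norm_num)) (by linarith)
      have h4 : Q n * ((1 / 2 : ℝ) ^ n) ^ (1 - σ) = K * N := by
        rw [hQ, mul_assoc (K * N), ← Real.rpow_add (by positivity)]; simp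
      have h5 : (0 : ℝ) ≤ ((1 / 2 : ℝ) ^ n) ^ (1 - σ) := by positivity
      have := mul_le_mul_of_nonneg_right h2 h5
      nlinarith
    rw [Finset.card_product, Nat.cast_mul, Real.rpow_add (by positivity)]
    have h2 := card_cellSet_mul_le hc hM n
    calc _ = (((cellSet c M n).card : ℝ) * ((1 / 2) ^ n) ^ (∑ j, 1 / c j)) *
          (((S n).card : ℝ) * ((1 / 2) ^ n) ^ ((1 - σ) * p)) := by ring
      _ ≤ _ := by gcongr

/-- `1 - 1 / (m + 2)`. -/
noncomputable def nearOne (m : ℕ) : ℝ := 1 - 1 / ((m : ℝ) + 2)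

theorem nearOne_pos (m : ℕ) : 0 < nearOne m := by
  have : (0 : ℝ) ≤ m := by positivity
  rw [nearOne, sub_pos, div_lt_one (by positivity)]
  linarith

theorem nearOne_lt_one (m : ℕ) : nearOne m < 1 := by
  rw [nearOne]
  have : 0 < 1 / ((m : ℝ) + 2) := by positivity
  linarith

theorem tendsto_nearOne : Tendsto nearOne atTop (𝓝 1) := by
  have h : Tendsto (fun m : ℕ => 1 / ((m : ℝ) + 2)) atTop (𝓝 0) :=
    tendsto_const_nhds.div_atTop (tendsto_atTop_add_const_right _ _ tendsto_natCast_atTop_atTop)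
  have h' := h.const_sub 1
  rw [sub_zero] at h'
  exact h'

/-- Removes the loss in the exponents: estimates proved with `l * H j`, l < 1, pass to l = 1 along a
countable sequence, so almost sure statements survive. -/
theorem le_ofReal_of_forall_nearOne {y : ℝ≥0∞} {φ : ℝ → ℝ} (hφ : ContinuousAt φ 1)
    (h : ∀ m, y ≤ ENNReal.ofReal (φ (nearOne m))) : y ≤ ENNReal.ofReal (φ 1) :=
  ge_of_tendsto' (ENNReal.tendsto_ofReal (hφ.tendsto.comp tendsto_nearOne)) h

theorem unitCube_subset_cube (N : ℕ) : unitCube N ⊆ cube N 1 := fun t ht j => by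
  rw [abs_le]; exact ⟨by linarith [(ht j).1], (ht j).2⟩

/-- The mesh exponents for the `k`-th covering. -/
noncomputable def cellExp (H : Fin N → ℝ) (k j : Fin N) : ℝ := min 1 (H j / H k)

/-- For ordered `H` the minimum in `cellExp` is H_j/H_k for j ≤ k and 1 beyond. The `+ 1`
compensates for the zero-based index. -/
theorem sum_one_div_cellExp {H : Fin N → ℝ} (hpos : ∀ j, 0 < H j) (hmono : Monotone H)
    (k : Fin N) : ∑ j, 1 / cellExp H k j =
      ∑ j ∈ Finset.Iic k, H k / H j + ((N : ℝ) - ((k : ℕ) + 1 : ℝ)) := by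
  have h : ∀ j, 1 / cellExp H k j = if j ≤ k then H k / H j else 1 := fun j => by
    rw [cellExp]
    split_ifs with hj
    · rw [min_eq_right ((div_le_one (hpos k)).2 (hmono hj)), one_div_div]
    · rw [min_eq_left ((one_le_div (hpos k)).2 (hmono (not_le.1 hj).le)), one_div_one]
  simp_rw [h]
  rw [Finset.sum_ite]
  congr 1
  · refine Finset.sum_congr ?_ fun _ _ => rfl
    ext j; simp
  · have e : Finset.univ.filter (fun j : Fin N => ¬ j ≤ k) = Finset.Ioi k := by
      ext j; simp
    rw [e, Finset.sum_const, Fin.card_Ioi, nsmul_eq_mul, mul_one]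
    have := k.isLt
    rw [Nat.cast_sub (by omega), Nat.cast_sub (by omega)]
    push_cast; ring

theorem cellExp_pos {H : Fin N → ℝ} (hpos : ∀ j, 0 < H j) (k j : Fin N) : 0 < cellExp H k j :=
  lt_min one_pos (div_pos (hpos j) (hpos k))

theorem mul_cellExp_le {H : Fin N → ℝ} (hpos : ∀ j, 0 < H j) {l : ℝ} (hl : 0 ≤ l) (k j : Fin N) :
    l * H k * cellExp H k j ≤ l * H j := by
  rw [mul_assoc]
  refine mul_le_mul_of_nonneg_left ?_ hl
  have := mul_le_mul_of_nonneg_left (min_le_right 1 (H j / H k)) (hpos k).le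
  rwa [mul_div_cancel₀ _ (hpos k).ne'] at this

namespace IsRegularField

variable {Ω : Type*} [MeasurableSpace Ω] {P : Measure Ω}
  {X : Fin p → EuclideanSpace ℝ (Fin N) → Ω → ℝ} {v : EuclideanSpace ℝ (Fin N) → ℝ}

/-- Upper bounds for the variogram with all exponents below `H`. -/
def _root_.AnisoField.VariogramUpper (v : EuclideanSpace ℝ (Fin N) → ℝ) (H : Fin N → ℝ) : Prop :=
  ∀ a : Fin N → ℝ, (∀ j, 0 ≤ a j) → (∀ j, a j < H j) → ∀ M : ℝ, ∃ C : ℝ, 0 < C ∧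
    ∀ h : EuclideanSpace ℝ (Fin N), (∀ j, |h j| ≤ M) → v h ≤ C * ∑ j, |h j| ^ (2 * a j)

theorem ae_holder_of_variogramUpper (h : IsRegularField X P v) {H : Fin N → ℝ}
    (hpos : ∀ j, 0 < H j) (hv : VariogramUpper v H) {l : ℝ} (hl0 : 0 < l) (hl1 : l < 1) {M : ℝ}
    (hM : 0 ≤ M) :
    ∀ᵐ ω ∂P, ∃ K : ℝ, 0 < K ∧ ∀ i, ∀ s ∈ cube N M, ∀ t ∈ cube N M,
      |X i s ω - X i t ω| ≤ K * ∑ j, |s j - t j| ^ (l * H j) := by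
  -- The loss l is split evenly: one factor √l for the variogram bound, the other for chaining.
  have hs0 : 0 < √l := Real.sqrt_pos.2 hl0
  have hs1 : √l < 1 := by rw [Real.sqrt_lt' one_pos]; linarith
  have hb : ∀ j, 0 < √l * H j := fun j => mul_pos hs0 (hpos j)
  obtain ⟨C, hC, hCv⟩ := hv (fun j => √l * H j) (fun j => (hb j).le)
    (fun j => mul_lt_of_lt_one_left (hpos j) hs1) 3
  have := h.ae_holder hb hs0 hs1 hC hCv hM
  simpa only [← mul_assoc, Real.mul_self_sqrt hl0.le] using this

/-- The bound `p` is the ambient dimension; the other comes from cells of sides 2^(-n/(l H_j)),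
whose images have size of order 2^(-n). -/
theorem ae_dimH_range_le (h : IsRegularField X P v) {H : Fin N → ℝ} (hpos : ∀ j, 0 < H j)
    (hv : VariogramUpper v H) :
    ∀ᵐ ω ∂P, dimH (path X ω '' unitCube N) ≤ ENNReal.ofReal (rangeDim p H) := by
  have hh := ae_all_iff.2 fun m : ℕ =>
    h.ae_holder_of_variogramUpper hpos hv (nearOne_pos m) (nearOne_lt_one m) (zero_le_one)
  filter_upwards [hh] with ω hω
  rw [rangeDim, ENNReal.ofReal_min]
  refine le_min ?_ ?_
  · refine (dimH_mono (subset_univ _)).trans ?_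
    rw [Real.dimH_univ_eq_finrank, finrank_euclideanSpace_fin, ENNReal.ofReal_natCast]
  · have e : ∑ j, 1 / H j = (fun l : ℝ => ∑ j, 1 / (l * H j)) 1 := by simp
    rw [e]
    refine le_ofReal_of_forall_nearOne (φ := fun l : ℝ => ∑ j, 1 / (l * H j)) ?_ fun m => ?_
    · refine tendsto_finsetSum _ fun j _ => ?_
      exact ContinuousAt.div continuousAt_const (continuousAt_id.mul continuousAt_const)
        (by simpa using (hpos j).ne')
    · obtain ⟨K, hK, hKω⟩ := hω m
      refine (dimH_mono (image_mono (unitCube_subset_cube N))).trans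
        (dimH_image_cube_le (K := p * K) (fun j => mul_pos (nearOne_pos m) (hpos j))
          (by positivity) zero_le_one fun s hs t ht => ?_)
      refine (dist_le_sum_abs _ _).trans ?_
      calc ∑ i, |path X ω s i - path X ω t i| ≤
          ∑ i : Fin p, K * ∑ j, |s j - t j| ^ (nearOne m * H j) :=
            Finset.sum_le_sum fun i _ => hKω i s hs t ht
        _ = _ := by simp [mul_assoc]

theorem ae_dimH_graph_le (h : IsRegularField X P v) {H : Fin N → ℝ} (hpos : ∀ j, 0 < H j)
    (hH1 : ∀ j, H j ≤ 1) (hmono : Monotone H) (hv : VariogramUpper v H) (hN : 1 ≤ N) :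
    ∀ᵐ ω ∂P, dimH (graphOver (path X ω) (unitCube N)) ≤ ENNReal.ofReal (graphDim p H) := by
  have hh := ae_all_iff.2 fun m : ℕ =>
    h.ae_holder_of_variogramUpper hpos hv (nearOne_pos m) (nearOne_lt_one m) (zero_le_one)
  filter_upwards [hh] with ω hω
  have hsub : graphOver (path X ω) (unitCube N) ⊆ graphOver (path X ω) (cube N 1) :=
    image_mono (unitCube_subset_cube N)
  rw [graphDim, ENNReal.ofReal_min]
  refine le_min ?_ ?_
  · have : Nonempty (Fin N) := ⟨⟨0, hN⟩⟩
    obtain ⟨k, hk⟩ := exists_eq_ciInf_of_finite (f := fun k : Fin N =>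
      ∑ j ∈ Finset.Iic k, H k / H j + ((N : ℝ) - ((k : ℕ) + 1 : ℝ)) + (1 - H k) * p)
    rw [← hk]
    have e : ∑ j ∈ Finset.Iic k, H k / H j + ((N : ℝ) - ((k : ℕ) + 1 : ℝ)) + (1 - H k) * p =
        (fun l : ℝ => ∑ j, 1 / cellExp H k j + (1 - l * H k) * p) 1 := by
      simp only [sum_one_div_cellExp hpos hmono, one_mul]
    rw [e]
    refine le_ofReal_of_forall_nearOne
      (φ := fun l : ℝ => ∑ j, 1 / cellExp H k j + (1 - l * H k) * p) ?_ fun m => ?_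
    · exact Continuous.continuousAt (by fun_prop)
    · obtain ⟨K, hK, hKω⟩ := hω m
      -- With exponents `cellExp H k` all cell sides are at most 2^(-n), and every component
      -- oscillates by at most order 2^(-n l H_k) on a cell.
      exact (dimH_mono hsub).trans (dimH_graphOver_cube_le
        (fun j => mul_pos (nearOne_pos m) (hpos j)) (cellExp_pos hpos k)
        (fun j => min_le_left _ _)
        (by nlinarith [hH1 k, hpos k, nearOne_pos m, nearOne_lt_one m])
        (fun j => mul_cellExp_le hpos (nearOne_pos m).le k j) hK.le zero_le_one hKω)
  · have e : ∑ j, 1 / H j = (fun l : ℝ => ∑ j, 1 / (l * H j)) 1 := by simp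
    rw [e]
    refine le_ofReal_of_forall_nearOne (φ := fun l : ℝ => ∑ j, 1 / (l * H j)) ?_ fun m => ?_
    · refine tendsto_finsetSum _ fun j _ => ?_
      exact ContinuousAt.div continuousAt_const (continuousAt_id.mul continuousAt_const)
        (by simpa using (hpos j).ne')
    · obtain ⟨K, hK, hKω⟩ := hω m
      -- Since the exponents are at most 1, t ↦ (t, g t) is itself anisotropic Hölder; on the cube u
      -- ≤ 2 gives u ≤ 2u^e, whence the constant 2.
      refine (dimH_mono hsub).trans
        (dimH_image_cube_le (K := 2 + p * K) (fun j => mul_pos (nearOne_pos m) (hpos j))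
          (by positivity) zero_le_one fun s hs t ht => ?_)
      refine (prodLp_dist_le _ _).trans ?_
      rw [add_mul]
      refine add_le_add ?_ ?_
      · refine (dist_le_sum_abs _ _).trans ?_
        rw [Finset.mul_sum]
        refine Finset.sum_le_sum fun j _ => ?_
        simp only [WithLp.toLp_fst]
        have hst : |s j - t j| ≤ 2 := by
          have h1 := abs_le.1 (hs j)
          have h2 := abs_le.1 (ht j)
          rw [abs_le]; constructor <;> linarith [h1.1, h1.2, h2.1, h2.2]
        have hexp : nearOne m * H j ≤ 1 := by
          nlinarith [hH1 j, hpos j, nearOne_pos m, nearOne_lt_one m]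
        have hexp0 : 0 ≤ nearOne m * H j := (mul_pos (nearOne_pos m) (hpos j)).le
        obtain ⟨e, he⟩ : ∃ e, e = nearOne m * H j := ⟨_, rfl⟩
        obtain ⟨u, hu⟩ : ∃ u, u = |s j - t j| := ⟨_, rfl⟩
        rw [← he] at hexp hexp0 ⊢
        rw [← hu] at hst ⊢
        have hu0 : 0 ≤ u := hu ▸ abs_nonneg _
        rcases le_total u 1 with h1 | h1
        · rcases hu0.eq_or_lt with h0 | h0
          · rw [← h0]; positivity
          · have := Real.rpow_le_rpow_of_exponent_ge h0 h1 hexp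
            rw [Real.rpow_one] at this
            have : 0 ≤ u ^ e := by positivity
            linarith
        · have := Real.one_le_rpow h1 hexp0
          linarith
      · refine (dist_le_sum_abs _ _).trans ?_
        calc ∑ i, |path X ω s i - path X ω t i| ≤
            ∑ i : Fin p, K * ∑ j, |s j - t j| ^ (nearOne m * H j) :=
              Finset.sum_le_sum fun i _ => hKω i s hs t ht
          _ = _ := by simp [mul_assoc]

end IsRegularField

end AnisoField

/-! ### Upper bounds for level sets: counting the cells hit -/

namespace AnisoField

open Filter Topology Metric Set
open scoped NNReal

variable {N p : ℕ}

namespace IsRegularField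

variable {Ω : Type*} [MeasurableSpace Ω] {P : Measure Ω}
  {X : Fin p → EuclideanSpace ℝ (Fin N) → Ω → ℝ} {v : EuclideanSpace ℝ (Fin N) → ℝ}

/-- The number of cells hit by a level set is small. -/
theorem ae_eventually_card_le (h : IsRegularField X P v) {c : Fin N → ℝ}
    (hc : ∀ j, 0 < c j) {σ w K M d : ℝ} (hw : 0 < w) (hK : 0 ≤ K) (hM : 0 ≤ M)
    (hd : ∑ j, 1 / c j - σ * p < d) (x : EuclideanSpace ℝ (Fin p))
    (τ : ℕ → (Fin N → ℤ) → EuclideanSpace ℝ (Fin N)) (hτ : ∀ n z, w ≤ v (τ n z)) :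
    ∀ᵐ ω ∂P, ∀ᶠ n in atTop, ∀ T : Finset (Fin N → ℤ), T ⊆ cellSet c M n →
      (∀ z ∈ T, ∀ i, |X i (τ n z) ω - x i| ≤ K * ((1 / 2) ^ n) ^ σ) →
      (T.card : ℝ) * ((1 / 2) ^ n) ^ d ≤ 1 := by
  classical
  obtain ⟨ε, hε⟩ : ∃ ε, ε = d - (∑ j, 1 / c j - σ * p) := ⟨_, rfl⟩
  have hε0 : 0 < ε := by linarith
  set E : ℕ → (Fin N → ℤ) → Set Ω := fun n z =>
    {ω | ∀ i, |X i (τ n z) ω - x i| ≤ K * ((1 / 2) ^ n) ^ σ} with hE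
  have hEm : ∀ n z, MeasurableSet (E n z) := fun n z => by
    have e : E n z = ⋂ i, {ω | |X i (τ n z) ω - x i| ≤ K * ((1 / 2) ^ n) ^ σ} := by
      ext ω; simp [hE]
    rw [e]
    refine MeasurableSet.iInter fun i => measurableSet_le ?_ measurable_const
    exact ((h.measurable i _).sub measurable_const).abs
  -- The number of hit cells normalized by 2^(-nd). Its mean decays like 2^(-nε), so ∑ Z_n is almost
  -- surely finite and Z_n → 0.
  set Z : ℕ → Ω → ℝ≥0∞ := fun n ω => ENNReal.ofReal (((1 / 2) ^ n) ^ d) *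
    ∑ z ∈ cellSet c M n, (E n z).indicator (fun _ => 1) ω with hZ
  have hZm : ∀ n, Measurable (Z n) := fun n =>
    (Finset.measurable_sum _ fun z _ => measurable_const.indicator (hEm n z)).const_mul _
  obtain ⟨A, hA⟩ : ∃ A : ℝ, A = (2 * M + 2) ^ N * (K / √w) ^ p := ⟨_, rfl⟩
  have hA0 : 0 ≤ A := by rw [hA]; positivity
  have hZint : ∀ n, ∫⁻ ω, Z n ω ∂P ≤ ENNReal.ofReal (A * ((1 / 2 : ℝ) ^ ε) ^ n) := by
    intro n
    rw [lintegral_const_mul _ (Finset.measurable_sum _ fun z _ =>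
      measurable_const.indicator (hEm n z)), lintegral_finsetSum _ fun z _ =>
      measurable_const.indicator (hEm n z)]
    have h1 : ∀ z ∈ cellSet c M n, ∫⁻ ω, (E n z).indicator (fun _ => 1) ω ∂P ≤
        ENNReal.ofReal ((K * ((1 / 2) ^ n) ^ σ / √w) ^ p) := fun z _ => by
      rw [lintegral_indicator (hEm n z), setLIntegral_one]
      refine (h.measure_value_le (hw.trans_le (hτ n z)) x (by positivity)).trans
        (ENNReal.ofReal_le_ofReal ?_)
      have := hτ n z
      gcongr
    refine (mul_le_mul_right (Finset.sum_le_sum h1) _).trans ?_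
    rw [Finset.sum_const, nsmul_eq_mul, ← ENNReal.ofReal_natCast,
      ← ENNReal.ofReal_mul (by positivity), ← ENNReal.ofReal_mul (by positivity)]
    refine ENNReal.ofReal_le_ofReal ?_
    have hcard := card_cellSet_mul_le hc hM n
    have hr : (0 : ℝ) < (1 / 2) ^ n := by positivity
    have e1 : ((1 / 2 : ℝ) ^ n) ^ d =
        ((1 / 2 : ℝ) ^ n) ^ (∑ j, 1 / c j) * (((1 / 2 : ℝ) ^ n) ^ (-σ)) ^ p *
          ((1 / 2 : ℝ) ^ ε) ^ n := by
      have e2 : ((1 / 2 : ℝ) ^ ε) ^ n = ((1 / 2 : ℝ) ^ n) ^ ε := by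
        rw [← Real.rpow_natCast, ← Real.rpow_natCast, ← Real.rpow_mul (by norm_num),
          ← Real.rpow_mul (by norm_num), mul_comm]
      rw [e2, ← Real.rpow_mul_natCast hr.le, ← Real.rpow_add hr, ← Real.rpow_add hr]
      congr 1
      rw [hε]; ring
    have e3 : (K * ((1 / 2 : ℝ) ^ n) ^ σ / √w) ^ p * (((1 / 2 : ℝ) ^ n) ^ (-σ)) ^ p =
        (K / √w) ^ p := by
      rw [← mul_pow]
      congr 1
      have : ((1 / 2 : ℝ) ^ n) ^ σ * ((1 / 2 : ℝ) ^ n) ^ (-σ) = 1 := by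
        rw [← Real.rpow_add hr]; simp
      calc _ = K / √w * (((1 / 2 : ℝ) ^ n) ^ σ * ((1 / 2 : ℝ) ^ n) ^ (-σ)) := by ring
        _ = _ := by rw [this, mul_one]
    calc _ = (((cellSet c M n).card : ℝ) * ((1 / 2) ^ n) ^ (∑ j, 1 / c j)) *
          ((K * ((1 / 2 : ℝ) ^ n) ^ σ / √w) ^ p * (((1 / 2 : ℝ) ^ n) ^ (-σ)) ^ p) *
          ((1 / 2 : ℝ) ^ ε) ^ n := by rw [e1]; ring
      _ ≤ (2 * M + 2) ^ N * (K / √w) ^ p * ((1 / 2 : ℝ) ^ ε) ^ n := by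
          rw [e3]
          gcongr
      _ = _ := by rw [hA]
  have hsum : Summable fun n : ℕ => A * ((1 / 2 : ℝ) ^ ε) ^ n :=
    (summable_geometric_of_lt_one (by positivity)
      (Real.rpow_lt_one (by norm_num) (by norm_num) hε0)).mul_left A
  have hfin : ∫⁻ ω, ∑' n, Z n ω ∂P ≠ ⊤ := by
    rw [lintegral_tsum fun n => (hZm n).aemeasurable]
    exact ne_top_of_le_ne_top hsum.tsum_ofReal_ne_top (ENNReal.tsum_le_tsum hZint)
  filter_upwards [ae_lt_top (Measurable.tsum hZm) hfin] with ω hω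
  have h0 := ENNReal.tendsto_atTop_zero_of_tsum_ne_top hω.ne
  filter_upwards [h0.eventually (Iic_mem_nhds one_pos)] with n hn T hT hTx
  have h1 : ENNReal.ofReal ((T.card : ℝ) * ((1 / 2) ^ n) ^ d) ≤ Z n ω := by
    rw [hZ, mul_comm, ENNReal.ofReal_mul (by positivity), ENNReal.ofReal_natCast]
    refine mul_le_mul_right ?_ _
    calc (T.card : ℝ≥0∞) = ∑ z ∈ T, (E n z).indicator (fun _ => 1) ω := by
          rw [Finset.sum_congr rfl fun z hz => indicator_of_mem (show ω ∈ E n z from hTx z hz) _]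
          simp
      _ ≤ _ := Finset.sum_le_sum_of_subset hT
  have h2 := h1.trans hn
  rwa [ENNReal.ofReal_le_one] at h2

/-- If a cell contains a point where the path equals `x`, then at the representative of the cell the
path is within the cell oscillation of `x`, so the cell is among those counted. The lower bound `w`
on the variance keeps the densities bounded. -/
theorem ae_dimH_level_inter_le (h : IsRegularField X P v) {a c : Fin N → ℝ} (ha : ∀ j, 0 < a j)
    (hc : ∀ j, 0 < c j) (hc1 : ∀ j, c j ≤ 1) {σ : ℝ} (hac : ∀ j, σ * c j ≤ a j)
    {w M d : ℝ} (hw : 0 < w) (hM : 0 ≤ M) (hd0 : 0 ≤ d) (hd : ∑ j, 1 / c j - σ * p < d)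
    (hhol : ∀ᵐ ω ∂P, ∃ K : ℝ, 0 < K ∧ ∀ i, ∀ s ∈ cube N M, ∀ t ∈ cube N M,
      |X i s ω - X i t ω| ≤ K * ∑ j, |s j - t j| ^ a j)
    {B : Set (EuclideanSpace ℝ (Fin N))} (hBM : B ⊆ cube N M) (hB : ∀ t ∈ B, w ≤ v t)
    (x : EuclideanSpace ℝ (Fin p)) :
    ∀ᵐ ω ∂P, dimH {t | t ∈ B ∧ path X ω t = x} ≤ ENNReal.ofReal d := by
  classical
  rcases B.eq_empty_or_nonempty with rfl | ⟨t₀, ht₀⟩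
  · simp
  obtain ⟨τ, hτB, hτ⟩ : ∃ τ : ℕ → (Fin N → ℤ) → EuclideanSpace ℝ (Fin N),
      (∀ n z, τ n z ∈ B) ∧ ∀ n, ∀ s ∈ B, gridIndex c n (τ n (gridIndex c n s)) =
        gridIndex c n s := by
    have : ∀ n z, ∃ t : EuclideanSpace ℝ (Fin N), t ∈ B ∧ ∀ s ∈ B, gridIndex c n s = z →
        gridIndex c n t = z := fun n z => by
      by_cases h : ∃ s ∈ B, gridIndex c n s = z
      · obtain ⟨s, hs, hz⟩ := h
        exact ⟨s, hs, fun _ _ _ => hz⟩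
      · exact ⟨t₀, ht₀, fun s hs hz => absurd ⟨s, hs, hz⟩ h⟩
    choose τ hτ hτ' using this
    exact ⟨τ, hτ, fun n s hs => hτ' n _ s hs rfl⟩
  -- The Hölder constant is random, while the counting estimate needs a deterministic one; countably
  -- many integers k suffice.
  have hcount := ae_all_iff.2 fun k : ℕ => h.ae_eventually_card_le (K := k * N) hc hw
    (by positivity) hM hd x τ fun n z => hB _ (hτB n z)
  filter_upwards [hhol, hcount] with ω hω hcω
  obtain ⟨K, hK, hKω⟩ := hω
  obtain ⟨k, hk⟩ := exists_nat_ge K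
  set T : ℕ → Finset (Fin N → ℤ) := fun n => (cellSet c M n).filter fun z =>
    ∀ i, |X i (τ n z) ω - x i| ≤ k * N * ((1 / 2) ^ n) ^ σ with hT
  refine dimH_le_of_dyadic_cover (D := N) (C := 1) hd0 (by positivity) T
    (fun n z => {t | t ∈ B ∧ gridIndex c n t = z}) ?_ (Eventually.of_forall fun n => ?_)
    ((hcω k).mono fun n hn => hn (T n) (Finset.filter_subset _ _)
      fun z hz => (Finset.mem_filter.1 hz).2).frequently
  · rintro n z - s ⟨hs, rfl⟩ t ⟨ht, hst⟩
    exact dist_le_of_cell hc hc1 hst.symm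
  · rintro t ⟨ht, htx⟩
    simp only [mem_iUnion, exists_prop]
    refine ⟨gridIndex c n t, Finset.mem_filter.2 ⟨gridIndex_mem_cellSet (hBM ht) n, fun i => ?_⟩,
      ht, rfl⟩
    have e : x i = X i t ω := by rw [← htx]; rfl
    rw [e]
    refine (hKω i _ (hBM (hτB n _)) t (hBM ht)).trans ?_
    rw [mul_assoc]
    exact mul_le_mul hk (sum_abs_rpow_le_of_cell ha hc hac (hτ n t ht))
      (Finset.sum_nonneg fun j _ => by positivity) (by positivity)

/-- The variance degenerates only at the origin. The rest of the space is exhausted by bounded sets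
on which it is bounded below, and dimension is countably stable. -/
theorem ae_dimH_level_le (h : IsRegularField X P v) {H : Fin N → ℝ} (hpos : ∀ j, 0 < H j)
    (hmono : Monotone H) (hv : VariogramUpper v H) (hN : 1 ≤ N) (hv0 : ∀ t, t ≠ 0 → 0 < v t)
    (x : EuclideanSpace ℝ (Fin p)) :
    ∀ᵐ ω ∂P, dimH {t | path X ω t = x} ≤ ENNReal.ofReal (levelDim p H) := by
  have : Nonempty (Fin N) := ⟨⟨0, hN⟩⟩
  obtain ⟨k, hk⟩ := exists_eq_ciInf_of_finite (f := fun k : Fin N =>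
    ∑ j ∈ Finset.Iic k, H k / H j + ((N : ℝ) - ((k : ℕ) + 1 : ℝ)) - H k * p)
  have e : ENNReal.ofReal (levelDim p H) = ENNReal.ofReal ((fun l : ℝ =>
      max 0 (∑ j, 1 / cellExp H k j - l * H k * p) + (1 - l)) 1) := by
    simp only [one_mul, sub_self, add_zero]
    rw [levelDim, ← hk, sum_one_div_cellExp hpos hmono, ENNReal.ofReal_max]
    simp
  have hall := ae_all_iff.2 fun m : ℕ => ae_all_iff.2 fun n : ℕ =>
    h.ae_dimH_level_inter_le (σ := nearOne m * H k) (w := 1 / ((n : ℝ) + 1)) (M := n)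
      -- The maximum keeps `d` nonnegative, matching the truncation in `ENNReal.ofReal`; the summand
      -- 1 - l makes the required inequality strict and vanishes in the limit.
      (d := max 0 (∑ j, 1 / cellExp H k j - nearOne m * H k * p) + (1 - nearOne m))
      (fun j => mul_pos (nearOne_pos m) (hpos j)) (cellExp_pos hpos k) (fun j => min_le_left _ _)
      (fun j => mul_cellExp_le hpos (nearOne_pos m).le k j) (by positivity) (by positivity)
      (add_nonneg (le_max_left _ _) (by linarith [nearOne_lt_one m]))
      (by linarith [nearOne_lt_one m,
        le_max_right 0 (∑ j, 1 / cellExp H k j - nearOne m * H k * p)])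
      (h.ae_holder_of_variogramUpper hpos hv (nearOne_pos m) (nearOne_lt_one m) (by positivity))
      (B := {t | t ∈ cube N n ∧ 1 / ((n : ℝ) + 1) ≤ v t}) (fun t ht => ht.1) (fun t ht => ht.2) x
  filter_upwards [hall] with ω hω
  rw [e]
  refine le_ofReal_of_forall_nearOne (φ := fun l : ℝ =>
    max 0 (∑ j, 1 / cellExp H k j - l * H k * p) + (1 - l))
    (Continuous.continuousAt (by fun_prop)) fun m => ?_
  have hsub : {t | path X ω t = x} ⊆ {0} ∪ ⋃ n : ℕ,
      {t | t ∈ {t | t ∈ cube N n ∧ 1 / ((n : ℝ) + 1) ≤ v t} ∧ path X ω t = x} := by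
    intro t ht
    by_cases ht0 : t = 0
    · exact Or.inl ht0
    · right
      obtain ⟨n₁, hn₁⟩ := exists_nat_ge (∑ j, |t j|)
      obtain ⟨n₂, hn₂⟩ := exists_nat_one_div_lt (hv0 t ht0)
      refine mem_iUnion.2 ⟨max n₁ n₂, ⟨fun j => ?_, ?_⟩, ht⟩
      · refine (Finset.single_le_sum (f := fun j => |t j|) (fun j _ => abs_nonneg _)
          (Finset.mem_univ j)).trans (hn₁.trans ?_)
        exact_mod_cast le_max_left _ _
      · refine le_trans ?_ hn₂.le
        have : (n₂ : ℝ) ≤ (max n₁ n₂ : ℕ) := by exact_mod_cast le_max_right _ _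
        gcongr
  refine (dimH_mono hsub).trans ?_
  rw [dimH_union, dimH_singleton, dimH_iUnion]
  exact max_le (by simp) (iSup_le fun n => hω m n)

end IsRegularField

end AnisoField

namespace AnisoField

open Filter Topology Metric Set
open scoped NNReal

variable {N p : ℕ}

/-! ### Expected energies and lower bounds -/

section Energy

variable {Ω T E : Type*} [MeasurableSpace Ω] [MeasurableSpace T] [MetricSpace E]
  [MeasurableSpace E] [BorelSpace E] [SecondCountableTopology E]

/-- Pairs of points of `A` with images at distance at most `2⁻ᵐ`. -/
def closePairs (F : Ω → T → E) (A : Set (Ω × T)) (m : ℕ) : Set (Ω × (T × T)) :=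
  {q | (q.1, q.2.1) ∈ A ∧ (q.1, q.2.2) ∈ A ∧ dist (F q.1 q.2.2) (F q.1 q.2.1) ≤ (1 / 2) ^ m}

theorem measurableSet_closePairs {F : Ω → T → E} (hF : Measurable (Function.uncurry F))
    {A : Set (Ω × T)} (hA : MeasurableSet A) (m : ℕ) : MeasurableSet (closePairs F A m) := by
  have h1 : Measurable fun q : Ω × (T × T) => (q.1, q.2.1) := by fun_prop
  have h2 : Measurable fun q : Ω × (T × T) => (q.1, q.2.2) := by fun_prop
  exact (h1 hA).inter ((h2 hA).inter
    (measurableSet_le ((hF.comp h2).dist (hF.comp h1)) measurable_const))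

/-- The energy becomes a series of measures of sections of jointly measurable sets, so its
measurability in ω and its mean follow from Tonelli. -/
theorem dyadicEnergy_map_eq {F : Ω → T → E} (hF : Measurable (Function.uncurry F))
    {A : Set (Ω × T)} (hA : MeasurableSet A) (ν : Measure T) [IsFiniteMeasure ν] (γ : ℝ) (ω : Ω) :
    dyadicEnergy γ ((ν.restrict {t | (ω, t) ∈ A}).map (F ω)) =
      ∑' m : ℕ, ENNReal.ofReal (2 ^ (m * γ)) *
        (ν.prod ν) (Prod.mk ω ⁻¹' closePairs F A m) := by
  have hFω : Measurable (F ω) := hF.comp measurable_prodMk_left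
  have hS : MeasurableSet {t | (ω, t) ∈ A} := measurable_prodMk_left hA
  rw [dyadicEnergy]
  congr 1
  ext m
  congr 1
  rw [lintegral_map (measurable_measure_closedBall _ _) hFω,
    Measure.prod_apply (measurable_prodMk_left (measurableSet_closePairs hF hA m)),
    ← lintegral_indicator hS]
  refine lintegral_congr fun s => ?_
  by_cases hs : (ω, s) ∈ A
  · rw [indicator_of_mem (by exact hs), Measure.map_apply hFω measurableSet_closedBall,
      Measure.restrict_apply (hFω measurableSet_closedBall)]
    congr 1
    ext t
    simp only [closePairs, mem_inter_iff, mem_preimage, mem_closedBall, mem_ofPred_eq]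
    tauto
  · rw [indicator_of_notMem (by exact hs)]
    symm
    convert measure_empty (μ := ν)
    ext t
    simp [closePairs, hs]

theorem measurable_dyadicEnergy_map {F : Ω → T → E} (hF : Measurable (Function.uncurry F))
    {A : Set (Ω × T)} (hA : MeasurableSet A) (ν : Measure T) [IsFiniteMeasure ν] (γ : ℝ) :
    Measurable fun ω => dyadicEnergy γ ((ν.restrict {t | (ω, t) ∈ A}).map (F ω)) := by
  simp_rw [dyadicEnergy_map_eq hF hA]
  exact Measurable.tsum fun m =>
    (measurable_measure_prodMk_left (measurableSet_closePairs hF hA m)).const_mul _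

theorem lintegral_dyadicEnergy_map {F : Ω → T → E} (hF : Measurable (Function.uncurry F))
    {A : Set (Ω × T)} (hA : MeasurableSet A) (ν : Measure T) [IsFiniteMeasure ν] (γ : ℝ)
    (P : Measure Ω) [IsProbabilityMeasure P] :
    ∫⁻ ω, dyadicEnergy γ ((ν.restrict {t | (ω, t) ∈ A}).map (F ω)) ∂P =
      ∑' m : ℕ, ENNReal.ofReal (2 ^ (m * γ)) * ∫⁻ s, ∫⁻ t, P {ω | (ω, s) ∈ A ∧ (ω, t) ∈ A ∧
        dist (F ω t) (F ω s) ≤ (1 / 2) ^ m} ∂ν ∂ν := by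
  have hG := measurableSet_closePairs hF hA
  simp_rw [dyadicEnergy_map_eq hF hA]
  rw [lintegral_tsum fun m => ((measurable_measure_prodMk_left (hG m)).const_mul _).aemeasurable]
  congr 1
  ext m
  rw [lintegral_const_mul _ (measurable_measure_prodMk_left (hG m)),
    ← Measure.prod_apply (hG m), Measure.prod_apply_symm (hG m),
    lintegral_prod _ (measurable_measure_prodMk_right (hG m)).aemeasurable]
  rfl

theorem tsum_dyadic_le {γ κ : ℝ} (hγ : γ < κ) {A : ℝ} (hA : 0 ≤ A) {f : ℕ → ℝ≥0∞}
    (hf : ∀ m, f m ≤ ENNReal.ofReal (A * ((1 / 2) ^ m) ^ κ)) :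
    ∑' m : ℕ, ENNReal.ofReal (2 ^ (m * γ)) * f m ≤
      ENNReal.ofReal (A * (1 - (1 / 2) ^ (κ - γ))⁻¹) := by
  have hlt : ((1 : ℝ) / 2) ^ (κ - γ) < 1 :=
    Real.rpow_lt_one (by norm_num) (by norm_num) (by linarith)
  have hs := hasSum_geometric_of_lt_one (by positivity) hlt
  rw [← (hs.mul_left A).tsum_eq,
    ENNReal.ofReal_tsum_of_nonneg (fun m => by positivity) (hs.mul_left A).summable]
  refine ENNReal.tsum_le_tsum fun m => ?_
  refine (mul_le_mul_right (hf m) _).trans ?_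
  rw [← ENNReal.ofReal_mul (by positivity)]
  refine ENNReal.ofReal_le_ofReal (le_of_eq ?_)
  have e : (2 : ℝ) ^ (m * γ) = (1 / 2) ^ (-(m * γ)) := by
    rw [one_div, Real.inv_rpow (by norm_num), Real.rpow_neg (by norm_num), inv_inv]
  rw [e, ← Real.rpow_natCast, ← Real.rpow_natCast, ← Real.rpow_mul (by norm_num),
    ← Real.rpow_mul (by norm_num), mul_left_comm, ← Real.rpow_add (by norm_num)]
  congr 2; ring

/-- The image of Lebesgue measure on `B` has finite expected γ-energy because γ < κ. The energy
criterion is applied to this measure as a constant sequence. -/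
theorem ae_le_dimH_image {F : Ω → EuclideanSpace ℝ (Fin N) → E}
    (hF : Measurable (Function.uncurry F)) (hFc : ∀ ω, Continuous (F ω))
    {B : Set (EuclideanSpace ℝ (Fin N))} (hB : IsCompact B) (hB0 : volume B ≠ 0)
    {P : Measure Ω} [IsProbabilityMeasure P] {γ κ : ℝ} (hγ0 : 0 < γ) (hγ : γ < κ) {A : ℝ}
    (hA : 0 ≤ A)
    (hP : ∀ m : ℕ, ∀ s ∈ B, ∫⁻ t in B, P {ω | dist (F ω t) (F ω s) ≤ (1 / 2) ^ m} ≤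
      ENNReal.ofReal (A * ((1 / 2) ^ m) ^ κ)) :
    ∀ᵐ ω ∂P, ENNReal.ofReal γ ≤ dimH (F ω '' B) := by
  have hBfin : volume B ≠ ⊤ := hB.measure_lt_top.ne
  have : IsFiniteMeasure ((volume : Measure (EuclideanSpace ℝ (Fin N))).restrict B) :=
    ⟨by rw [Measure.restrict_apply_univ]; exact hB.measure_lt_top⟩
  have hint := lintegral_dyadicEnergy_map hF MeasurableSet.univ (volume.restrict B) γ P
  have hmeas := measurable_dyadicEnergy_map hF MeasurableSet.univ (volume.restrict B) γ
  simp only [mem_univ, true_and, ofPred_true, Measure.restrict_univ] at hint hmeas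
  have hfin : ∫⁻ ω, dyadicEnergy γ ((volume.restrict B).map (F ω)) ∂P ≠ ⊤ := by
    rw [hint]
    refine ne_top_of_le_ne_top ENNReal.ofReal_ne_top
      (tsum_dyadic_le (A := A * (volume B).toReal) hγ (by positivity) fun m => ?_)
    calc ∫⁻ s in B, ∫⁻ t in B, P {ω | dist (F ω t) (F ω s) ≤ (1 / 2) ^ m}
        ≤ ∫⁻ s in B, ENNReal.ofReal (A * ((1 / 2) ^ m) ^ κ) :=
          setLIntegral_mono' hB.measurableSet (hP m)
      _ = _ := by
          rw [setLIntegral_const, mul_right_comm A,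
            ENNReal.ofReal_mul (q := (volume B).toReal) (by positivity),
            ENNReal.ofReal_toReal hBfin]
  filter_upwards [ae_lt_top hmeas hfin] with ω hω
  have hFω : Measurable (F ω) := (hFc ω).measurable
  obtain ⟨c, hc⟩ : ∃ c : ℝ≥0, (c : ℝ≥0∞) = volume B := ⟨_, ENNReal.coe_toNNReal hBfin⟩
  obtain ⟨L, hL⟩ : ∃ L : ℝ≥0, (L : ℝ≥0∞) = dyadicEnergy γ ((volume.restrict B).map (F ω)) :=
    ⟨_, ENNReal.coe_toNNReal hω.ne⟩
  have hc0 : 0 < c := by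
    rw [← hc] at hB0
    exact pos_iff_ne_zero.2 (by exact_mod_cast hB0)
  refine le_dimH_of_dyadicEnergy (hB.image (hFc ω)) (γ := γ.toNNReal) (by simpa using hγ0)
    (fun _ => (volume.restrict B).map (F ω)) (c := c) (L := L) hc0
    (fun U hU hBU => Eventually.of_forall fun _ => ?_)
    (Eventually.of_forall fun _ => ⟨?_, ?_⟩).frequently
  · rw [Measure.map_apply hFω hU.measurableSet.compl,
      Measure.restrict_apply (hFω hU.measurableSet.compl)]
    convert measure_empty (μ := (volume : Measure (EuclideanSpace ℝ (Fin N))))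
    ext t
    simp only [mem_inter_iff, mem_preimage, mem_compl_iff, mem_empty_iff_false, iff_false, not_and]
    exact fun h1 h2 => h1 (hBU (mem_image_of_mem _ h2))
  · rw [Measure.map_apply hFω MeasurableSet.univ, preimage_univ, Measure.restrict_apply_univ, hc]
  · rw [Real.coe_toNNReal _ hγ0.le, hL]

end Energy

/-- The product kernels are meaningful only off the hyperplanes t_j = s_j, where a negative power of
0 would appear; these are null. -/
theorem ae_forall_coord_ne (s : EuclideanSpace ℝ (Fin N)) :
    ∀ᵐ t : EuclideanSpace ℝ (Fin N), ∀ j, s j ≠ t j := by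
  rw [ae_all_iff]
  intro j
  have h := volume_coord_box (N := N) (S := fun i => if i = j then {s j} else univ)
    fun i => by split_ifs <;> simp
  rw [Finset.prod_eq_zero (Finset.mem_univ j) (by simp)] at h
  refine measure_mono_null (fun t ht => ?_) h
  simp only [mem_compl_iff, mem_ofPred_eq, not_not] at ht
  intro i
  split_ifs with hi
  · subst hi; exact ht.symm
  · trivial

/-- Integration of a kernel dominated by a product of powers of the coordinates. -/
theorem exists_setLIntegral_kernel_le {σ : Fin N → ℝ} (hσ : ∀ j, σ j < 1) :
    ∃ C : ℝ, 0 < C ∧ ∀ ρ : ℝ, 0 < ρ → ∀ A : ℝ, 0 ≤ A → ∀ B : Set (EuclideanSpace ℝ (Fin N)),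
      MeasurableSet B → ∀ (s : EuclideanSpace ℝ (Fin N)) (κ : EuclideanSpace ℝ (Fin N) → ℝ≥0∞),
      (∀ t ∈ B, (∀ j, s j ≠ t j) → (∀ j, |s j - t j| ≤ ρ) →
        κ t ≤ ENNReal.ofReal (A * ∏ j, |s j - t j| ^ (-σ j))) →
      (∀ t ∈ B, (∃ j, ρ < |s j - t j|) → κ t = 0) →
      ∫⁻ t in B, κ t ≤ ENNReal.ofReal (A * C * ρ ^ ((N : ℝ) - ∑ j, σ j)) := by
  obtain ⟨C, hC, hCρ⟩ := setLIntegral_cube_prod_rpow hσ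
  refine ⟨C, hC, fun ρ hρ A hA B hB s κ h1 h2 => ?_⟩
  set G : EuclideanSpace ℝ (Fin N) → ℝ≥0∞ := (cube N ρ).indicator fun h =>
    ENNReal.ofReal A * ENNReal.ofReal (∏ j, |h j| ^ (-σ j)) with hG
  calc ∫⁻ t in B, κ t ≤ ∫⁻ t in B, G (s - t) := by
        refine lintegral_mono_ae ((ae_restrict_iff' hB).2 ?_)
        filter_upwards [ae_forall_coord_ne s] with t ht htB
        by_cases hst : ∀ j, |s j - t j| ≤ ρ
        · rw [hG, indicator_of_mem (show s - t ∈ cube N ρ from hst), ← ENNReal.ofReal_mul hA]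
          exact h1 t htB ht hst
        · push Not at hst
          rw [h2 t htB hst]
          exact zero_le
    _ ≤ ∫⁻ t, G (s - t) := setLIntegral_le_lintegral _ _
    _ = ∫⁻ h, G h := lintegral_sub_left_eq_self G s
    _ = ENNReal.ofReal A * ∫⁻ h in cube N ρ, ENNReal.ofReal (∏ j, |h j| ^ (-σ j)) := by
        rw [hG, lintegral_indicator (measurableSet_cube N ρ), lintegral_const_mul]
        exact ENNReal.measurable_ofReal.comp (Finset.measurable_prod _ fun j _ => by fun_prop)
    _ ≤ _ := by
        rw [mul_assoc, ENNReal.ofReal_mul hA]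
        gcongr
        exact hCρ ρ hρ

/-- Split V^(-q/2) as the product of the V^(-w_j/2) and use the j-th lower bound of V in the j-th
factor. The freedom in `w` is what gets optimized. -/
theorem inv_sqrt_rpow_le_prod {c V : ℝ} (hc : 0 < c) {H w : Fin N → ℝ}
    (hw : ∀ j, 0 ≤ w j) {q : ℝ} (hq : ∑ j, w j = q) {h : Fin N → ℝ} (hh : ∀ j, h j ≠ 0)
    (hV : ∀ j, c * |h j| ^ (2 * H j) ≤ V) (hV0 : 0 < V) :
    (1 / √V) ^ q ≤ (1 / √c) ^ q * ∏ j, |h j| ^ (-(H j * w j)) := by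
  rw [← hq, Real.rpow_sum_of_pos (by positivity), Real.rpow_sum_of_pos (by positivity),
    ← Finset.prod_mul_distrib]
  refine Finset.prod_le_prod (fun j _ => by positivity) fun j _ => ?_
  have hj : 0 < |h j| := abs_pos.2 (hh j)
  have e : (1 / √c) ^ w j * |h j| ^ (-(H j * w j)) = (1 / √(c * |h j| ^ (2 * H j))) ^ w j := by
    have e1 : √(c * |h j| ^ (2 * H j)) = √c * |h j| ^ H j := by
      rw [Real.sqrt_mul hc.le, mul_comm 2 (H j), Real.rpow_mul hj.le, Real.rpow_two,
        Real.sqrt_sq (by positivity)]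
    rw [e1, neg_mul_eq_neg_mul, Real.rpow_mul hj.le, ← Real.mul_rpow (by positivity) (by positivity),
      Real.rpow_neg hj.le]
    congr 1
    field_simp
  rw [e]
  have := hV j
  refine Real.rpow_le_rpow (by positivity) ?_ (hw j)
  gcongr

/-- Lower bounds for the variogram near `0`. -/
def VariogramLower (v : EuclideanSpace ℝ (Fin N) → ℝ) (H : Fin N → ℝ) : Prop :=
  ∃ c δ : ℝ, 0 < c ∧ 0 < δ ∧ ∀ h : EuclideanSpace ℝ (Fin N), (∀ j, |h j| ≤ δ) →
    ∀ j, c * |h j| ^ (2 * H j) ≤ v h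

/-- The box `∏ [a, b]`. -/
def coordBox (N : ℕ) (a b : ℝ) : Set (EuclideanSpace ℝ (Fin N)) := {t | ∀ j, t j ∈ Icc a b}

theorem isCompact_coordBox (a b : ℝ) : IsCompact (coordBox N a b) := by
  have h : IsCompact (Set.pi univ fun _ : Fin N => Icc a b) :=
    isCompact_univ_pi fun _ => isCompact_Icc
  have := h.image (PiLp.continuous_toLp 2 fun _ : Fin N => ℝ)
  convert this using 1
  ext t
  simp only [coordBox, mem_ofPred_eq, mem_image, Set.mem_pi, mem_univ, forall_const]
  constructor
  · exact fun h => ⟨t.ofLp, h, rfl⟩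
  · rintro ⟨x, hx, rfl⟩
    exact hx

theorem volume_coordBox_ne_zero {a b : ℝ} (hab : a < b) :
    volume (coordBox N a b) ≠ 0 := by
  rw [coordBox, volume_coord_box fun _ => measurableSet_Icc, Finset.prod_ne_zero_iff]
  intro j _
  rw [Real.volume_Icc]
  simpa using hab

theorem abs_sub_le_of_mem_coordBox {a b : ℝ} {s t : EuclideanSpace ℝ (Fin N)}
    (hs : s ∈ coordBox N a b) (ht : t ∈ coordBox N a b) (j : Fin N) : |s j - t j| ≤ b - a := by
  have h1 := hs j
  have h2 := ht j
  rw [abs_le]; constructor <;> linarith [h1.1, h1.2, h2.1, h2.2]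

theorem abs_coord_sub_le_dist {ι : Type*} [Fintype ι] (x y : EuclideanSpace ℝ ι) (i : ι) :
    |x i - y i| ≤ dist x y := by
  rw [dist_eq_norm]
  exact PiLp.norm_apply_le (x - y) i

namespace IsRegularField

variable {Ω : Type*} [MeasurableSpace Ω] {P : Measure Ω}
  {X : Fin p → EuclideanSpace ℝ (Fin N) → Ω → ℝ} {v : EuclideanSpace ℝ (Fin N) → ℝ}

theorem continuous_path (h : IsRegularField X P v) (ω : Ω) : Continuous (path X ω) :=
  (PiLp.continuous_toLp 2 _).comp (continuous_pi fun i => h.continuous i ω)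

theorem measurable_path (h : IsRegularField X P v) :
    Measurable (Function.uncurry (path X)) := by
  have h1 : Measurable (Function.uncurry fun (t : EuclideanSpace ℝ (Fin N)) (ω : Ω) =>
      path X ω t) := by
    refine measurable_uncurry_of_continuous_of_measurable (fun ω => h.continuous_path ω)
      fun t => ?_
    exact (PiLp.continuous_toLp 2 _).measurable.comp (measurable_pi_lambda _ fun i =>
      h.measurable i t)
  exact h1.comp measurable_swap

theorem measure_increment_le_prod [IsProbabilityMeasure P] (h : IsRegularField X P v)
    (hN : 1 ≤ N) {H : Fin N → ℝ}
    {c δ : ℝ} (hc : 0 < c) (hv : ∀ h : EuclideanSpace ℝ (Fin N), (∀ j, |h j| ≤ δ) →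
      ∀ j, c * |h j| ^ (2 * H j) ≤ v h) {w : Fin N → ℝ} (hw : ∀ j, 0 ≤ w j) {q : ℝ}
    (hq : ∑ j, w j = q) (hqp : q ≤ p) {ρ : ℝ} (hρ : 0 < ρ) {s t : EuclideanSpace ℝ (Fin N)}
    (hst : ∀ j, s j ≠ t j) (hδ : ∀ j, |s j - t j| ≤ δ) :
    P {ω | ∀ i, |X i s ω - X i t ω| ≤ ρ} ≤
      ENNReal.ofReal ((1 / √c) ^ q * ρ ^ q * ∏ j, |s j - t j| ^ (-(H j * w j))) := by
  have hV := hv (s - t) hδ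
  have hV0 : 0 < v (s - t) := by
    have h0 : 0 < |(s - t) ⟨0, hN⟩| := abs_pos.2 (sub_ne_zero.2 (hst _))
    exact lt_of_lt_of_le (by positivity) (hV ⟨0, hN⟩)
  have hq0 : 0 ≤ q := hq ▸ Finset.sum_nonneg fun j _ => hw j
  refine (h.measure_increment_le hV0 hρ hq0 hqp).trans (ENNReal.ofReal_le_ofReal ?_)
  have h1 := inv_sqrt_rpow_le_prod hc hw hq (h := fun j => s j - t j)
    (fun j => sub_ne_zero.2 (hst j)) hV hV0
  rw [div_eq_mul_one_div, Real.mul_rpow hρ.le (by positivity)]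
  calc ρ ^ q * (1 / √(v (s - t))) ^ q
      ≤ ρ ^ q * ((1 / √c) ^ q * ∏ j, |s j - t j| ^ (-(H j * w j))) := by gcongr
    _ = _ := by ring

/-- For q between γ and the target, integrability H_j w_j < 1 alone gives pair probabilities of
order 2^(-mq) after integration over a fixed box. -/
theorem ae_le_dimH_range_aux [IsProbabilityMeasure P] (h : IsRegularField X P v) (hN : 1 ≤ N)
    {H : Fin N → ℝ} (hpos : ∀ j, 0 < H j) (hv : VariogramLower v H) {γ : ℝ} (hγ0 : 0 < γ)
    (hγ : γ < rangeDim p H) :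
    ∀ᵐ ω ∂P, ENNReal.ofReal γ ≤ dimH (path X ω '' unitCube N) := by
  obtain ⟨c, δ, hc, hδ, hv⟩ := hv
  obtain ⟨q, hγq, hqR⟩ := exists_between hγ
  have hqp : q ≤ p := hqR.le.trans (min_le_left _ _)
  obtain ⟨w, hw0, hwq, hw1, -⟩ := exists_weights hpos (hγ0.trans hγq).le
    -- Any number below all the terms serves here: the last conclusion on the weights is discarded.
    (hqR.trans_le (min_le_right _ _)) (η := (⨅ k : Fin N, (∑ j ∈ Finset.Iic k, H k / H j +
      ((N : ℝ) - ((k : ℕ) + 1 : ℝ)) - H k * q)) - 1) fun k =>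
      (sub_one_lt _).trans_le (ciInf_le (Set.finite_range _).bddBelow k)
  obtain ⟨C, hC, hCρ⟩ := exists_setLIntegral_kernel_le hw1
  have hδ' : 0 < min δ 1 := lt_min hδ one_pos
  -- A small subcube suffices by monotonicity, and on it the local lower bound of the variogram is
  -- valid.
  have hsub : coordBox N 0 (min δ 1) ⊆ unitCube N := fun t ht j =>
    ⟨(ht j).1, (ht j).2.trans (min_le_right _ _)⟩
  have hmain := ae_le_dimH_image h.measurable_path h.continuous_path
    (isCompact_coordBox 0 (min δ 1)) (volume_coordBox_ne_zero hδ') (P := P) hγ0 hγq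
    (A := (1 / √c) ^ q * C * (min δ 1) ^ ((N : ℝ) - ∑ j, H j * w j)) (by positivity)
    fun m s hs => ?_
  · filter_upwards [hmain] with ω hω
    exact hω.trans (dimH_mono (image_mono hsub))
  · have := hCρ (min δ 1) hδ' ((1 / √c) ^ q * ((1 / 2) ^ m) ^ q) (by positivity)
      (coordBox N 0 (min δ 1)) (isCompact_coordBox _ _).measurableSet s
      (fun t => P {ω | dist (path X ω t) (path X ω s) ≤ (1 / 2) ^ m})
      (fun t ht hst hd => ?_) (fun t ht hd => ?_)
    · refine this.trans (ENNReal.ofReal_le_ofReal (le_of_eq ?_))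
      ring
    · have hsub' : {ω | dist (path X ω t) (path X ω s) ≤ (1 / 2) ^ m} ⊆
          {ω | ∀ i, |X i s ω - X i t ω| ≤ (1 / 2) ^ m} := fun ω hω i => by
        rw [abs_sub_comm]
        exact (abs_coord_sub_le_dist (path X ω t) (path X ω s) i).trans hω
      exact (measure_mono hsub').trans (h.measure_increment_le_prod hN hc hv hw0
        hwq hqp (by positivity) hst fun j => (hd j).trans (min_le_left _ _))
    · obtain ⟨j, hj⟩ := hd
      have := abs_sub_le_of_mem_coordBox hs ht j
      linarith

/-- Closeness on the graph also forces |s_j - t_j| ≤ 2^(-m). Integrating the kernel over that cube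
adds N - ∑ H_j w_j to the exponent `p`. -/
theorem ae_le_dimH_graph_aux [IsProbabilityMeasure P] (h : IsRegularField X P v) (hN : 1 ≤ N)
    {H : Fin N → ℝ} (hpos : ∀ j, 0 < H j) (hv : VariogramLower v H)
    (hpH : (p : ℝ) < ∑ j, 1 / H j) {γ : ℝ} (hγ0 : 0 < γ) (hγ : γ < p + levelDim p H) :
    ∀ᵐ ω ∂P, ENNReal.ofReal γ ≤ dimH (graphOver (path X ω) (unitCube N)) := by
  obtain ⟨c, δ, hc, hδ, hv⟩ := hv
  obtain ⟨η, hγη, hη⟩ := exists_between (show γ - p < levelDim p H by linarith)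
  obtain ⟨w, hw0, hwq, hw1, hwη⟩ := exists_weights hpos (Nat.cast_nonneg p) hpH (η := η) fun k =>
      hη.trans_le (ciInf_le (Set.finite_range _).bddBelow k)
  obtain ⟨C, hC, hCρ⟩ := exists_setLIntegral_kernel_le hw1
  have hδ' : 0 < min δ 1 := lt_min hδ one_pos
  have hsub : coordBox N 0 (min δ 1) ⊆ unitCube N := fun t ht j =>
    ⟨(ht j).1, (ht j).2.trans (min_le_right _ _)⟩
  have hmain := ae_le_dimH_image (F := fun ω t => (t, path X ω t))
    (measurable_snd.prodMk h.measurable_path)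
    (fun ω => continuous_id.prodMk (h.continuous_path ω))
    (isCompact_coordBox 0 (min δ 1)) (volume_coordBox_ne_zero hδ') (P := P) hγ0
    (κ := p + ((N : ℝ) - ∑ j, H j * w j)) (by linarith)
    (A := (1 / √c) ^ (p : ℝ) * C) (by positivity)
    fun m s hs => ?_
  · filter_upwards [hmain] with ω hω
    refine (hω.trans (dimH_mono (image_mono hsub))).trans ?_
    -- The energy argument uses the sup metric on the product; the Euclidean graph maps onto this
    -- image by a 1-Lipschitz map, so its dimension is at least as large.
    have e : (fun t => (t, path X ω t)) '' unitCube N =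
        WithLp.ofLp '' graphOver (path X ω) (unitCube N) := by
      rw [graphOver, image_image]
    rw [e]
    exact (WithLp.prod_lipschitzWith_ofLp 2 _ _).dimH_image_le _
  · have := hCρ ((1 / 2) ^ m) (by positivity) ((1 / √c) ^ (p : ℝ) * ((1 / 2) ^ m) ^ (p : ℝ))
      (by positivity) (coordBox N 0 (min δ 1)) (isCompact_coordBox _ _).measurableSet s
      (fun t => P {ω | dist (t, path X ω t) (s, path X ω s) ≤ (1 / 2) ^ m})
      (fun t ht hst hd => ?_) (fun t ht hd => ?_)
    · refine this.trans (ENNReal.ofReal_le_ofReal (le_of_eq ?_))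
      rw [Real.rpow_add (by positivity)]
      ring
    · have hsub' : {ω | dist (t, path X ω t) (s, path X ω s) ≤ (1 / 2) ^ m} ⊆
          {ω | ∀ i, |X i s ω - X i t ω| ≤ (1 / 2) ^ m} := fun ω hω i => by
        rw [abs_sub_comm]
        exact (abs_coord_sub_le_dist (path X ω t) (path X ω s) i).trans
          ((le_max_right _ _).trans hω)
      refine (measure_mono hsub').trans (h.measure_increment_le_prod hN hc hv hw0
        hwq le_rfl (by positivity) hst fun j => ?_)
      refine (abs_sub_le_of_mem_coordBox hs ht j).trans ?_
      rw [sub_zero]; exact min_le_left _ _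
    · obtain ⟨j, hj⟩ := hd
      convert measure_empty (μ := P)
      ext ω
      simp only [mem_ofPred_eq, mem_empty_iff_false, iff_false, not_le]
      rw [abs_sub_comm] at hj
      exact hj.trans_le ((abs_coord_sub_le_dist t s j).trans (le_max_left _ _))

theorem _root_.AnisoField.ofReal_le_of_forall_lt {D : ℝ} {y : ℝ≥0∞}
    (h : ∀ m, ENNReal.ofReal (D * nearOne m) ≤ y) : ENNReal.ofReal D ≤ y := by
  have h1 := tendsto_nearOne.const_mul D
  rw [mul_one] at h1
  exact le_of_tendsto' (ENNReal.tendsto_ofReal h1) h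

theorem ae_le_dimH_range [IsProbabilityMeasure P] (h : IsRegularField X P v) (hN : 1 ≤ N)
    {H : Fin N → ℝ} (hpos : ∀ j, 0 < H j) (hv : VariogramLower v H) :
    ∀ᵐ ω ∂P, ENNReal.ofReal (rangeDim p H) ≤ dimH (path X ω '' unitCube N) := by
  rcases le_or_gt (rangeDim p H) 0 with h0 | h0
  · simp [ENNReal.ofReal_of_nonpos h0]
  have := ae_all_iff.2 fun m => h.ae_le_dimH_range_aux hN hpos hv
    (mul_pos h0 (nearOne_pos m)) (mul_lt_of_lt_one_right h0 (nearOne_lt_one m))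
  filter_upwards [this] with ω hω
  exact ofReal_le_of_forall_lt hω

/-- If ∑ 1/H_j ≤ p, the range is a Lipschitz image of the graph and already has the required
dimension. Otherwise the graph formula is at most `p + levelDim p H`, which the energy estimate
reaches. -/
theorem ae_le_dimH_graph [IsProbabilityMeasure P] (h : IsRegularField X P v) (hN : 1 ≤ N)
    {H : Fin N → ℝ} (hpos : ∀ j, 0 < H j) (hv : VariogramLower v H) :
    ∀ᵐ ω ∂P, ENNReal.ofReal (graphDim p H) ≤
      dimH (graphOver (path X ω) (unitCube N)) := by
  rcases le_or_gt (∑ j, 1 / H j) p with hp | hp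
  · filter_upwards [h.ae_le_dimH_range hN hpos hv] with ω hω
    refine (ENNReal.ofReal_le_ofReal ?_).trans (hω.trans ?_)
    · rw [rangeDim, min_eq_right hp]
      exact min_le_right _ _
    · have e : path X ω '' unitCube N =
          Prod.snd '' (WithLp.ofLp '' graphOver (path X ω) (unitCube N)) := by
        rw [graphOver, image_image, image_image]
      rw [e]
      exact (LipschitzWith.prod_snd.dimH_image_le _).trans
        ((WithLp.prod_lipschitzWith_ofLp 2 _ _).dimH_image_le _)
  · have hle : graphDim p H ≤ p + levelDim p H := by
      refine (min_le_left _ _).trans (le_of_eq ?_)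
      have : Nonempty (Fin N) := ⟨⟨0, hN⟩⟩
      rw [levelDim, add_ciInf (Set.finite_range _).bddBelow]
      congr 1
      ext k
      ring
    rcases le_or_gt (graphDim p H) 0 with h0 | h0
    · simp [ENNReal.ofReal_of_nonpos h0]
    have := ae_all_iff.2 fun m => h.ae_le_dimH_graph_aux hN hpos hv hp
      (mul_pos h0 (nearOne_pos m)) ((mul_lt_of_lt_one_right h0 (nearOne_lt_one m)).trans_le hle)
    filter_upwards [this] with ω hω
    exact ofReal_le_of_forall_lt hω

end IsRegularField

end AnisoField

namespace AnisoField

open Filter Topology Metric Set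
open scoped NNReal

variable {N p : ℕ}

/-! ### The second moment method -/

/-- The term m = 0 counts pairs at distance at most 1, which is all of them; so an energy bound is
also a second moment bound for the total mass. -/
theorem measure_univ_sq_le_dyadicEnergy {E : Type*} [PseudoMetricSpace E] [MeasurableSpace E]
    {μ : Measure E} {B : Set E} (hB : μ Bᶜ = 0) (hdiam : ∀ x ∈ B, ∀ y ∈ B, dist x y ≤ 1) (γ : ℝ) :
    μ univ * μ univ ≤ dyadicEnergy γ μ := by
  refine le_trans ?_ (ENNReal.le_tsum 0)
  simp only [Nat.cast_zero, zero_mul, Real.rpow_zero, ENNReal.ofReal_one, one_mul, pow_zero]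
  rw [← lintegral_const]
  refine lintegral_mono_ae ?_
  have : ∀ᵐ x ∂μ, x ∈ B := hB
  filter_upwards [this] with x hx
  refine measure_mono_ae ?_
  filter_upwards [this] with y hy _
  exact hdiam y hy x hx

/-- Three ranges: W < a, then a ≤ W ≤ M, then W ≥ M, where W ≤ W²/M. -/
theorem le_add_indicator_add_sq {W a M : ℝ≥0∞} (hM0 : M ≠ 0) (hM : M ≠ ⊤) :
    W ≤ a + M * {W | a ≤ W}.indicator (fun _ => 1) W + M⁻¹ * (W * W) := by
  by_cases h1 : a ≤ W
  · rw [indicator_of_mem (show W ∈ {W | a ≤ W} from h1), mul_one]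
    rcases le_total W M with h2 | h2
    · exact h2.trans (le_add_right (le_add_left le_rfl))
    · refine le_trans ?_ le_add_self
      calc W = M⁻¹ * (M * W) := by
            rw [← mul_assoc, ENNReal.inv_mul_cancel hM0 hM, one_mul]
        _ ≤ _ := by gcongr
  · exact (not_le.1 h1).le.trans (le_add_right (le_add_right le_rfl))

section SecondMoment

variable {Ω : Type*} [MeasurableSpace Ω] {P : Measure Ω} [IsProbabilityMeasure P]

/-- The Paley–Zygmund inequality. -/
theorem paley_zygmund {W T : Ω → ℝ≥0∞} (hW : Measurable W) {c C : ℝ≥0} (hc : 0 < c) (hC : 0 < C)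
    (h1 : c ≤ ∫⁻ ω, W ω ∂P) (h2 : ∫⁻ ω, T ω ∂P ≤ C) (hWT : ∀ ω, W ω * W ω ≤ T ω) :
    ((c ^ 2 / (16 * C) : ℝ≥0) : ℝ≥0∞) ≤ P {ω | ((c / 2 : ℝ≥0) : ℝ≥0∞) ≤ W ω} := by
  -- Makes the quadratic term C/M equal to c/4; with the truncation at c/2 a quarter of the mean is
  -- left for the event.
  set M : ℝ≥0 := 4 * C / c with hM
  have hM0 : 0 < M := by positivity
  set G := {ω | ((c / 2 : ℝ≥0) : ℝ≥0∞) ≤ W ω} with hG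
  have hGm : MeasurableSet G := measurableSet_le measurable_const hW
  have h3 : ∫⁻ ω, W ω ∂P ≤ ((c / 2 : ℝ≥0) : ℝ≥0∞) + M * P G + (M : ℝ≥0∞)⁻¹ * C := by
    calc ∫⁻ ω, W ω ∂P
        ≤ ∫⁻ ω, (((c / 2 : ℝ≥0) : ℝ≥0∞) + M * G.indicator (fun _ => 1) ω +
            (M : ℝ≥0∞)⁻¹ * T ω) ∂P := by
          refine lintegral_mono fun ω => ?_
          refine (le_add_indicator_add_sq (a := ((c / 2 : ℝ≥0) : ℝ≥0∞)) (M := M)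
            (by exact_mod_cast hM0.ne') ENNReal.coe_ne_top).trans ?_
          exact add_le_add le_rfl (mul_le_mul_right (hWT ω) _)
      _ = ((c / 2 : ℝ≥0) : ℝ≥0∞) + M * P G + (M : ℝ≥0∞)⁻¹ * ∫⁻ ω, T ω ∂P := by
          have hmeas : Measurable fun ω : Ω =>
              ((c / 2 : ℝ≥0) : ℝ≥0∞) + M * G.indicator (fun _ => 1) ω :=
            ((measurable_const.indicator hGm).const_mul _).const_add _
          rw [lintegral_add_left hmeas, lintegral_add_left measurable_const, lintegral_const, measure_univ, mul_one,
            lintegral_const_mul _ (measurable_const.indicator hGm), lintegral_indicator hGm,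
            setLIntegral_one, lintegral_const_mul' _ _
            (ENNReal.inv_ne_top.2 (by exact_mod_cast hM0.ne'))]
      _ ≤ _ := by gcongr
  have h4 := h1.trans h3
  obtain ⟨g, hg⟩ : ∃ g : ℝ≥0, (g : ℝ≥0∞) = P G := ⟨_, ENNReal.coe_toNNReal (measure_ne_top P G)⟩
  rw [← hg, ← ENNReal.coe_inv hM0.ne'] at h4
  rw [← hg]
  norm_cast at h4 ⊢
  have e : M⁻¹ * C = c / 4 := by
    rw [hM]; field_simp
  rw [e] at h4
  have h5 : (c : ℝ) ≤ c / 2 + M * g + c / 4 := by exact_mod_cast h4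
  have h6 : (M : ℝ) = 4 * C / c := by rw [hM]; push_cast; rfl
  have hc' : (0 : ℝ) < c := by exact_mod_cast hc
  have hC' : (0 : ℝ) < C := by exact_mod_cast hC
  rw [← NNReal.coe_le_coe]
  push_cast
  rw [div_le_iff₀ (by positivity)]
  rw [h6] at h5
  have h7 : (4 * C / c * g : ℝ) * c = 4 * C * g := by field_simp
  nlinarith

/-- The limsup is a decreasing intersection of unions, each of probability at least `q`; continuity
from above applies. -/
theorem le_measure_frequently {A : ℕ → Set Ω} (hA : ∀ n, MeasurableSet (A n)) {q : ℝ≥0∞}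
    (hq : ∀ n, q ≤ P (A n)) :
    MeasurableSet {ω | ∃ᶠ n in atTop, ω ∈ A n} ∧ q ≤ P {ω | ∃ᶠ n in atTop, ω ∈ A n} := by
  have e : {ω | ∃ᶠ n in atTop, ω ∈ A n} = ⋂ n, ⋃ m, ⋃ (_ : n ≤ m), A m := by
    ext ω
    simp only [frequently_atTop, mem_ofPred_eq, mem_iInter, mem_iUnion, exists_prop]
  have hm : ∀ n, MeasurableSet (⋃ m, ⋃ (_ : n ≤ m), A m) := fun n =>
    MeasurableSet.iUnion fun m => MeasurableSet.iUnion fun _ => hA m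
  refine ⟨e ▸ MeasurableSet.iInter hm, ?_⟩
  have hanti : Antitone fun n => ⋃ m, ⋃ (_ : n ≤ m), A m := fun a b hab ω hω => by
    simp only [mem_iUnion, exists_prop] at hω ⊢
    obtain ⟨m, hm, hω⟩ := hω
    exact ⟨m, hab.trans hm, hω⟩
  rw [e, hanti.measure_iInter (fun n => (hm n).nullMeasurableSet) ⟨0, measure_ne_top _ _⟩]
  refine le_iInf fun n => (hq n).trans (measure_mono fun ω hω => ?_)
  simp only [mem_iUnion, exists_prop]
  exact ⟨n, le_rfl, hω⟩

/-- A uniform first moment bound from below and moment bounds from above yield an event of positive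
probability on which the variables are frequently controlled. -/
theorem exists_measure_frequently_pos {W : ℕ → Ω → ℝ≥0∞} {T : ℕ → ℕ → Ω → ℝ≥0∞}
    (hW : ∀ n, Measurable (W n)) (hT : ∀ k n, Measurable (T k n)) {c : ℝ≥0} (hc : 0 < c)
    {C : ℕ → ℝ≥0} (h1 : ∀ n, c ≤ ∫⁻ ω, W n ω ∂P) (h2 : ∀ k n, ∫⁻ ω, T k n ω ∂P ≤ C k)
    (hWT : ∀ n ω, W n ω * W n ω ≤ T 0 n ω) :
    ∃ (c' : ℝ≥0) (L : ℕ → ℝ≥0), 0 < c' ∧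
      MeasurableSet {ω | ∃ᶠ n in atTop, c' ≤ W n ω ∧ ∀ k, T k n ω ≤ L k} ∧
      0 < P {ω | ∃ᶠ n in atTop, c' ≤ W n ω ∧ ∀ k, T k n ω ≤ L k} := by
  set D : ℕ → ℝ≥0 := fun k => C k + 1 with hD
  have hD0 : ∀ k, 0 < D k := fun k => by positivity
  have h2' : ∀ k n, ∫⁻ ω, T k n ω ∂P ≤ D k := fun k n =>
    (h2 k n).trans (by exact_mod_cast le_self_add)
  set r : ℝ≥0 := c ^ 2 / (16 * D 0) with hr
  have hr0 : 0 < r := by have := hD0 0; positivity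
  -- By Markov the k-th constraint fails with probability at most (r/4)2^(-k), in total r/2, which
  -- is half of the Paley–Zygmund probability r.
  set L : ℕ → ℝ≥0 := fun k => D k / (r / 2 / 2 * (1 / 2) ^ k) with hL
  have hL0 : ∀ k, 0 < L k := fun k => by have := hD0 k; positivity
  have hsm : ∀ n, MeasurableSet {ω | ((c / 2 : ℝ≥0) : ℝ≥0∞) ≤ W n ω ∧ ∀ k, T k n ω ≤ L k} :=
    fun n => (measurableSet_le measurable_const (hW n)).inter (by
      have e : {ω | ∀ k, T k n ω ≤ L k} = ⋂ k, {ω | T k n ω ≤ L k} := by ext; simp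
      change MeasurableSet {ω | ∀ k, T k n ω ≤ L k}
      rw [e]
      exact MeasurableSet.iInter fun k => measurableSet_le (hT k n) measurable_const)
  have hmain := le_measure_frequently (P := P) (q := ((r / 2 : ℝ≥0) : ℝ≥0∞)) hsm fun n => ?_
  · refine ⟨c / 2, L, by positivity, hmain.1, lt_of_lt_of_le ?_ hmain.2⟩
    exact_mod_cast half_pos hr0
  · have hpz := paley_zygmund (hW n) hc (hD0 0) (h1 n) (h2' 0 n) (hWT n)
    have hbad : P (⋃ k, {ω | (L k : ℝ≥0∞) ≤ T k n ω}) ≤ ((r / 2 : ℝ≥0) : ℝ≥0∞) := by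
      refine (measure_iUnion_le _).trans ?_
      have hk : ∀ k, P {ω | (L k : ℝ≥0∞) ≤ T k n ω} ≤
          ((r / 2 / 2 * (1 / 2) ^ k : ℝ≥0) : ℝ≥0∞) := fun k => by
        refine (meas_ge_le_lintegral_div (hT k n).aemeasurable
          (by exact_mod_cast (hL0 k).ne') ENNReal.coe_ne_top).trans ?_
        refine (ENNReal.div_le_div_right (h2' k n) _).trans ?_
        rw [← ENNReal.coe_div (hL0 k).ne']
        have : D k / L k = r / 2 / 2 * (1 / 2) ^ k := by
          have := (hD0 k).ne'
          rw [hL, div_div_cancel₀ this]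
        rw [this]
      refine (ENNReal.tsum_le_tsum hk).trans ?_
      have hs : HasSum (fun k : ℕ => r / 2 / 2 * (1 / 2 : ℝ≥0) ^ k) (r / 2 / 2 * 2) := by
        refine HasSum.mul_left _ ?_
        rw [← NNReal.hasSum_coe]
        push_cast
        exact hasSum_geometric_two
      rw [← ENNReal.coe_tsum hs.summable, hs.tsum_eq, div_mul_cancel₀ _ two_ne_zero]
    have hsub : {ω | ((c / 2 : ℝ≥0) : ℝ≥0∞) ≤ W n ω} ⊆
        {ω | ((c / 2 : ℝ≥0) : ℝ≥0∞) ≤ W n ω ∧ ∀ k, T k n ω ≤ L k} ∪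
          ⋃ k, {ω | (L k : ℝ≥0∞) ≤ T k n ω} := fun ω hω => by
      by_cases h : ∀ k, T k n ω ≤ L k
      · exact Or.inl ⟨hω, h⟩
      · push Not at h
        obtain ⟨k, hk⟩ := h
        exact Or.inr (mem_iUnion.2 ⟨k, hk.le⟩)
    have h3 := (hpz.trans (measure_mono hsub)).trans
      ((measure_union_le _ _).trans (add_le_add_right hbad _))
    rw [← hr, ← add_halves r, ENNReal.coe_add] at h3
    simp only [add_halves] at h3
    exact (ENNReal.add_le_add_iff_right ENNReal.coe_ne_top).1 h3

end SecondMoment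

end AnisoField

/-! ### Lower bounds for level sets: approximate local times -/

namespace AnisoField

open Filter Topology Metric Set
open scoped NNReal

variable {N p : ℕ}

/-- Asymptotic decorrelation of the values and the increments. -/
def CrossBound (v : EuclideanSpace ℝ (Fin N) → ℝ) : Prop :=
  ∀ m : ℝ, 0 < m → ∃ δ : ℝ, 0 < δ ∧ ∀ s h : EuclideanSpace ℝ (Fin N), m ≤ v s → ‖h‖ ≤ δ → h ≠ 0 →
    (v (s + h) - v s - v h) ^ 2 ≤ 2 * (v s * v h)

section LevelMeasure

variable {Ω : Type*} [MeasurableSpace Ω]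

/-- The pairs `(ω, t)` for which the path at `t` is close to `x`. -/
def nearLevel (X : Fin p → EuclideanSpace ℝ (Fin N) → Ω → ℝ) (x : EuclideanSpace ℝ (Fin p))
    (n : ℕ) : Set (Ω × EuclideanSpace ℝ (Fin N)) :=
  {q | ∀ i, |X i q.2 q.1 - x i| ≤ (1 / 2) ^ n}

/-- Lebesgue measure on `B`, scaled by `2^{np}`. -/
noncomputable def scaledVolume (p : ℕ) (B : Set (EuclideanSpace ℝ (Fin N))) (n : ℕ) :
    Measure (EuclideanSpace ℝ (Fin N)) :=
  ENNReal.ofReal ((2 ^ n) ^ p) • volume.restrict B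

/-- Approximate local times. -/
noncomputable def levelMeasure (X : Fin p → EuclideanSpace ℝ (Fin N) → Ω → ℝ)
    (x : EuclideanSpace ℝ (Fin p)) (B : Set (EuclideanSpace ℝ (Fin N))) (n : ℕ) (ω : Ω) :
    Measure (EuclideanSpace ℝ (Fin N)) :=
  (scaledVolume p B n).restrict {t | (ω, t) ∈ nearLevel X x n}

theorem isFiniteMeasure_scaledVolume {B : Set (EuclideanSpace ℝ (Fin N))} (hB : IsCompact B)
    (n : ℕ) : IsFiniteMeasure (scaledVolume p B n) := by
  refine ⟨?_⟩
  rw [scaledVolume, Measure.smul_apply, Measure.restrict_apply_univ, smul_eq_mul]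
  exact ENNReal.mul_lt_top ENNReal.ofReal_lt_top hB.measure_lt_top

end LevelMeasure

namespace IsRegularField

variable {Ω : Type*} [MeasurableSpace Ω] {P : Measure Ω}
  {X : Fin p → EuclideanSpace ℝ (Fin N) → Ω → ℝ} {v : EuclideanSpace ℝ (Fin N) → ℝ}

theorem measurableSet_nearLevel (h : IsRegularField X P v) (x : EuclideanSpace ℝ (Fin p))
    (n : ℕ) : MeasurableSet (nearLevel X x n) := by
  have e : nearLevel X x n = ⋂ i, {q : Ω × EuclideanSpace ℝ (Fin N) |
      |Function.uncurry (path X) q i - x i| ≤ (1 / 2) ^ n} := by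
    ext q; simp [nearLevel, path, Function.uncurry]
  rw [e]
  refine MeasurableSet.iInter fun i => measurableSet_le ?_ measurable_const
  have hi : Measurable fun q : Ω × EuclideanSpace ℝ (Fin N) =>
      Function.uncurry (path X) q i :=
    (EuclideanSpace.proj (𝕜 := ℝ) i).continuous.measurable.comp h.measurable_path
  exact (hi.sub measurable_const).abs

/-- A box based at (1, …, 1) avoids the origin, so variances are bounded above and below. There the
correlation bound reduces two-point probabilities to one-point ones times small-ball factors of the
increment. -/
theorem exists_box [IsProbabilityMeasure P] (h : IsRegularField X P v) (hN : 1 ≤ N)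
    {H : Fin N → ℝ} (hv : VariogramLower v H) (hvc : Continuous v)
    (hv0 : ∀ t, t ≠ 0 → 0 < v t) (hcross : CrossBound v) (x : EuclideanSpace ℝ (Fin p)) :
    ∃ δ w₀ w₁ D : ℝ, 0 < δ ∧ 0 < w₀ ∧ w₀ ≤ w₁ ∧ 0 < D ∧
      (∀ t ∈ coordBox N 1 (1 + δ), w₀ ≤ v t ∧ v t ≤ w₁) ∧
      (∀ s ∈ coordBox N 1 (1 + δ), ∀ t ∈ coordBox N 1 (1 + δ), dist s t ≤ 1) ∧
      ∀ w : Fin N → ℝ, (∀ j, 0 ≤ w j) → ∑ j, w j = p → ∀ s ∈ coordBox N 1 (1 + δ),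
        ∀ t ∈ coordBox N 1 (1 + δ), (∀ j, s j ≠ t j) → ∀ u : ℝ, 0 ≤ u →
        P {ω | ∀ i, |X i s ω - x i| ≤ u ∧ |X i t ω - x i| ≤ u} ≤
          ENNReal.ofReal (D * (u ^ p * u ^ p) * ∏ j, |s j - t j| ^ (-(H j * w j))) := by
  obtain ⟨c, δ₁, hc, hδ₁, hv⟩ := hv
  have hK := isCompact_coordBox (N := N) 1 2
  have hKne : (coordBox N 1 2).Nonempty :=
    ⟨WithLp.toLp 2 fun _ => 1, fun j => ⟨le_rfl, one_le_two⟩⟩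
  obtain ⟨t₀, ht₀, hmin⟩ := hK.exists_isMinOn hKne hvc.continuousOn
  obtain ⟨t₁, ht₁, hmax⟩ := hK.exists_isMaxOn hKne hvc.continuousOn
  have ht₀0 : t₀ ≠ 0 := fun h0 => by
    have := (ht₀ ⟨0, hN⟩).1
    rw [h0] at this
    norm_num at this
  have hw₀ := hv0 t₀ ht₀0
  obtain ⟨δ₂, hδ₂, hcr⟩ := hcross (v t₀) hw₀
  have hNpos : (0 : ℝ) < N := by exact_mod_cast hN
  -- The four constraints: validity of the variogram bound, containment in [1,2]^N, validity of the
  -- correlation bound, diameter at most 1.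
  obtain ⟨δ, hδ⟩ : ∃ δ, δ = min (min δ₁ 1) (min (δ₂ / N) (1 / N)) := ⟨_, rfl⟩
  have hδ0 : 0 < δ := by rw [hδ]; positivity
  have hδδ₁ : δ ≤ δ₁ := hδ ▸ (min_le_left _ _).trans (min_le_left _ _)
  have hδ1 : δ ≤ 1 := hδ ▸ (min_le_left _ _).trans (min_le_right _ _)
  have hδδ₂ : N * δ ≤ δ₂ := by
    have : δ ≤ δ₂ / N := hδ ▸ (min_le_right _ _).trans (min_le_left _ _)
    rw [le_div_iff₀ hNpos] at this; linarith
  have hδN : N * δ ≤ 1 := by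
    have : δ ≤ 1 / N := hδ ▸ (min_le_right _ _).trans (min_le_right _ _)
    rw [le_div_iff₀ hNpos] at this; linarith
  have hsub : coordBox N 1 (1 + δ) ⊆ coordBox N 1 2 := fun t ht j =>
    ⟨(ht j).1, (ht j).2.trans (by linarith)⟩
  have hdist : ∀ s ∈ coordBox N 1 (1 + δ), ∀ t ∈ coordBox N 1 (1 + δ), dist s t ≤ N * δ :=
    fun s hs t ht => by
      refine (dist_le_sum_abs s t).trans ?_
      refine (Finset.sum_le_sum fun j _ => abs_sub_le_of_mem_coordBox hs ht j).trans ?_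
      simp
  refine ⟨δ, v t₀, v t₁, (√2 / √(v t₀)) ^ p * (1 / √c) ^ (p : ℝ), hδ0, hw₀, hmin ht₁,
    by positivity, fun t ht => ⟨hmin (hsub ht), hmax (hsub ht)⟩,
    fun s hs t ht => (hdist s hs t ht).trans hδN, fun w hw hwp s hs t ht hst u hu => ?_⟩
  have hne : t - s ≠ 0 := fun h0 => by
    have := congrArg (fun y : EuclideanSpace ℝ (Fin N) => y ⟨0, hN⟩) h0
    exact hst ⟨0, hN⟩ (sub_eq_zero.1 this).symm
  have hV0 := hv0 _ hne
  have hvs : v t₀ ≤ v s := hmin (hsub hs)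
  have hcr' := hcr s (t - s) hvs
    (by rw [← dist_eq_norm]; exact (hdist t ht s hs).trans hδδ₂) hne
  rw [add_sub_cancel] at hcr'
  refine (h.measure_two_values_le (hw₀.trans_le hvs) hV0 hcr' x hu).trans
    (ENNReal.ofReal_le_ofReal ?_)
  have hV : ∀ j, c * |s j - t j| ^ (2 * H j) ≤ v (t - s) := fun j => by
    rw [abs_sub_comm]
    refine hv (t - s) (fun i => ?_) j
    exact (abs_sub_le_of_mem_coordBox ht hs i).trans (by linarith)
  have hprod := inv_sqrt_rpow_le_prod hc hw hwp (h := fun j => s j - t j)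
    (fun j => sub_ne_zero.2 (hst j)) hV hV0
  calc (u / √(v s) * (u / √(v (t - s) / 2))) ^ p
      ≤ (u / √(v t₀) * (u / √(v (t - s) / 2))) ^ p := by gcongr
    _ = (√2 / √(v t₀)) ^ p * (u ^ p * u ^ p) * (1 / √(v (t - s))) ^ (p : ℝ) := by
        rw [Real.rpow_natCast, ← mul_pow, ← mul_pow, ← mul_pow, Real.sqrt_div' _ zero_le_two]
        congr 1
        have := Real.sqrt_pos.2 hV0
        field_simp
    _ ≤ (√2 / √(v t₀)) ^ p * (u ^ p * u ^ p) *
        ((1 / √c) ^ (p : ℝ) * ∏ j, |s j - t j| ^ (-(H j * w j))) := by gcongr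
    _ = _ := by ring

theorem measurable_dyadicEnergy_levelMeasure (h : IsRegularField X P v)
    (x : EuclideanSpace ℝ (Fin p)) {B : Set (EuclideanSpace ℝ (Fin N))} (hB : IsCompact B) (n : ℕ)
    (γ : ℝ) : Measurable fun ω => dyadicEnergy γ (levelMeasure X x B n ω) := by
  have := isFiniteMeasure_scaledVolume (p := p) hB n
  have := measurable_dyadicEnergy_map (F := fun (_ : Ω) (t : EuclideanSpace ℝ (Fin N)) => t)
    measurable_snd (h.measurableSet_nearLevel x n) (scaledVolume p B n) γ
  simp only [Measure.map_id'] at this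
  exact this

/-- The two normalizations 2^(np) cancel the factor (2^(-n))^(2p) of the two-point bound, so the
estimate is uniform in n. Restricting to |s_j - t_j| ≤ 2^(-m) yields the decay needed for γ. -/
theorem lintegral_dyadicEnergy_levelMeasure_le [IsProbabilityMeasure P]
    (h : IsRegularField X P v) (x : EuclideanSpace ℝ (Fin p))
    {B : Set (EuclideanSpace ℝ (Fin N))} (hB : IsCompact B) {σ : Fin N → ℝ} (hσ : ∀ j, σ j < 1)
    {D : ℝ} (hD : 0 < D) (htwo : ∀ s ∈ B, ∀ t ∈ B, (∀ j, s j ≠ t j) → ∀ u : ℝ, 0 ≤ u →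
      P {ω | ∀ i, |X i s ω - x i| ≤ u ∧ |X i t ω - x i| ≤ u} ≤
        ENNReal.ofReal (D * (u ^ p * u ^ p) * ∏ j, |s j - t j| ^ (-σ j)))
    {γ : ℝ} (hγ : γ < N - ∑ j, σ j) :
    ∃ C : ℝ≥0, ∀ n, ∫⁻ ω, dyadicEnergy γ (levelMeasure X x B n ω) ∂P ≤ C := by
  obtain ⟨C, hC, hCρ⟩ := exists_setLIntegral_kernel_le hσ
  obtain ⟨V, hV⟩ : ∃ V, V = (volume B).toReal := ⟨_, rfl⟩
  have hVB : ENNReal.ofReal V = volume B := by rw [hV, ENNReal.ofReal_toReal hB.measure_lt_top.ne]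
  have hV0 : 0 ≤ V := hV ▸ ENNReal.toReal_nonneg
  refine ⟨(D * C * V * (1 - (1 / 2) ^ ((N - ∑ j, σ j) - γ))⁻¹).toNNReal, fun n => ?_⟩
  have := isFiniteMeasure_scaledVolume (p := p) hB n
  have heq := lintegral_dyadicEnergy_map
    (F := fun (_ : Ω) (t : EuclideanSpace ℝ (Fin N)) => t)
    measurable_snd (h.measurableSet_nearLevel x n) (scaledVolume p B n) γ P
  simp only [Measure.map_id'] at heq
  change ∫⁻ ω, dyadicEnergy γ ((scaledVolume p B n).restrict _) ∂P ≤ ENNReal.ofReal _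
  rw [heq]
  refine tsum_dyadic_le hγ (by positivity) fun m => ?_
  obtain ⟨κ, hκ⟩ : ∃ κ, κ = (N : ℝ) - ∑ j, σ j := ⟨_, rfl⟩
  have hinner : ∀ s ∈ B, ∫⁻ t in B, P {ω | (ω, s) ∈ nearLevel X x n ∧ (ω, t) ∈ nearLevel X x n ∧
      dist t s ≤ (1 / 2) ^ m} ≤
      ENNReal.ofReal (D * (((1 / 2) ^ n) ^ p * ((1 / 2) ^ n) ^ p) * C * ((1 / 2) ^ m) ^ κ) := by
    intro s hs
    rw [hκ]
    refine hCρ ((1 / 2) ^ m) (by positivity) _ (by positivity) B hB.measurableSet s _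
      (fun t ht hst _ => ?_) (fun t ht hd => ?_)
    · refine le_trans ?_ (htwo s hs t ht hst ((1 / 2) ^ n) (by positivity))
      exact measure_mono fun ω hω i => ⟨hω.1 i, hω.2.1 i⟩
    · obtain ⟨j, hj⟩ := hd
      convert measure_empty (μ := P)
      ext ω
      simp only [mem_ofPred_eq, mem_empty_iff_false, iff_false, not_and, not_le]
      intro _ _
      rw [abs_sub_comm] at hj
      exact hj.trans_le (abs_coord_sub_le_dist t s j)
  rw [← hκ]
  simp only [scaledVolume, lintegral_smul_measure, smul_eq_mul]
  calc _ ≤ ENNReal.ofReal ((2 ^ n) ^ p) * ∫⁻ s in B, ENNReal.ofReal ((2 ^ n) ^ p) *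
        ENNReal.ofReal (D * (((1 / 2) ^ n) ^ p * ((1 / 2) ^ n) ^ p) * C * ((1 / 2) ^ m) ^ κ) := by
        refine mul_le_mul_right (setLIntegral_mono' hB.measurableSet fun s hs => ?_) _
        exact mul_le_mul_right (hinner s hs) _
    _ = _ := by
        rw [setLIntegral_const, ← hVB, ← ENNReal.ofReal_mul (by positivity),
          ← ENNReal.ofReal_mul (by positivity), ← ENNReal.ofReal_mul (by positivity)]
        congr 1
        have e : ((2 : ℝ) ^ n) ^ p * ((1 / 2) ^ n) ^ p = 1 := by
          rw [← mul_pow, ← mul_pow]; norm_num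
        calc _ = (((2 : ℝ) ^ n) ^ p * ((1 / 2) ^ n) ^ p) *
              (((2 : ℝ) ^ n) ^ p * ((1 / 2) ^ n) ^ p) * (D * C * V * ((1 / 2) ^ m) ^ κ) := by ring
          _ = _ := by rw [e]; ring

/-- Densities near `x` are bounded below on `B`, so the one-point probability (2^(-n))^p cancels the
normalization. -/
theorem exists_le_lintegral_levelMeasure [IsProbabilityMeasure P] (h : IsRegularField X P v)
    (x : EuclideanSpace ℝ (Fin p)) {B : Set (EuclideanSpace ℝ (Fin N))} (hB : IsCompact B)
    (hB0 : volume B ≠ 0) {w₀ w₁ : ℝ} (hw₀ : 0 < w₀) (hw₁ : w₀ ≤ w₁)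
    (hBv : ∀ t ∈ B, w₀ ≤ v t ∧ v t ≤ w₁) :
    ∃ c : ℝ≥0, 0 < c ∧ ∀ n, c ≤ ∫⁻ ω, levelMeasure X x B n ω univ ∂P := by
  obtain ⟨c, hc, hcP⟩ := h.exists_le_measure_value hw₀ hw₁ x
  obtain ⟨V, hV⟩ : ∃ V : ℝ≥0, (V : ℝ≥0∞) = volume B :=
    ⟨_, ENNReal.coe_toNNReal hB.measure_lt_top.ne⟩
  have hV0 : 0 < V := by
    rw [← hV] at hB0
    exact pos_iff_ne_zero.2 (by exact_mod_cast hB0)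
  refine ⟨c.toNNReal * V, by positivity, fun n => ?_⟩
  have := isFiniteMeasure_scaledVolume (p := p) hB n
  have hA := h.measurableSet_nearLevel x n
  have e : ∀ ω, levelMeasure X x B n ω univ =
      scaledVolume p B n (Prod.mk ω ⁻¹' nearLevel X x n) := fun ω => by
    rw [levelMeasure, Measure.restrict_apply_univ]; rfl
  simp_rw [e]
  rw [← Measure.prod_apply hA, Measure.prod_apply_symm hA, scaledVolume, lintegral_smul_measure,
    smul_eq_mul]
  calc ((c.toNNReal * V : ℝ≥0) : ℝ≥0∞)
      = ENNReal.ofReal ((2 ^ n) ^ p) *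
          ∫⁻ t in B, ENNReal.ofReal (c * ((1 / 2) ^ n) ^ p) := by
        rw [setLIntegral_const, ← hV, ← mul_assoc, ← ENNReal.ofReal_mul (by positivity)]
        have e : ((2 : ℝ) ^ n) ^ p * (c * ((1 / 2) ^ n) ^ p) = c := by
          rw [mul_left_comm, ← mul_pow, ← mul_pow]; norm_num
        rw [e, ENNReal.coe_mul]; rfl
    _ ≤ _ := by
        refine mul_le_mul_right (setLIntegral_mono' hB.measurableSet fun t ht => ?_) _
        exact hcP t _ (hBv t ht).1 (hBv t ht).2 (by positivity)
          (pow_le_one₀ (by norm_num) (by norm_num))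

/-- On the compact set `B \ U` the path stays at a positive distance from `x`, so once p·2^(-n) is
smaller no near-level point is left there. -/
theorem eventually_levelMeasure_compl_eq_zero (h : IsRegularField X P v)
    (x : EuclideanSpace ℝ (Fin p)) {B : Set (EuclideanSpace ℝ (Fin N))} (hB : IsCompact B) (ω : Ω)
    {U : Set (EuclideanSpace ℝ (Fin N))} (hU : IsOpen U)
    (hBU : {t | t ∈ B ∧ path X ω t = x} ⊆ U) :
    ∀ᶠ n in atTop, levelMeasure X x B n ω Uᶜ = 0 := by
  have hcomp : IsCompact (B \ U) := hB.diff hU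
  obtain ⟨η, hη, hηB⟩ : ∃ η : ℝ, 0 < η ∧ ∀ t ∈ B \ U, η ≤ dist (path X ω t) x := by
    rcases (B \ U).eq_empty_or_nonempty with he | hne
    · exact ⟨1, one_pos, by simp [he]⟩
    · have hcont : Continuous fun t => dist (path X ω t) x :=
        (h.continuous_path ω).dist continuous_const
      obtain ⟨t₀, ht₀, hmin⟩ := hcomp.exists_isMinOn hne hcont.continuousOn
      refine ⟨_, dist_pos.2 fun h0 => ht₀.2 (hBU ⟨ht₀.1, h0⟩), fun t ht => hmin ht⟩
  have hlim : Tendsto (fun n : ℕ => (p : ℝ) * (1 / 2 : ℝ) ^ n) atTop (𝓝 (p * 0)) :=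
    (tendsto_pow_atTop_nhds_zero_of_lt_one (by norm_num) (by norm_num)).const_mul _
  rw [mul_zero] at hlim
  filter_upwards [hlim.eventually (Iio_mem_nhds hη)] with n hn
  have hUm : MeasurableSet Uᶜ := hU.measurableSet.compl
  have hS : MeasurableSet {t | (ω, t) ∈ nearLevel X x n} :=
    measurable_prodMk_left (h.measurableSet_nearLevel x n)
  rw [levelMeasure, Measure.restrict_apply hUm, scaledVolume, Measure.smul_apply,
    Measure.restrict_apply (hUm.inter hS), smul_eq_mul]
  convert mul_zero _
  convert measure_empty (μ := (volume : Measure (EuclideanSpace ℝ (Fin N))))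
  ext t
  simp only [mem_inter_iff, mem_compl_iff, mem_ofPred_eq, mem_empty_iff_false, iff_false, not_and]
  rintro ⟨htU, ht⟩ htB
  have h1 := hηB t ⟨htB, htU⟩
  have h2 : dist (path X ω t) x ≤ p * (1 / 2) ^ n := by
    refine (dist_le_sum_abs _ _).trans ?_
    calc ∑ i, |path X ω t i - x i| ≤ ∑ i : Fin p, (1 / 2 : ℝ) ^ n :=
          Finset.sum_le_sum fun i _ => ht i
      _ = _ := by simp
  exact absurd (h1.trans h2) (not_le.2 hn)

/-- Lower bound for the dimension of level sets, with positive probability. -/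
theorem exists_le_dimH_level [IsProbabilityMeasure P] (h : IsRegularField X P v) (hN : 1 ≤ N)
    {H : Fin N → ℝ} (hpos : ∀ j, 0 < H j) (hv : VariogramLower v H) (hvc : Continuous v)
    (hv0 : ∀ t, t ≠ 0 → 0 < v t) (hcross : CrossBound v) (hpH : (p : ℝ) < ∑ j, 1 / H j)
    (x : EuclideanSpace ℝ (Fin p)) :
    ∃ A : Set Ω, MeasurableSet A ∧ 0 < P A ∧
      ∀ ω ∈ A, ENNReal.ofReal (levelDim p H) ≤ dimH {t | path X ω t = x} := by
  -- A nonpositive value is truncated to 0 by `ENNReal.ofReal`, and then the whole space serves as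
  -- event.
  rcases le_or_gt (levelDim p H) 0 with h0 | h0
  · exact ⟨univ, MeasurableSet.univ, by simp, fun ω _ => by simp [ENNReal.ofReal_of_nonpos h0]⟩
  obtain ⟨δ, w₀, w₁, D, hδ, hw₀, hw₁, hD, hBv, hBd, htwo⟩ :=
    h.exists_box hN hv hvc hv0 hcross x
  obtain ⟨B, hB⟩ : ∃ B, B = coordBox N 1 (1 + δ) := ⟨_, rfl⟩
  rw [← hB] at hBv hBd htwo
  have hBc : IsCompact B := hB ▸ isCompact_coordBox _ _
  have hB0 : volume B ≠ 0 := hB ▸ volume_coordBox_ne_zero (by linarith)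
  obtain ⟨c, hc, hcW⟩ := h.exists_le_lintegral_levelMeasure x hBc hB0 hw₀ hw₁ hBv
  have hC : ∀ k, ∃ C : ℝ≥0, ∀ n, ∫⁻ ω, dyadicEnergy (levelDim p H * nearOne k)
      (levelMeasure X x B n ω) ∂P ≤ C := fun k => by
    obtain ⟨η, hγη, hη⟩ := exists_between (mul_lt_of_lt_one_right h0 (nearOne_lt_one k))
    obtain ⟨w, hw0, hwq, hw1, hwη⟩ := exists_weights hpos (Nat.cast_nonneg p) hpH (η := η)
      fun k => hη.trans_le (ciInf_le (Set.finite_range _).bddBelow k)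
    exact h.lintegral_dyadicEnergy_levelMeasure_le x hBc hw1 hD (htwo w hw0 hwq)
      (hγη.trans_le hwη)
  choose C hC using hC
  have hfin : ∀ n, IsFiniteMeasure (scaledVolume p B n) := fun n =>
    isFiniteMeasure_scaledVolume hBc n
  have hWm : ∀ n, Measurable fun ω => levelMeasure X x B n ω univ := fun n => by
    simp only [levelMeasure, Measure.restrict_apply_univ]
    exact measurable_measure_prodMk_left (h.measurableSet_nearLevel x n)
  -- All exponents `levelDim p H * nearOne k` are controlled simultaneously on one event, which
  -- gives the full dimension there. The energy with k = 0 bounds the squared mass.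
  obtain ⟨c', L, hc', hAm, hA0⟩ := exists_measure_frequently_pos hWm
    (T := fun k n ω => dyadicEnergy (levelDim p H * nearOne k) (levelMeasure X x B n ω))
    (fun k n => h.measurable_dyadicEnergy_levelMeasure x hBc n _) hc hcW hC
    (fun n ω => measure_univ_sq_le_dyadicEnergy (B := B) (by
      rw [levelMeasure]
      refine measure_mono_null (subset_refl _)
        (Measure.absolutelyContinuous_of_le Measure.restrict_le_self ?_)
      rw [scaledVolume, Measure.smul_apply, Measure.restrict_apply hBc.measurableSet.compl]
      simp) hBd _)
  refine ⟨_, hAm, hA0, fun ω hω => ?_⟩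
  refine ofReal_le_of_forall_lt fun k => ?_
  have hγ0 : 0 < levelDim p H * nearOne k := mul_pos h0 (nearOne_pos k)
  have hK : IsCompact {t | t ∈ B ∧ path X ω t = x} :=
    hBc.inter_right (isClosed_eq (h.continuous_path ω) continuous_const)
  have hfin' : ∀ n, IsFiniteMeasure (levelMeasure X x B n ω) := fun n => by
    rw [levelMeasure]; infer_instance
  refine le_trans ?_ (dimH_mono fun t ht => ht.2 : dimH {t | t ∈ B ∧ path X ω t = x} ≤ _)
  refine le_dimH_of_dyadicEnergy hK (γ := (levelDim p H * nearOne k).toNNReal) (by simpa using hγ0)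
    (fun n => levelMeasure X x B n ω) (c := c') (L := L k) hc'
    (fun U hU hBU => h.eventually_levelMeasure_compl_eq_zero x hBc ω hU hBU)
    (Frequently.mono hω fun n hn => ⟨hn.1, ?_⟩)
  rw [Real.coe_toNNReal _ hγ0.le]
  exact hn.2 k

end IsRegularField

end AnisoField

namespace AnisoField

open Filter Topology Metric Set
open scoped NNReal

variable {N p : ℕ}

/-! ### Regular versions -/

/-- Polarization: with z = e^(ia) - 1 and w = e^(ib) - 1, twice the real part of z times the
conjugate of w is |z|² + |w|² - |z - w|², and |z - w| = |e^(i(a-b)) - 1|. -/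
theorem re_spectralKernel (s t ξ : EuclideanSpace ℝ (Fin N)) :
    ((Complex.exp (Complex.I * (inner ℝ s ξ : ℝ)) - 1) *
      (Complex.exp (-(Complex.I * (inner ℝ t ξ : ℝ))) - 1)).re =
      (vkernel s ξ + vkernel t ξ - vkernel (s - t) ξ) / 2 := by
  have h : ∀ a : ℝ, Complex.exp (Complex.I * a) = ⟨Real.cos a, Real.sin a⟩ := fun a => by
    rw [mul_comm]
    apply Complex.ext
    · exact Complex.exp_ofReal_mul_I_re a
    · exact Complex.exp_ofReal_mul_I_im a
  have h2 : Complex.exp (-(Complex.I * (inner ℝ t ξ : ℝ))) =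
      ⟨Real.cos (inner ℝ t ξ), -Real.sin (inner ℝ t ξ)⟩ := by
    rw [← mul_neg, ← Complex.ofReal_neg, h, Real.cos_neg, Real.sin_neg]
  rw [h, h2]
  simp only [Complex.mul_re, Complex.sub_re, Complex.one_re, Complex.sub_im, Complex.one_im,
    vkernel, inner_sub_left, Real.cos_sub]
  ring

theorem norm_spectralKernel_le (s t ξ : EuclideanSpace ℝ (Fin N)) :
    ‖(Complex.exp (Complex.I * (inner ℝ s ξ : ℝ)) - 1) *
      (Complex.exp (-(Complex.I * (inner ℝ t ξ : ℝ))) - 1)‖ ≤ vkernel s ξ + vkernel t ξ := by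
  have h : ∀ x : ℝ, ‖Complex.exp (Complex.I * x) - 1‖ ^ 2 = 2 * (1 - Real.cos x) := fun x => by
    rw [Complex.norm_exp_I_mul_ofReal_sub_one, Real.norm_eq_abs, sq_abs, mul_pow, Real.sin_sq_eq_half_sub]
    ring_nf
  have h2 : Complex.exp (-(Complex.I * (inner ℝ t ξ : ℝ))) =
      Complex.exp (Complex.I * ((-(inner ℝ t ξ) : ℝ) : ℂ)) := by
    push_cast; ring_nf
  rw [norm_mul, h2]
  have e1 := h (inner ℝ s ξ)
  have e2 := h (-(inner ℝ t ξ))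
  rw [Real.cos_neg] at e2
  have e1' : vkernel s ξ = _ := e1.symm
  have e2' : vkernel t ξ = _ := e2.symm
  rw [e1', e2']
  have h3 := norm_nonneg (Complex.exp (Complex.I * (inner ℝ s ξ : ℝ)) - 1)
  have h4 := norm_nonneg (Complex.exp (Complex.I * ((-(inner ℝ t ξ) : ℝ) : ℂ)) - 1)
  nlinarith [sq_nonneg (‖Complex.exp (Complex.I * (inner ℝ s ξ : ℝ)) - 1‖ -
    ‖Complex.exp (Complex.I * ((-(inner ℝ t ξ) : ℝ) : ℂ)) - 1‖)]

/-- Real parts of the spectral formula suffice, since the covariance is real. From here on the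
density enters only through its variogram. -/
theorem IsSIGaussianField.integral_mul_eq {Ω : Type*} [MeasurableSpace Ω]
    {Y : EuclideanSpace ℝ (Fin N) → Ω → ℝ} {P : Measure Ω} {f : EuclideanSpace ℝ (Fin N) → ℝ}
    (hY : IsSIGaussianField Y P f) (s t : EuclideanSpace ℝ (Fin N)) :
    ∫ ω, Y s ω * Y t ω ∂P = (variogram f s + variogram f t - variogram f (s - t)) / 2 := by
  have hi := hY.density.integrable_vkernel
  have hint : Integrable (fun ξ => (Complex.exp (Complex.I * (inner ℝ s ξ : ℝ)) - 1) *
      (Complex.exp (-(Complex.I * (inner ℝ t ξ : ℝ))) - 1)) (spectralMeasure f) := by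
    refine ((hi s).add (hi t)).mono' ?_ (ae_of_all _ fun ξ => norm_spectralKernel_le s t ξ)
    exact Continuous.aestronglyMeasurable (by fun_prop)
  have h := congrArg Complex.re (hY.covariance s t)
  rw [Complex.ofReal_re] at h
  have h2 := integral_re hint
  simp only [RCLike.re_to_complex] at h2
  rw [h, ← h2]
  simp_rw [re_spectralKernel]
  rw [integral_div]
  have e1 := integral_sub ((hi s).add (hi t)) (hi (s - t))
  have e2 := integral_add (hi s) (hi t)
  simp only [Pi.add_apply] at e1 e2
  rw [e1, e2]
  rfl

theorem variogram_zero (f : EuclideanSpace ℝ (Fin N) → ℝ) : variogram f 0 = 0 := by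
  simp [variogram, vkernel]

theorem variogram_neg (f : EuclideanSpace ℝ (Fin N) → ℝ) (t : EuclideanSpace ℝ (Fin N)) :
    variogram f (-t) = variogram f t := by
  simp [variogram, vkernel]

/-- Independent copies with almost surely continuous paths agree, on an almost sure event, with a
regular field. -/
theorem IsIndependentCopies.exists_regular {Ω Ω' : Type*} [MeasurableSpace Ω]
    [MeasurableSpace Ω'] {P : Measure Ω} [IsProbabilityMeasure P] {P' : Measure Ω'}
    {f : EuclideanSpace ℝ (Fin N) → ℝ} {Y : EuclideanSpace ℝ (Fin N) → Ω' → ℝ}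
    (hY : IsSIGaussianField Y P' f) {X : Fin p → EuclideanSpace ℝ (Fin N) → Ω → ℝ}
    (hX : IsIndependentCopies X P Y P') (hcont : ∀ i, ∀ᵐ ω ∂P, Continuous fun t => X i t ω) :
    ∃ (Z : Fin p → EuclideanSpace ℝ (Fin N) → Ω → ℝ) (G : Set Ω), IsRegularField Z P (variogram f) ∧
      MeasurableSet G ∧ P Gᶜ = 0 ∧ ∀ ω ∈ G, path Z ω = path X ω := by
  have hm := fun i => (hX.identDistrib i).aemeasurable_fst
  have hae : ∀ᵐ ω ∂P, ∀ i, (fun t => X i t ω) = (hm i).mk _ ω ∧ Continuous fun t => X i t ω :=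
    ae_all_iff.2 fun i => (hm i).ae_eq_mk.and (hcont i)
  -- The copies are only almost everywhere measurable into the product space. Outside a measurable
  -- null set they agree with measurable modifications and are continuous; on it the new field is
  -- set to 0.
  obtain ⟨S, hSsub, hSm, hS0⟩ := exists_measurable_superset_of_null (ae_iff.1 hae)
  have hG : ∀ ω ∈ Sᶜ, ∀ i, (fun t => X i t ω) = (hm i).mk _ ω ∧ Continuous fun t => X i t ω :=
    fun ω hω => by
      by_contra hcon
      exact hω (hSsub hcon)
  set Z : Fin p → EuclideanSpace ℝ (Fin N) → Ω → ℝ := fun i t =>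
    Sᶜ.indicator fun ω => (hm i).mk _ ω t with hZ
  have hZX : ∀ ω ∈ Sᶜ, ∀ i t, Z i t ω = X i t ω := fun ω hω i t => by
    rw [hZ]
    simp only
    rw [indicator_of_mem hω, ← (hG ω hω i).1]
  have hSae : ∀ᵐ ω ∂P, ω ∈ Sᶜ := by
    rw [ae_iff]; simpa using hS0
  have hpathae : ∀ i, (fun ω t => X i t ω) =ᵐ[P] fun ω t => Z i t ω := fun i => by
    filter_upwards [hSae] with ω hω
    ext t
    exact (hZX ω hω i t).symm
  have hid : ∀ i, IdentDistrib (fun ω t => Z i t ω) (fun ω t => Y t ω) P P' := fun i =>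
    (IdentDistrib.of_ae_eq (hm i) (hpathae i)).symm.trans (hX.identDistrib i)
  have hZm : ∀ i t, Measurable (Z i t) := fun i t =>
    ((measurable_pi_apply t).comp (hm i).measurable_mk).indicator hSm.compl
  refine ⟨Z, Sᶜ, ⟨hZm, fun i ω => ?_, hX.indep.congr hpathae, fun i => ⟨fun I => ⟨?_⟩⟩,
    fun i t => ?_, fun i s t => ?_, variogram_zero f, variogram_neg f⟩,
    hSm.compl, by simpa using hS0, fun ω hω => ?_⟩
  · by_cases hω : ω ∈ Sᶜ
    · simpa only [hZX ω hω i] using (hG ω hω i).2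
    · have : ∀ t, Z i t ω = 0 := fun t => indicator_of_notMem hω _
      simpa only [this] using continuous_const
  · have h1 := ((hid i).comp (Finset.measurable_restrict I)).map_eq
    have h2 := (hY.gaussian.hasGaussianLaw I).isGaussian_map
    change IsGaussian (P.map (I.restrict ∘ fun ω t => Z i t ω))
    rw [h1]
    exact h2
  · have h1 := ((hid i).comp (measurable_pi_apply t)).integral_eq
    exact h1.trans (hY.centered t)
  · have h1 := ((hid i).comp ((measurable_pi_apply s).mul (measurable_pi_apply t))).integral_eq
    exact h1.trans (hY.integral_mul_eq s t)
  · ext t i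
    exact hZX ω hω i t

theorem monotone_hurstBar {β : Fin N → ℝ} {γ : ℝ} (hH : Monotone (hurst β γ)) :
    Monotone (hurstBar β γ) := fun _ _ hij => min_le_min le_rfl (hH hij)

end AnisoField

/-! ### The theorem: both bounds combined and transferred to the given field -/

theorem corollary5p3 {N p : ℕ} (hN : 1 ≤ N) (hp : 1 ≤ p)
    {Ω Ω' : Type*} [MeasurableSpace Ω] [MeasurableSpace Ω']
    (P : Measure Ω) [IsProbabilityMeasure P] (P' : Measure Ω') [IsProbabilityMeasure P']
    (β : Fin N → ℝ) (γ : ℝ) (f : EuclideanSpace ℝ (Fin N) → ℝ)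
    (hf : AnisoField.SpectralCondition β γ f)
    (hH : Monotone (AnisoField.hurst β γ))
    (Y : EuclideanSpace ℝ (Fin N) → Ω' → ℝ) (hY : AnisoField.IsSIGaussianField Y P' f)
    (X : Fin p → EuclideanSpace ℝ (Fin N) → Ω → ℝ)
    (hX : AnisoField.IsIndependentCopies X P Y P')
    (hcont : ∀ i, ∀ᵐ ω ∂P, Continuous fun t => X i t ω) :
    (∀ᵐ ω ∂P,
      dimH (AnisoField.path X ω '' AnisoField.unitCube N) =
          ENNReal.ofReal (AnisoField.rangeDim p (AnisoField.hurstBar β γ)) ∧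
      dimH (AnisoField.graphOver (AnisoField.path X ω) (AnisoField.unitCube N)) =
          ENNReal.ofReal (AnisoField.graphDim p (AnisoField.hurstBar β γ))) ∧
    ((∀ j, AnisoField.hurst β γ j ≤ 1) → (p : ℝ) < ∑ j, 1 / AnisoField.hurst β γ j →
      ∀ x : EuclideanSpace ℝ (Fin p), ∃ A : Set Ω, MeasurableSet A ∧ 0 < P A ∧
        ∀ ω ∈ A, dimH {t : EuclideanSpace ℝ (Fin N) | AnisoField.path X ω t = x} =
          ENNReal.ofReal (AnisoField.levelDim p (AnisoField.hurst β γ))) := by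
  obtain ⟨Z, G, hZ, hGm, hG0, hGX⟩ := hX.exists_regular hY hcont
  have hpos := hf.hurstBar_pos
  have hmono := AnisoField.monotone_hurstBar hH
  have hup : AnisoField.VariogramUpper (AnisoField.variogram f) (AnisoField.hurstBar β γ) :=
    fun a ha0 ha M => hf.exists_variogram_le hY.density ha0 ha M
  have hlow : AnisoField.VariogramLower (AnisoField.variogram f) (AnisoField.hurstBar β γ) :=
    hf.exists_le_variogram hY.density
  have hv0 : ∀ t, t ≠ 0 → 0 < AnisoField.variogram f t := fun t ht =>
    hf.variogram_pos hY.density ht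
  have hGae : ∀ᵐ ω ∂P, ω ∈ G := hG0
  refine ⟨?_, fun hH1 hpH x => ?_⟩
  · filter_upwards [hGae, hZ.ae_dimH_range_le hpos hup, hZ.ae_le_dimH_range hN hpos hlow,
      hZ.ae_dimH_graph_le hpos (fun j => min_le_left _ _) hmono hup hN,
      hZ.ae_le_dimH_graph hN hpos hlow] with ω hω h1 h2 h3 h4
    rw [← hGX ω hω]
    exact ⟨le_antisymm h1 h2, le_antisymm h3 h4⟩
  · have hbar : AnisoField.hurstBar β γ = AnisoField.hurst β γ :=
      funext fun j => min_eq_right (hH1 j)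
    rw [hbar] at hpos hmono hup hlow
    obtain ⟨A, hAm, hA0, hA⟩ := hZ.exists_le_dimH_level hN hpos hlow
      hY.density.continuous_variogram hv0
      (fun m hm => hf.exists_cross_le hY.density hH1 hm) hpH x
    have hle := hGae.and (hZ.ae_dimH_level_le hpos hmono hup hN hv0 x)
    obtain ⟨S, hSsub, hSm, hS0⟩ := exists_measurable_superset_of_null (ae_iff.1 hle)
    -- Deleting a measurable null set makes the almost sure upper bound, and the agreement with the
    -- regular field, hold at every point of the event.
    refine ⟨A \ S, hAm.diff hSm, ?_, fun ω hω => ?_⟩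
    · rwa [measure_sdiff_null hS0]
    · have h1 : ω ∈ G ∧ dimH {t | AnisoField.path Z ω t = x} ≤
          ENNReal.ofReal (AnisoField.levelDim p (AnisoField.hurst β γ)) := by
        by_contra hcon
        exact hω.2 (hSsub hcon)
      rw [← hGX ω h1.1]
      exact le_antisymm h1.2 (hA ω hω.1)
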